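/- Let $\Gamma=\mathbb R^3/\mathbb Z^3$ be the unit torus and let $\Phi\in C^2(\mathbb R^3)$ be a nonnegative, radial, non-increasing potential with $\Phi(q)=0$ for $|q|>1$. Let $\beta>0$, let $M_\beta(v)=C_\beta e^{-\beta|v|^2/2}$ with $\int_{\mathbb R^3}M_\beta\,dv=1$, let $d\mu=M_\beta(v)\,dv$, and let $\mathbf H=L^2(\Gamma\times\mathbb R^3,dx\,d\mu)$. For $v,v_1\in\mathbb R^3$ write $V=v-v_1$. For $\alpha>0$ and a unit vector $\nu$ with $\nu\cdot V>0$, let $v'=v'(\nu,v,v_1)$ be the velocity after the collision of a particle of unit mass which arrives with velocity $v$ at distance one from a second particle of unit mass and velocity $v_1$, $\nu$ being the unit vector from the first particle to the second one at that moment, when the two particles move according to Newton's equations with the pair potential $\alpha^{-1/2}\Phi$. The linear Boltzmann operator is $$Q_Bf(x,v)=\alpha\int_{\mathbb R^3}dv_1\,M_\beta(v_1)\int_{\nu\in S^2,\ \nu\cdot V>0}d\nu\,|\nu\cdot V|\,\bigl[f(x,v')-f(x,v)\bigr],$$ and the linear Landau operator is $$Q_Lf(x,v)=A\int_{\mathbb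 R^3}dv_1\,M_\beta(v_1)\,\frac{1}{|V|^3}\Bigl[|V|^2\Delta_vf(x,v)-\bigl(V,D_v^2f(x,v)V\bigr)-4\,V\cdot\nabla_vf(x,v)\Bigr],$$ $$A=\frac1{8\pi}\int_0^\infty r^3\,\hat\Phi(r)^2\,dr,\qquad \hat\Phi(|k|)=\int_{\mathbb R^3}\Phi(x)e^{-ik\cdot x}\,dx .$$ Put $G_\alpha=Q_B-v\cdot\nabla_x$ and $G=Q_L-v\cdot\nabla_x$. Let $D$ be the space of smooth real functions $f(x,v)$ on $\Gamma\times\mathbb R^3$ (periodic in $x$) with compact support in $v$. Then for every $f\in D$ the integrals defining $Q_Bf(x,v)$ and $Q_Lf(x,v)$ converge absolutely for all $\alpha>0$ and all $x,v$, the functions $G_\alpha f$ and $Gf$ belong to $\mathbf H$, and $$\|(G_\alpha-G)f\|_{\mathbf H}\longrightarrow 0\qquad(\alpha\to\infty).$$ Moreover, there is a constant $C$, depending only on $f,\beta,\Phi$, such that for all $\alpha>0$ $$\|(G_\alpha-G)f\|_{\mathbf H}^2\le C\,\alpha^{-1/15}.$$ -/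

import Mathlib

open MeasureTheory Filter Topology Set
open scoped ENNReal ContDiff RealInnerProductSpace Gradient Laplacian

namespace LinearLandau

noncomputable section

/-- Euclidean three-space. -/
abbrev E3 : Type := EuclideanSpace ℝ (Fin 3)

/-- A nonnegative, radial, non-increasing, twice continuously differentiable pair potential on
`ℝ³` that vanishes outside the unit ball. -/
structure IsPairPotential (Φ : E3 → ℝ) : Prop where
  contDiff : ContDiff ℝ 2 Φ
  nonneg : ∀ q, 0 ≤ Φ q
  radial : ∀ q q', ‖q‖ = ‖q'‖ → Φ q = Φ q'
  antitone : ∀ q q', ‖q‖ ≤ ‖q'‖ → Φ q' ≤ Φ q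
  shortRange : ∀ q, 1 < ‖q‖ → Φ q = 0

/-! ### The collision of two particles -/

/-- `q₁, q₂` (positions) and `w₁, w₂` (velocities) solve Newton's equations for two particles of
unit mass that interact through the pair potential `α ^ (-1/2) • Φ`. -/
structure IsTwoBodyMotion (Φ : E3 → ℝ) (α : ℝ) (q₁ q₂ w₁ w₂ : ℝ → E3) : Prop where
  vel₁ : ∀ t, HasDerivAt q₁ (w₁ t) t
  vel₂ : ∀ t, HasDerivAt q₂ (w₂ t) t
  acc₁ : ∀ t, HasDerivAt w₁ (-(1 / √α) • ∇ Φ (q₁ t - q₂ t)) t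
  acc₂ : ∀ t, HasDerivAt w₂ (-(1 / √α) • ∇ Φ (q₂ t - q₁ t)) t

/-- `v'` is the velocity after the collision of a particle of velocity `v` with a particle of
velocity `v₁`, where `ν` points from the first particle to the second one at the moment when they
come into contact (at distance one). -/
def IsPostCollisional (Φ : E3 → ℝ) (α : ℝ) (ν v v₁ v' : E3) : Prop :=
  ∃ q₁ q₂ w₁ w₂ : ℝ → E3, IsTwoBodyMotion Φ α q₁ q₂ w₁ w₂ ∧
    q₂ 0 - q₁ 0 = ν ∧ w₁ 0 = v ∧ w₂ 0 = v₁ ∧ Tendsto w₁ atTop (𝓝 v')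

open Classical in
/-- The post-collisional velocity `v'` as a function of `ν`, `v`, `v₁`. -/
def postVelocity (Φ : E3 → ℝ) (α : ℝ) (ν v v₁ : E3) : E3 :=
  if h : ∃ v', IsPostCollisional Φ α ν v v₁ v' then h.choose else v

/-! ### The equilibrium and the Hilbert space -/

/-- The Maxwellian `M_β(v) = C_β exp (-β |v|² / 2)`, normalised to have integral one. -/
def maxwellian (β : ℝ) (v : E3) : ℝ :=
  (∫ w : E3, Real.exp (-(β / 2) * ‖w‖ ^ 2))⁻¹ * Real.exp (-(β / 2) * ‖v‖ ^ 2)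

/-- The measure `dμ = M_β(v) dv`. -/
def maxwellMeasure (β : ℝ) : Measure E3 :=
  volume.withDensity fun v => ENNReal.ofReal (maxwellian β v)

/-- The fundamental cell `[0, 1)³` of the unit torus `Γ = ℝ³ / ℤ³`. Functions on `Γ` are
`ℤ³`-periodic functions on `ℝ³`. -/
def unitCell : Set E3 := {x | ∀ i, x i ∈ Ico (0 : ℝ) 1}

/-- The measure `dx dμ` on `Γ × ℝ³`, so that `𝐇` is the `L²` space of `phaseMeasure β`. -/
def phaseMeasure (β : ℝ) : Measure (E3 × E3) :=
  (volume.restrict unitCell).prod (maxwellMeasure β)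

/-- `F` represents an element of `𝐇`. -/
def MemH (β : ℝ) (F : E3 → E3 → ℝ) : Prop :=
  MemLp (fun z : E3 × E3 => F z.1 z.2) 2 (phaseMeasure β)

/-- The norm of `𝐇` (infinite for a function that does not belong to `𝐇`). -/
def normH (β : ℝ) (F : E3 → E3 → ℝ) : ℝ≥0∞ :=
  eLpNorm (fun z : E3 × E3 => F z.1 z.2) 2 (phaseMeasure β)

/-- The class `D` of smooth functions on `Γ × ℝ³`, i.e. smooth functions of `(x, v)` that are
`ℤ³`-periodic in `x`, with compact support in `v`. -/
structure IsCoreFunction (f : E3 → E3 → ℝ) : Prop where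
  smooth : ContDiff ℝ ∞ fun z : E3 × E3 => f z.1 z.2
  periodic : ∀ x v i, f (x + EuclideanSpace.single i 1) v = f x v
  compactSupport : ∃ R : ℝ, ∀ x v, R < ‖v‖ → f x v = 0

/-! ### The linear Boltzmann operator -/

/-- The unit sphere of `ℝ³`. -/
abbrev S2 : Type := Metric.sphere (0 : E3) 1

/-- The surface measure `dν` of the unit sphere. -/
def sphereMeasure : Measure S2 := (volume : Measure E3).toSphere

/-- The integrand `1_{ν · V > 0} |ν · V| (f(v') - f(v))`, with `V = v - v₁`, of the collision
integral of a function `f` of the velocity. -/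
def collisionIntegrand (Φ : E3 → ℝ) (α : ℝ) (f : E3 → ℝ) (v v₁ : E3) (ν : S2) : ℝ :=
  {ν : S2 | 0 < ⟪(ν : E3), v - v₁⟫}.indicator
    (fun ν => |⟪(ν : E3), v - v₁⟫| * (f (postVelocity Φ α ν v v₁) - f v)) ν

/-- The linear Boltzmann operator `Q_B`. -/
def boltzmannOp (Φ : E3 → ℝ) (β α : ℝ) (f : E3 → E3 → ℝ) (x v : E3) : ℝ :=
  α * ∫ v₁, maxwellian β v₁ * ∫ ν, collisionIntegrand Φ α (f x) v v₁ ν ∂sphereMeasure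

/-! ### The linear Landau operator -/

/-- `∫ Φ(x) exp (-i k · x) dx`. -/
def potentialFourier (Φ : E3 → ℝ) (k : E3) : ℂ :=
  ∫ x, (Φ x : ℂ) * Complex.exp (-(Complex.I * (⟪k, x⟫ : ℝ)))

/-- The Landau constant `A = (1 / 8π) ∫₀^∞ r³ Φ̂(r)² dr`; as `Φ` is radial, `Φ̂` is real and
`Φ̂(r)` is its value at any vector of length `r`. -/
def landauConst (Φ : E3 → ℝ) : ℝ :=
  1 / (8 * Real.pi) *
    ∫ r in Ioi (0 : ℝ), r ^ 3 * (potentialFourier Φ (EuclideanSpace.single 0 r)).re ^ 2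

/-- `|V|⁻³ [|V|² Δf(v) - (V, D²f(v) V) - 4 V · ∇f(v)]` with `V = v - v₁`, for a function `f` of
the velocity. -/
def landauIntegrand (f : E3 → ℝ) (v v₁ : E3) : ℝ :=
  1 / ‖v - v₁‖ ^ 3 *
    (‖v - v₁‖ ^ 2 * Δ f v - iteratedFDeriv ℝ 2 f v ![v - v₁, v - v₁] - 4 * ⟪v - v₁, ∇ f v⟫)

/-- The linear Landau operator `Q_L`. -/
def landauOp (Φ : E3 → ℝ) (β : ℝ) (f : E3 → E3 → ℝ) (x v : E3) : ℝ :=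
  landauConst Φ * ∫ v₁, maxwellian β v₁ * landauIntegrand (f x) v v₁

/-! ### The generators -/

/-- The transport term `v · ∇ₓ f`. -/
def transport (f : E3 → E3 → ℝ) (x v : E3) : ℝ := ⟪v, ∇ (fun y => f y v) x⟫

/-- The linear Boltzmann generator `G_α = Q_B - v · ∇ₓ`. -/
def boltzmannGen (Φ : E3 → ℝ) (β α : ℝ) (f : E3 → E3 → ℝ) (x v : E3) : ℝ :=
  boltzmannOp Φ β α f x v - transport f x v

/-- The linear Landau generator `G = Q_L - v · ∇ₓ`. -/
def landauGen (Φ : E3 → ℝ) (β : ℝ) (f : E3 → E3 → ℝ) (x v : E3) : ℝ :=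
  landauOp Φ β f x v - transport f x v

end

end LinearLandau

open LinearLandau

/-! Put `κ = α^(-1/2)`, so that `α κ² = 1`. A collision changes the velocity by a jump `J = v' - v`
of size `O(κ / |V|)`, and `Q_B f` is `α` times an average of `f(v + J) - f(v)`. After a Taylor
expansion in `J`, the terms of order `κ²` must produce `Q_L`.

Two-body dynamics. In relative coordinates the force is central and repulsive, so `x · w` is
nondecreasing and a particle that leaves the unit ball moves freely ever after. Only a head-on
trajectory can be trapped, and then its velocity tends to zero; hence `v'` always exists. Comparison
with the straight line (`exists_jump_bounds`) gives `|J - J₀| ≤ C κ² / |V|³` for the Born jump `J₀`,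
which integrates the force along the unperturbed line.

The first moment of `J` seems to need the Born series to second order. It does not: by symmetry
around the axis `V` the mean of `J` is parallel to `V`, and energy conservation gives `V · J =
-|J|²` off the head-on direction. So the drift is exactly a second moment of `J` (`integral_jump`),
and only second moments of `J₀` are needed.

These are computed in `integral_bornJump`. The flux `(ν · V) dν` is the area element of the
impact-parameter disc (`integral_flux`), and there `J₀` is `κ / |V|` times `kick`, the gradient of
the X-ray transform of `Φ`. The Fourier slice theorem and Plancherel turn `∫ |kick|²` into `4A`;
isotropy gives `2A` in each of the two transverse directions. Half of this is the diffusion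
coefficient, and the trace `4A` is the factor 4 in the drift.

Integration over `v₁`. Per relative velocity the error is `O(κ (1 + 1/|V|)⁴)`, which is not
integrable at `V = 0` in dimension three, but the two terms separately are `O((1 + 1/|V|)²)`. Since
`min 1 X ≤ X^θ` with `X = κ (1 + 1/|V|)²`, the error is `O(κ^θ (1 + 1/|V|)^(2 + 2θ))`, which is
integrable for `θ < 1/2`. With `θ = 1/15` this gives a bound `C α^(-1/30)` uniform in `(x, v)`. As
`dx dμ` is finite and the transport terms cancel, squaring gives the rate, and the rate gives the
convergence. -/

namespace LinearLandau

noncomputable section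

/-! ### Pair potentials: the force is central, repulsive, Lipschitz and of range one. -/

section

namespace IsPairPotential

variable {Φ : E3 → ℝ}

lemma hasFDerivAt (hΦ : IsPairPotential Φ) (x : E3) : HasFDerivAt Φ (fderiv ℝ Φ x) x :=
  (hΦ.contDiff.differentiable (by norm_num) x).hasFDerivAt

lemma contDiff_gradient (hΦ : IsPairPotential Φ) : ContDiff ℝ 1 (∇ Φ) := by
  have h : ContDiff ℝ 1 (fderiv ℝ Φ) := hΦ.contDiff.fderiv_right (by norm_num)
  exact (InnerProductSpace.toDual ℝ E3).symm.contDiff.comp h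

lemma continuous_gradient (hΦ : IsPairPotential Φ) : Continuous (∇ Φ) :=
  hΦ.contDiff_gradient.continuous

/-- Continuity extends the vanishing to the unit sphere itself, where every collision starts; so
there is no potential energy at contact. -/
lemma eq_zero_of_one_le (hΦ : IsPairPotential Φ) {x : E3} (hx : 1 ≤ ‖x‖) : Φ x = 0 := by
  have hc : Continuous fun t : ℝ => Φ (t • x) :=
    hΦ.contDiff.continuous.comp (by fun_prop)
  have h1 : Tendsto (fun t : ℝ => Φ (t • x)) (𝓝[>] 1) (𝓝 (Φ ((1 : ℝ) • x))) :=
    (hc.tendsto 1).mono_left nhdsWithin_le_nhds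
  have h2 : Tendsto (fun t : ℝ => Φ (t • x)) (𝓝[>] 1) (𝓝 0) := by
    refine tendsto_const_nhds.congr' ?_
    filter_upwards [self_mem_nhdsWithin] with t ht
    have ht : 1 < t := ht
    refine (hΦ.shortRange _ ?_).symm
    rw [norm_smul, Real.norm_eq_abs, abs_of_pos (by linarith)]
    nlinarith
  simpa using tendsto_nhds_unique h1 h2

/-- Zeros of a nonnegative function are minima; this covers the sphere as well as the exterior. -/
lemma gradient_eq_zero_of_one_le (hΦ : IsPairPotential Φ) {x : E3} (hx : 1 ≤ ‖x‖) :
    ∇ Φ x = 0 := by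
  have h : IsLocalMin Φ x := Eventually.of_forall fun y => by
    simpa [hΦ.eq_zero_of_one_le hx] using hΦ.nonneg y
  rw [gradient, h.fderiv_eq_zero]
  simp

lemma hasCompactSupport_gradient (hΦ : IsPairPotential Φ) : HasCompactSupport (∇ Φ) := by
  refine HasCompactSupport.intro (isCompact_closedBall (0 : E3) 1) fun x hx => ?_
  exact hΦ.gradient_eq_zero_of_one_le (by simpa using (not_le.1 (by simpa using hx)).le)

lemma hasCompactSupport (hΦ : IsPairPotential Φ) : HasCompactSupport Φ := by
  refine HasCompactSupport.intro (isCompact_closedBall (0 : E3) 1) fun x hx => ?_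
  exact hΦ.eq_zero_of_one_le (by simpa using (not_le.1 (by simpa using hx)).le)

lemma exists_gradient_bounds (hΦ : IsPairPotential Φ) : ∃ K : NNReal, 0 < K ∧
    (∀ x, ‖∇ Φ x‖ ≤ K) ∧ LipschitzWith K (∇ Φ) := by
  obtain ⟨L, hL⟩ := hΦ.contDiff_gradient.lipschitzWith_of_hasCompactSupport
    hΦ.hasCompactSupport_gradient (by norm_num)
  obtain ⟨B, hB⟩ := hΦ.continuous_gradient.bounded_above_of_compact_support
    hΦ.hasCompactSupport_gradient
  refine ⟨L + B.toNNReal + 1, by positivity, fun x => (hB x).trans ?_, hL.weaken ?_⟩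
  · push_cast
    have := Real.le_coe_toNNReal B
    have := L.2
    simp only [NNReal.val_eq_coe] at this
    linarith
  · rw [add_assoc]
    exact le_self_add

lemma gradient_map (hΦ : IsPairPotential Φ) (R : E3 ≃ₗᵢ[ℝ] E3) (x : E3) :
    ∇ Φ (R x) = R (∇ Φ x) := by
  have hR : Φ ∘ R = Φ := funext fun y => hΦ.radial _ _ (R.norm_map y)
  refine ext_inner_right ℝ fun y => ?_
  obtain ⟨z, rfl⟩ := R.surjective y
  rw [R.inner_map_map, inner_gradient_left, inner_gradient_left]
  have h1 : HasFDerivAt (Φ ∘ R) ((fderiv ℝ Φ (R x)).comp (R : E3 →L[ℝ] E3)) x :=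
    (hΦ.hasFDerivAt (R x)).comp x R.toContinuousLinearEquiv.hasFDerivAt
  rw [hR] at h1
  rw [← h1.unique (hΦ.hasFDerivAt x)]
  rfl

lemma gradient_neg (hΦ : IsPairPotential Φ) (x : E3) : ∇ Φ (-x) = -∇ Φ x :=
  hΦ.gradient_map (LinearIsometryEquiv.neg ℝ) x

/-- The reflection in the plane orthogonal to `y` fixes `x`, hence also `∇ Φ x`, and sends `y` to
`-y`. -/
lemma inner_gradient_of_inner_eq_zero (hΦ : IsPairPotential Φ) {x y : E3} (h : ⟪x, y⟫ = 0) :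
    ⟪∇ Φ x, y⟫ = 0 := by
  have hx : (ℝ ∙ y)ᗮ.reflection x = x := by
    rw [Submodule.reflection_eq_self_iff, Submodule.mem_orthogonal_singleton_iff_inner_left, h]
  have hy : (ℝ ∙ y)ᗮ.reflection y = -y :=
    Submodule.reflection_orthogonalComplement_singleton_eq_neg y
  have h1 := hΦ.gradient_map ((ℝ ∙ y)ᗮ.reflection) x
  rw [hx] at h1
  have h2 := (ℝ ∙ y)ᗮ.reflection.inner_map_map (∇ Φ x) y
  rw [← h1, hy, inner_neg_right] at h2
  linarith

/-- The curve `s ↦ exp s • x` has velocity `x` at `s = 0` and increasing norm on all of `ℝ`, so `Φ`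
is antitone along it; no case distinction at `x = 0` is needed. -/
lemma inner_gradient_self_nonpos (hΦ : IsPairPotential Φ) (x : E3) : ⟪∇ Φ x, x⟫ ≤ 0 := by
  have h1 : HasDerivAt (fun s : ℝ => Φ (Real.exp s • x)) (fderiv ℝ Φ x x) 0 := by
    have h2 : HasDerivAt (fun s : ℝ => Real.exp s • x) x 0 := by
      simpa using (Real.hasDerivAt_exp 0).smul_const x
    have h3 : HasFDerivAt Φ (fderiv ℝ Φ x) (Real.exp 0 • x) := by
      simpa using hΦ.hasFDerivAt x
    exact h3.comp_hasDerivAt 0 h2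
  have h2 : Antitone (fun s : ℝ => Φ (Real.exp s • x)) := fun s t hst => by
    refine hΦ.antitone _ _ ?_
    simp only [norm_smul, Real.norm_eq_abs, Real.abs_exp]
    gcongr
  rw [inner_gradient_left, ← h1.deriv]
  exact h2.deriv_nonpos

/-- The force is central and repulsive. -/
lemma exists_gradient_eq_smul (hΦ : IsPairPotential Φ) (x : E3) :
    ∃ c : ℝ, c ≤ 0 ∧ ∇ Φ x = c • x := by
  rcases eq_or_ne x 0 with rfl | hx
  · refine ⟨0, le_rfl, ?_⟩
    rw [zero_smul, ← inner_self_eq_zero (𝕜 := ℝ)]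
    exact hΦ.inner_gradient_of_inner_eq_zero (inner_zero_left _)
  · have hx2 : 0 < ‖x‖ ^ 2 := by positivity
    refine ⟨⟪∇ Φ x, x⟫ / ‖x‖ ^ 2, div_nonpos_of_nonpos_of_nonneg
      (hΦ.inner_gradient_self_nonpos x) hx2.le, ?_⟩
    set c := ⟪∇ Φ x, x⟫ / ‖x‖ ^ 2 with hc
    -- The residual `∇ Φ x - c • x` is orthogonal to `x`, hence to `∇ Φ x` as well, hence to itself.
    have h1 : ⟪x, ∇ Φ x - c • x⟫ = 0 := by
      rw [inner_sub_right, real_inner_smul_right, real_inner_self_eq_norm_sq, real_inner_comm, hc]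
      field_simp
      ring
    have h2 := hΦ.inner_gradient_of_inner_eq_zero h1
    rw [← sub_eq_zero, ← inner_self_eq_zero (𝕜 := ℝ), inner_sub_left, h2, real_inner_smul_left, h1]
    simp

end IsPairPotential

end

/-! ### Global existence, uniqueness and continuity of the relative motion. -/

section

open scoped Manifold in
/-- A globally Lipschitz `C¹` vector field is complete. -/
lemma exists_global_solution {E : Type*} [NormedAddCommGroup E] [NormedSpace ℝ E] [CompleteSpace E]
    {F : E → E} {K : NNReal} (hL : LipschitzWith K F) (hF : ContDiff ℝ 1 F) (x : E) :
    ∃ γ : ℝ → E, γ 0 = x ∧ ∀ t, HasDerivAt γ (F (γ t)) t := by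
  -- On the ball of radius `‖F y‖` around `y` the field is bounded by `(1 + K) ‖F y‖`, so a solution
  -- from `y` lives for the time `1 / (1 + K)`, whatever `y` is. A uniform lifetime implies
  -- completeness.
  have hT : (0 : ℝ) < 1 / (1 + K) := by positivity
  have hCM : ContMDiff 𝓘(ℝ, E) 𝓘(ℝ, E).tangent 1
      (fun x => (⟨x, F x⟩ : TangentBundle 𝓘(ℝ, E) E)) :=
    contMDiff_vectorSpace_iff_contDiff.2 hF
  obtain ⟨γ, h0, hγ⟩ := exists_isMIntegralCurve_of_isMIntegralCurveOn (I := 𝓘(ℝ, E)) (M := E)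
    (v := F) hCM hT (fun y => by
      have hpl : IsPicardLindelof (fun _ => F) (tmin := -(1 / (1 + K : ℝ))) (tmax := 1 / (1 + K))
          ⟨0, by constructor <;> linarith⟩ y (‖F y‖₊) 0 (‖F y‖₊ + K * ‖F y‖₊) K := by
        refine IsPicardLindelof.of_time_independent (fun z hz => ?_) hL.lipschitzOnWith ?_
        · have h1 : ‖F z‖ ≤ ‖F z - F y‖ + ‖F y‖ := by
            simpa using norm_add_le (F z - F y) (F y)
          have h2 : ‖F z - F y‖ ≤ K * ‖z - y‖ := by
            simpa [dist_eq_norm] using hL.dist_le_mul z y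
          have h3 : ‖z - y‖ ≤ ‖F y‖ := by simpa [dist_eq_norm] using hz
          have h4 : (K : ℝ) * ‖z - y‖ ≤ K * ‖F y‖ := by gcongr
          push_cast
          linarith
        · simp only [sub_zero, zero_sub, neg_neg, max_self, NNReal.coe_zero]
          push_cast
          have : (1 + K : ℝ) ≠ 0 := by positivity
          apply le_of_eq
          field_simp
      obtain ⟨α, h0, hα⟩ := hpl.exists_eq_forall_mem_Icc_hasDerivWithinAt₀
      refine ⟨α, h0, fun t ht => ?_⟩
      exact ((hα t (Ioo_subset_Icc_self ht)).mono
        Ioo_subset_Icc_self).hasFDerivWithinAt.hasMFDerivWithinAt) x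
  refine ⟨γ, h0, fun t => ?_⟩
  have h : HasFDerivAt γ ((1 : ℝ →L[ℝ] ℝ).smulRight (F (γ t)) : ℝ →L[ℝ] E) t :=
    (hγ t).hasFDerivAt
  exact h.hasDerivAt.congr_deriv (by simp)

/-- The relative position `x` and the relative velocity `w` of two particles that interact through
the potential `κ • Φ`. -/
structure IsRelMotion (Φ : E3 → ℝ) (κ : ℝ) (x w : ℝ → E3) : Prop where
  pos : ∀ t, HasDerivAt x (w t) t
  vel : ∀ t, HasDerivAt w (-(2 * κ) • ∇ Φ (x t)) t

/-- The vector field of the relative motion. -/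
def relField (Φ : E3 → ℝ) (κ : ℝ) (z : E3 × E3) : E3 × E3 := (z.2, -(2 * κ) • ∇ Φ z.1)

section

variable {Φ : E3 → ℝ} {κ : ℝ}

lemma IsPairPotential.exists_lipschitzWith_relField (hΦ : IsPairPotential Φ) (κ : ℝ) :
    ∃ L : NNReal, LipschitzWith L (relField Φ κ) := by
  obtain ⟨K, -, -, hK⟩ := hΦ.exists_gradient_bounds
  refine ⟨_, LipschitzWith.prodMk LipschitzWith.prod_snd
    ((lipschitzWith_smul (-(2 * κ))).comp (hK.comp LipschitzWith.prod_fst))⟩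

lemma isRelMotion_iff {x w : ℝ → E3} : IsRelMotion Φ κ x w ↔
    ∀ t, HasDerivAt (fun t => (x t, w t)) (relField Φ κ (x t, w t)) t := by
  refine ⟨fun h t => (h.pos t).prodMk (h.vel t), fun h => ⟨fun t => ?_, fun t => ?_⟩⟩
  · exact (hasFDerivAt_fst (𝕜 := ℝ) (p := (x t, w t))).comp_hasDerivAt t (h t)
  · exact (hasFDerivAt_snd (𝕜 := ℝ) (p := (x t, w t))).comp_hasDerivAt t (h t)

lemma IsPairPotential.exists_isRelMotion (hΦ : IsPairPotential Φ) (κ : ℝ) (x₀ w₀ : E3) :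
    ∃ x w : ℝ → E3, IsRelMotion Φ κ x w ∧ x 0 = x₀ ∧ w 0 = w₀ := by
  obtain ⟨L, hL⟩ := hΦ.exists_lipschitzWith_relField κ
  have hF : ContDiff ℝ 1 (relField Φ κ) :=
    contDiff_snd.prodMk ((hΦ.contDiff_gradient.comp contDiff_fst).const_smul (-(2 * κ)))
  obtain ⟨γ, h0, hγ⟩ := exists_global_solution hL hF (x₀, w₀)
  exact ⟨fun t => (γ t).1, fun t => (γ t).2, isRelMotion_iff.2 hγ, by simp [h0], by simp [h0]⟩

lemma IsRelMotion.continuous_pos {x w : ℝ → E3} (h : IsRelMotion Φ κ x w) : Continuous x :=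
  continuous_iff_continuousAt.2 fun t => (h.pos t).continuousAt

lemma IsRelMotion.continuous_vel {x w : ℝ → E3} (h : IsRelMotion Φ κ x w) : Continuous w :=
  continuous_iff_continuousAt.2 fun t => (h.vel t).continuousAt

/-- Grönwall's inequality; it yields uniqueness and also the continuity of the flow in its initial
data. -/
lemma IsPairPotential.exists_dist_relMotion_le (hΦ : IsPairPotential Φ) (κ : ℝ) :
    ∃ L : ℝ, ∀ x w y u : ℝ → E3, IsRelMotion Φ κ x w → IsRelMotion Φ κ y u → ∀ t, 0 ≤ t →
      dist (x t, w t) (y t, u t) ≤ dist (x 0, w 0) (y 0, u 0) * Real.exp (L * t) := by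
  obtain ⟨L, hL⟩ := hΦ.exists_lipschitzWith_relField κ
  refine ⟨L, fun x w y u h h' t ht => ?_⟩
  have := dist_le_of_trajectories_ODE (v := fun _ => relField Φ κ) (a := 0) (b := t)
    (f := fun t => (x t, w t)) (g := fun t => (y t, u t)) (fun _ => hL)
    (h.continuous_pos.prodMk h.continuous_vel).continuousOn
    (fun s _ => (isRelMotion_iff.1 h s).hasDerivWithinAt)
    (h'.continuous_pos.prodMk h'.continuous_vel).continuousOn
    (fun s _ => (isRelMotion_iff.1 h' s).hasDerivWithinAt) le_rfl t (right_mem_Icc.2 ht)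
  simpa using this

lemma IsPairPotential.relMotion_unique (hΦ : IsPairPotential Φ) {x w y u : ℝ → E3}
    (h : IsRelMotion Φ κ x w) (h' : IsRelMotion Φ κ y u) (hx : x 0 = y 0) (hw : w 0 = u 0)
    {t : ℝ} (ht : 0 ≤ t) : x t = y t ∧ w t = u t := by
  obtain ⟨L, hL⟩ := hΦ.exists_dist_relMotion_le κ
  have := hL x w y u h h' t ht
  rw [hx, hw, dist_self, zero_mul] at this
  simpa using dist_le_zero.1 this

open Classical in
/-- The relative velocity at time `t` as a function of the initial data. -/
def relVel (Φ : E3 → ℝ) (κ : ℝ) (t : ℝ) (z : E3 × E3) : E3 :=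
  if h : ∃ p : (ℝ → E3) × (ℝ → E3), IsRelMotion Φ κ p.1 p.2 ∧ p.1 0 = z.1 ∧ p.2 0 = z.2 then
    h.choose.2 t else 0

lemma IsPairPotential.relVel_eq (hΦ : IsPairPotential Φ) {x w : ℝ → E3}
    (h : IsRelMotion Φ κ x w) {t : ℝ} (ht : 0 ≤ t) : relVel Φ κ t (x 0, w 0) = w t := by
  have hex : ∃ p : (ℝ → E3) × (ℝ → E3), IsRelMotion Φ κ p.1 p.2 ∧ p.1 0 = x 0 ∧ p.2 0 = w 0 :=
    ⟨(x, w), h, rfl, rfl⟩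
  rw [relVel, dif_pos hex]
  obtain ⟨h1, h2, h3⟩ := hex.choose_spec
  exact (hΦ.relMotion_unique h1 h h2 h3 ht).2

/-- This serves the measurability of `jump`, which is a pointwise limit of these maps along integer
times. -/
lemma IsPairPotential.continuous_relVel (hΦ : IsPairPotential Φ) (κ : ℝ) {t : ℝ} (ht : 0 ≤ t) :
    Continuous (relVel Φ κ t) := by
  obtain ⟨L, hL⟩ := hΦ.exists_dist_relMotion_le κ
  refine (LipschitzWith.of_dist_le_mul (K := (Real.exp (L * t)).toNNReal) fun z z' => ?_).continuous
  obtain ⟨x, w, h, h1, h2⟩ := hΦ.exists_isRelMotion κ z.1 z.2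
  obtain ⟨y, u, h', h1', h2'⟩ := hΦ.exists_isRelMotion κ z'.1 z'.2
  have hz : z = (x 0, w 0) := by rw [h1, h2]
  have hz' : z' = (y 0, u 0) := by rw [h1', h2']
  rw [Real.coe_toNNReal _ (Real.exp_pos _).le, hz, hz', hΦ.relVel_eq h ht, hΦ.relVel_eq h' ht,
    mul_comm]
  refine le_trans ?_ (hL x w y u h h' t ht)
  rw [Prod.dist_eq (x := (x t, w t))]
  exact le_max_right _ _

end

end

/-! ### Scattering: conservation laws, escape or trapping, and the post-collisional velocity. -/

section

namespace IsRelMotion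

variable {Φ : E3 → ℝ} {κ : ℝ} {x w : ℝ → E3}

lemma hasDerivAt_norm_sq_pos (h : IsRelMotion Φ κ x w) (t : ℝ) :
    HasDerivAt (fun t => ‖x t‖ ^ 2) (2 * ⟪x t, w t⟫) t :=
  (h.pos t).norm_sq

lemma hasDerivAt_norm_sq_vel (h : IsRelMotion Φ κ x w) (t : ℝ) :
    HasDerivAt (fun t => ‖w t‖ ^ 2) (-(4 * κ) * ⟪∇ Φ (x t), w t⟫) t :=
  (h.vel t).norm_sq.congr_deriv (by rw [real_inner_smul_right, real_inner_comm]; ring)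

lemma hasDerivAt_virial (h : IsRelMotion Φ κ x w) (t : ℝ) :
    HasDerivAt (fun t => ⟪x t, w t⟫) (‖w t‖ ^ 2 - 2 * κ * ⟪∇ Φ (x t), x t⟫) t :=
  ((h.pos t).inner ℝ (h.vel t)).congr_deriv (by
    rw [real_inner_smul_right, real_inner_comm (x t), real_inner_self_eq_norm_sq]; ring)

/-- Conservation of energy. -/
lemma energy_eq (hΦ : IsPairPotential Φ) (h : IsRelMotion Φ κ x w) (s t : ℝ) :
    ‖w s‖ ^ 2 + 4 * κ * Φ (x s) = ‖w t‖ ^ 2 + 4 * κ * Φ (x t) := by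
  have hd : ∀ t, HasDerivAt (fun t => ‖w t‖ ^ 2 + 4 * κ * Φ (x t)) 0 t := fun t => by
    have h1 : HasDerivAt (fun t => Φ (x t)) (fderiv ℝ Φ (x t) (w t)) t :=
      (hΦ.hasFDerivAt (x t)).comp_hasDerivAt t (h.pos t)
    refine ((h.hasDerivAt_norm_sq_vel t).add (h1.const_mul (4 * κ))).congr_deriv ?_
    rw [← inner_gradient_left]
    ring
  exact is_const_of_deriv_eq_zero (fun t => (hd t).differentiableAt) (fun t => (hd t).deriv) s t

/-- Conservation of the square of the angular momentum. -/
lemma gram_eq (hΦ : IsPairPotential Φ) (h : IsRelMotion Φ κ x w) (s t : ℝ) :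
    ‖x s‖ ^ 2 * ‖w s‖ ^ 2 - ⟪x s, w s⟫ ^ 2 = ‖x t‖ ^ 2 * ‖w t‖ ^ 2 - ⟪x t, w t⟫ ^ 2 := by
  have hd : ∀ t, HasDerivAt (fun t => ‖x t‖ ^ 2 * ‖w t‖ ^ 2 - ⟪x t, w t⟫ ^ 2) 0 t := fun t => by
    refine (((h.hasDerivAt_norm_sq_pos t).mul (h.hasDerivAt_norm_sq_vel t)).sub
      ((h.hasDerivAt_virial t).pow 2)).congr_deriv ?_
    obtain ⟨c, -, hc⟩ := hΦ.exists_gradient_eq_smul (x t)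
    rw [hc, real_inner_smul_left, real_inner_smul_left, real_inner_self_eq_norm_sq]
    ring
  exact is_const_of_deriv_eq_zero (f := fun t => ‖x t‖ ^ 2 * ‖w t‖ ^ 2 - ⟪x t, w t⟫ ^ 2)
    (fun t => (hd t).differentiableAt) (fun t => (hd t).deriv) s t

/-- The right side is the time derivative of `x · w`; repulsion makes it at least the square of the
speed. -/
lemma norm_sq_le_deriv_virial (hΦ : IsPairPotential Φ) (hκ : 0 ≤ κ) (t : ℝ) :
    ‖w t‖ ^ 2 ≤ ‖w t‖ ^ 2 - 2 * κ * ⟪∇ Φ (x t), x t⟫ := by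
  have := mul_nonneg hκ (neg_nonneg.2 (hΦ.inner_gradient_self_nonpos (x t)))
  linarith

lemma monotone_virial (hΦ : IsPairPotential Φ) (hκ : 0 ≤ κ) (h : IsRelMotion Φ κ x w) :
    Monotone fun t => ⟪x t, w t⟫ :=
  monotone_of_hasDerivAt_nonneg h.hasDerivAt_virial fun t =>
    (sq_nonneg _).trans (norm_sq_le_deriv_virial hΦ hκ t)

/-- The derivative `2 x · w` of `‖x‖²` is nondecreasing, so `‖x‖²` is convex in time and lies above
its tangents. -/
lemma norm_pos_le_of_virial (hΦ : IsPairPotential Φ) (hκ : 0 ≤ κ) (h : IsRelMotion Φ κ x w)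
    {s t : ℝ} (hst : s ≤ t) :
    ‖x s‖ ^ 2 + 2 * ⟪x s, w s⟫ * (t - s) ≤ ‖x t‖ ^ 2 := by
  have := (convex_Ici s).mul_sub_le_image_sub_of_le_deriv (f := fun t => ‖x t‖ ^ 2)
    (C := 2 * ⟪x s, w s⟫)
    (fun t _ => (h.hasDerivAt_norm_sq_pos t).continuousAt.continuousWithinAt)
    (fun t _ => (h.hasDerivAt_norm_sq_pos t).differentiableAt.differentiableWithinAt)
    (fun t ht => by
      rw [(h.hasDerivAt_norm_sq_pos t).deriv]
      have := h.monotone_virial hΦ hκ (interior_subset ht : t ∈ Ici s)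
      simp only at this
      linarith) s self_mem_Ici t hst hst
  linarith

lemma norm_pos_le_of_virial_nonpos (hΦ : IsPairPotential Φ) (hκ : 0 ≤ κ) (h : IsRelMotion Φ κ x w)
    {s t : ℝ} (ht : ⟪x t, w t⟫ ≤ 0) (hst : s ≤ t) : ‖x t‖ ^ 2 ≤ ‖x s‖ ^ 2 := by
  refine antitoneOn_of_deriv_nonpos (convex_Iic t) (f := fun t => ‖x t‖ ^ 2)
    (fun t _ => (h.hasDerivAt_norm_sq_pos t).continuousAt.continuousWithinAt)
    (fun t _ => (h.hasDerivAt_norm_sq_pos t).differentiableAt.differentiableWithinAt)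
    (fun s hs => ?_) hst self_mem_Iic hst
  rw [(h.hasDerivAt_norm_sq_pos s).deriv]
  have := h.monotone_virial hΦ hκ (interior_subset hs : s ∈ Iic t)
  simp only at this
  linarith

/-- By convexity of `‖x‖²` an outgoing particle outside the ball stays outside, where there is no
force. -/
lemma vel_eq_of_escaped (hΦ : IsPairPotential Φ) (hκ : 0 ≤ κ) (h : IsRelMotion Φ κ x w)
    {s t : ℝ} (hx : 1 ≤ ‖x s‖) (hs : 0 ≤ ⟪x s, w s⟫) (hst : s ≤ t) : w t = w s := by
  refine constant_of_has_deriv_right_zero (a := s) (b := t) h.continuous_vel.continuousOn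
    (fun r hr => ?_) t (right_mem_Icc.2 hst)
  have h1 := h.norm_pos_le_of_virial hΦ hκ hr.1
  have h2 : 1 ≤ ‖x r‖ := by
    have : 0 ≤ 2 * ⟪x s, w s⟫ * (r - s) := by
      have := hr.1
      have : 0 ≤ r - s := by linarith
      positivity
    by_contra! hlt
    nlinarith [norm_nonneg (x r)]
  have h3 := h.vel r
  rw [hΦ.gradient_eq_zero_of_one_le h2, smul_zero] at h3
  exact h3.hasDerivWithinAt

/-- If `x · w = m > 0` at some time, then `‖x‖²` grows at rate at least `2m`; after a further time
`1 / (2m)` the particle is outgoing with `‖x‖ ≥ 1`, against the trapping hypothesis. -/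
lemma virial_nonpos_of_trapped (hΦ : IsPairPotential Φ) (hκ : 0 ≤ κ) (h : IsRelMotion Φ κ x w)
    (htrap : ∀ t, 0 ≤ t → 0 ≤ ⟪x t, w t⟫ → ‖x t‖ < 1) {t : ℝ} (ht : 0 ≤ t) :
    ⟪x t, w t⟫ ≤ 0 := by
  by_contra! hm
  set m := ⟪x t, w t⟫ with hmdef
  have hT : t ≤ t + 1 / (2 * m) := by
    have : 0 < 1 / (2 * m) := by positivity
    linarith
  have h1 := h.norm_pos_le_of_virial hΦ hκ hT
  have h2 : 2 * m * (t + 1 / (2 * m) - t) = 1 := by field_simp; ring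
  have h3 := htrap _ (ht.trans hT) (hm.le.trans (h.monotone_virial hΦ hκ hT))
  rw [← hmdef, h2] at h1
  nlinarith [norm_nonneg (x (t + 1 / (2 * m))), sq_nonneg ‖x t‖]

/-- A trapped particle is never outgoing, so repulsion only slows it down. Its speed cannot stay
above `η`: then `x · w` would grow at rate at least `η²` and become positive. -/
lemma tendsto_zero_of_trapped (hΦ : IsPairPotential Φ) (hκ : 0 ≤ κ) (h : IsRelMotion Φ κ x w)
    (htrap : ∀ t, 0 ≤ t → 0 ≤ ⟪x t, w t⟫ → ‖x t‖ < 1) : Tendsto w atTop (𝓝 0) := by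
  have hanti : AntitoneOn (fun t => ‖w t‖ ^ 2) (Ici 0) := by
    refine antitoneOn_of_deriv_nonpos (convex_Ici 0)
      (fun t _ => (h.hasDerivAt_norm_sq_vel t).continuousAt.continuousWithinAt)
      (fun t _ => (h.hasDerivAt_norm_sq_vel t).differentiableAt.differentiableWithinAt)
      (fun t ht => ?_)
    rw [(h.hasDerivAt_norm_sq_vel t).deriv]
    obtain ⟨c, hc0, hc⟩ := hΦ.exists_gradient_eq_smul (x t)
    rw [hc, real_inner_smul_left]
    have hm := h.virial_nonpos_of_trapped hΦ hκ htrap (interior_subset ht : t ∈ Ici 0)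
    have := mul_nonneg hκ (mul_nonneg_of_nonpos_of_nonpos hc0 hm)
    linarith
  rw [tendsto_zero_iff_norm_tendsto_zero, Metric.tendsto_atTop]
  intro η hη
  have hex : ∃ t, 0 ≤ t ∧ ‖w t‖ ^ 2 < η ^ 2 := by
    by_contra! hcon
    set m := ⟪x 0, w 0⟫ with hm
    set T := (|m| + 1) / η ^ 2 with hT
    have hT0 : 0 ≤ T := by positivity
    have h1 := (convex_Ici (0 : ℝ)).mul_sub_le_image_sub_of_le_deriv (f := fun t => ⟪x t, w t⟫)
      (C := η ^ 2)
      (fun t _ => (h.hasDerivAt_virial t).continuousAt.continuousWithinAt)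
      (fun t _ => (h.hasDerivAt_virial t).differentiableAt.differentiableWithinAt)
      (fun t ht => by
        rw [(h.hasDerivAt_virial t).deriv]
        exact (hcon t (interior_subset ht : t ∈ Ici 0)).trans (norm_sq_le_deriv_virial hΦ hκ t))
      0 self_mem_Ici T hT0 hT0
    have h2 := h.virial_nonpos_of_trapped hΦ hκ htrap hT0
    have h3 : η ^ 2 * (T - 0) = |m| + 1 := by rw [hT]; field_simp; ring
    have h4 := neg_abs_le m
    rw [h3, ← hm] at h1
    linarith
  obtain ⟨T, hT0, hT⟩ := hex
  refine ⟨T, fun t ht => ?_⟩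
  have h1 := hanti hT0 (hT0.trans ht : (0 : ℝ) ≤ t) ht
  simp only at h1
  rw [Real.dist_eq, sub_zero, abs_of_nonneg (norm_nonneg _)]
  exact lt_of_pow_lt_pow_left₀ 2 hη.le (h1.trans_lt hT)

/-- The position stays bounded while the velocity tends to zero, so the conserved angular momentum
must vanish: only head-on motions can be trapped. -/
lemma norm_mul_norm_eq_of_trapped (hΦ : IsPairPotential Φ) (hκ : 0 ≤ κ) (h : IsRelMotion Φ κ x w)
    (htrap : ∀ t, 0 ≤ t → 0 ≤ ⟪x t, w t⟫ → ‖x t‖ < 1) :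
    ‖x 0‖ ^ 2 * ‖w 0‖ ^ 2 = ⟪x 0, w 0⟫ ^ 2 := by
  have h1 : Tendsto (fun t => ‖x 0‖ ^ 2 * ‖w t‖ ^ 2) atTop (𝓝 0) := by
    simpa using ((h.tendsto_zero_of_trapped hΦ hκ htrap).norm.pow 2).const_mul (‖x 0‖ ^ 2)
  have h2 : ‖x 0‖ ^ 2 * ‖w 0‖ ^ 2 - ⟪x 0, w 0⟫ ^ 2 ≤ 0 := by
    refine ge_of_tendsto h1 ?_
    filter_upwards [eventually_ge_atTop 0] with t ht
    rw [h.gram_eq hΦ 0 t]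
    have h3 := h.norm_pos_le_of_virial_nonpos hΦ hκ
      (h.virial_nonpos_of_trapped hΦ hκ htrap ht) ht
    have h4 : ‖x t‖ ^ 2 * ‖w t‖ ^ 2 ≤ ‖x 0‖ ^ 2 * ‖w t‖ ^ 2 := by gcongr
    linarith [sq_nonneg ⟪x t, w t⟫]
  have h3 := abs_real_inner_le_norm (x 0) (w 0)
  have h4 : ⟪x 0, w 0⟫ ^ 2 ≤ (‖x 0‖ * ‖w 0‖) ^ 2 := by
    rw [← sq_abs]
    gcongr
  rw [mul_pow] at h4
  linarith

lemma exists_tendsto_vel (hΦ : IsPairPotential Φ) (hκ : 0 ≤ κ) (h : IsRelMotion Φ κ x w) :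
    ∃ u, Tendsto w atTop (𝓝 u) := by
  by_cases htrap : ∀ t, 0 ≤ t → 0 ≤ ⟪x t, w t⟫ → ‖x t‖ < 1
  · exact ⟨0, h.tendsto_zero_of_trapped hΦ hκ htrap⟩
  · push Not at htrap
    obtain ⟨s, -, hs, hx⟩ := htrap
    refine ⟨w s, tendsto_const_nhds.congr' ?_⟩
    filter_upwards [eventually_ge_atTop s] with t ht
    exact (h.vel_eq_of_escaped hΦ hκ hx hs ht).symm

end IsRelMotion

/-- The change of velocity `v' - v` in a collision as a function of the direction `ν` of the second
particle, and the relative velocity `V`, at the moment of contact. -/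
def jump (Φ : E3 → ℝ) (κ : ℝ) (ν V : E3) : E3 :=
  (1 / 2 : ℝ) • (limUnder atTop (fun n : ℕ => relVel Φ κ n (-ν, V)) - V)

variable {Φ : E3 → ℝ} {κ : ℝ}

/-- The factor 2 appears because the two particles share the change of relative velocity equally, by
conservation of momentum. -/
lemma IsRelMotion.tendsto_jump (hΦ : IsPairPotential Φ) (hκ : 0 ≤ κ) {x w : ℝ → E3}
    (h : IsRelMotion Φ κ x w) {ν V : E3} (hx : x 0 = -ν) (hw : w 0 = V) :
    Tendsto w atTop (𝓝 (V + (2 : ℝ) • jump Φ κ ν V)) := by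
  obtain ⟨u, hu⟩ := h.exists_tendsto_vel hΦ hκ
  have h1 : Tendsto (fun n : ℕ => relVel Φ κ n (-ν, V)) atTop (𝓝 u) := by
    refine (hu.comp tendsto_natCast_atTop_atTop).congr fun n => ?_
    rw [← hx, ← hw, hΦ.relVel_eq h n.cast_nonneg]
    rfl
  convert hu using 2
  rw [jump, h1.limUnder_eq]
  module

lemma IsPairPotential.exists_isRelMotion_jump (hΦ : IsPairPotential Φ) (hκ : 0 ≤ κ) (ν V : E3) :
    ∃ x w : ℝ → E3, IsRelMotion Φ κ x w ∧ x 0 = -ν ∧ w 0 = V ∧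
      Tendsto w atTop (𝓝 (V + (2 : ℝ) • jump Φ κ ν V)) := by
  obtain ⟨x, w, h, hx, hw⟩ := hΦ.exists_isRelMotion κ (-ν) V
  exact ⟨x, w, h, hx, hw, h.tendsto_jump hΦ hκ hx hw⟩

lemma IsPairPotential.measurable_jump (hΦ : IsPairPotential Φ) (hκ : 0 ≤ κ) :
    Measurable fun p : E3 × E3 => jump Φ κ p.1 p.2 := by
  refine measurable_of_tendsto_metrizable
    (f := fun (n : ℕ) (p : E3 × E3) => (1 / 2 : ℝ) • (relVel Φ κ n (-p.1, p.2) - p.2))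
    (fun n => ?_) (tendsto_pi_nhds.2 fun p => ?_)
  · have := hΦ.continuous_relVel κ n.cast_nonneg
    exact Continuous.measurable (by fun_prop)
  · obtain ⟨x, w, h, hx, hw, hlim⟩ := hΦ.exists_isRelMotion_jump hκ p.1 p.2
    have h1 : Tendsto (fun n : ℕ => (1 / 2 : ℝ) • (relVel Φ κ n (-p.1, p.2) - p.2)) atTop
        (𝓝 ((1 / 2 : ℝ) • ((p.2 + (2 : ℝ) • jump Φ κ p.1 p.2) - p.2))) := by
      refine ((hlim.comp tendsto_natCast_atTop_atTop).sub_const p.2).const_smul (1 / 2 : ℝ)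
        |>.congr fun n => ?_
      have h2 := hΦ.relVel_eq h n.cast_nonneg
      rw [hx, hw] at h2
      rw [h2]
      rfl
    convert h1 using 2
    module

lemma IsRelMotion.map {x w : ℝ → E3} (hΦ : IsPairPotential Φ) (h : IsRelMotion Φ κ x w)
    (R : E3 ≃ₗᵢ[ℝ] E3) : IsRelMotion Φ κ (fun t => R (x t)) (fun t => R (w t)) where
  pos t := R.toContinuousLinearEquiv.hasFDerivAt.comp_hasDerivAt t (h.pos t)
  vel t := by
    rw [hΦ.gradient_map, ← map_smul]
    exact R.toContinuousLinearEquiv.hasFDerivAt.comp_hasDerivAt t (h.vel t)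

/-- A rotated motion is again a motion, because the potential is radial; uniqueness then identifies
the limits. -/
lemma IsPairPotential.jump_map (hΦ : IsPairPotential Φ) (hκ : 0 ≤ κ) (R : E3 ≃ₗᵢ[ℝ] E3)
    (ν V : E3) : jump Φ κ (R ν) (R V) = R (jump Φ κ ν V) := by
  obtain ⟨x, w, h, hx, hw, hlim⟩ := hΦ.exists_isRelMotion_jump hκ ν V
  have h1 := (h.map hΦ R).tendsto_jump hΦ hκ (ν := R ν) (V := R V) (by simp [hx]) (by simp [hw])
  have h2 := tendsto_nhds_unique h1 ((R.continuous.tendsto _).comp hlim)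
  rw [map_add, map_smul] at h2
  exact smul_right_injective _ (two_ne_zero (α := ℝ)) (add_left_cancel h2)

lemma IsTwoBodyMotion.isRelMotion (hΦ : IsPairPotential Φ) {α : ℝ} {q₁ q₂ w₁ w₂ : ℝ → E3}
    (h : IsTwoBodyMotion Φ α q₁ q₂ w₁ w₂) :
    IsRelMotion Φ (1 / √α) (fun t => q₁ t - q₂ t) (fun t => w₁ t - w₂ t) where
  pos t := (h.vel₁ t).sub (h.vel₂ t)
  vel t := by
    refine ((h.acc₁ t).sub (h.acc₂ t)).congr_deriv ?_
    rw [← neg_sub (q₁ t), hΦ.gradient_neg]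
    module

lemma IsTwoBodyMotion.momentum_eq (hΦ : IsPairPotential Φ) {α : ℝ} {q₁ q₂ w₁ w₂ : ℝ → E3}
    (h : IsTwoBodyMotion Φ α q₁ q₂ w₁ w₂) (s t : ℝ) : w₁ s + w₂ s = w₁ t + w₂ t := by
  have hd : ∀ t, HasDerivAt (fun t => w₁ t + w₂ t) 0 t := fun t => by
    refine ((h.acc₁ t).add (h.acc₂ t)).congr_deriv ?_
    rw [← neg_sub (q₁ t), hΦ.gradient_neg]
    module
  exact is_const_of_deriv_eq_zero (fun t => (hd t).differentiableAt) (fun t => (hd t).deriv) s t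

/-- The converse of the reduction to relative coordinates: the sum of the positions moves uniformly
with the total momentum `p`. -/
lemma IsRelMotion.isTwoBodyMotion (hΦ : IsPairPotential Φ) {α : ℝ} {x w : ℝ → E3}
    (h : IsRelMotion Φ (1 / √α) x w) (p : E3) :
    IsTwoBodyMotion Φ α (fun t => (1 / 2 : ℝ) • (t • p + x t)) (fun t => (1 / 2 : ℝ) • (t • p - x t))
      (fun t => (1 / 2 : ℝ) • (p + w t)) (fun t => (1 / 2 : ℝ) • (p - w t)) where
  vel₁ t := ((((hasDerivAt_id t).smul_const p).add (h.pos t)).const_smul (1 / 2 : ℝ)).congr_deriv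
    (by simp)
  vel₂ t := ((((hasDerivAt_id t).smul_const p).sub (h.pos t)).const_smul (1 / 2 : ℝ)).congr_deriv
    (by simp)
  acc₁ t := by
    refine (((h.vel t).const_add p).const_smul (1 / 2 : ℝ)).congr_deriv ?_
    rw [show (1 / 2 : ℝ) • (t • p + x t) - (1 / 2 : ℝ) • (t • p - x t) = x t by module]
    module
  acc₂ t := by
    refine (((h.vel t).const_sub p).const_smul (1 / 2 : ℝ)).congr_deriv ?_
    rw [show (1 / 2 : ℝ) • (t • p - x t) - (1 / 2 : ℝ) • (t • p + x t) = -x t by module,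
      hΦ.gradient_neg]
    module

/-- Existence and uniqueness of `v'` at once, so the default value in `postVelocity` never occurs.
-/
lemma IsPairPotential.isPostCollisional_iff (hΦ : IsPairPotential Φ) {α : ℝ} {ν v v₁ v' : E3} :
    IsPostCollisional Φ α ν v v₁ v' ↔ v' = v + jump Φ (1 / √α) ν (v - v₁) := by
  have hκ : 0 ≤ 1 / √α := by positivity
  constructor
  · rintro ⟨q₁, q₂, w₁, w₂, h, hν, hv, hv₁, hlim⟩
    have h1 := (h.isRelMotion hΦ).tendsto_jump hΦ hκ (ν := ν) (V := v - v₁)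
      (by simp [← hν]) (by simp [hv, hv₁])
    have h2 : Tendsto w₁ atTop
        (𝓝 ((1 / 2 : ℝ) • ((v + v₁) + ((v - v₁) + (2 : ℝ) • jump Φ (1 / √α) ν (v - v₁))))) := by
      refine ((h1.const_add (v + v₁)).const_smul (1 / 2 : ℝ)).congr fun t => ?_
      rw [← hv, ← hv₁, h.momentum_eq hΦ 0 t]
      module
    rw [tendsto_nhds_unique hlim h2]
    module
  · rintro rfl
    obtain ⟨x, w, h, hx, hw, hlim⟩ := hΦ.exists_isRelMotion_jump hκ ν (v - v₁)
    refine ⟨_, _, _, _, h.isTwoBodyMotion hΦ (v + v₁), ?_, ?_, ?_, ?_⟩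
    · simp only [hx]; module
    · simp only [hw]; module
    · simp only [hw]; module
    · convert (hlim.const_add (v + v₁)).const_smul (1 / 2 : ℝ) using 2
      module

lemma IsPairPotential.postVelocity_eq (hΦ : IsPairPotential Φ) (α : ℝ) (ν v v₁ : E3) :
    postVelocity Φ α ν v v₁ = v + jump Φ (1 / √α) ν (v - v₁) := by
  have hex : ∃ v', IsPostCollisional Φ α ν v v₁ v' := ⟨_, hΦ.isPostCollisional_iff.2 rfl⟩
  rw [postVelocity, dif_pos hex]
  exact hΦ.isPostCollisional_iff.1 hex.choose_spec

end

/-! ### The Born approximation of the jump, with error bounds. -/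

section

/-- The change of velocity to first order in the strength `κ` of the interaction. -/
def bornJump (Φ : E3 → ℝ) (κ : ℝ) (ν V : E3) : E3 := -κ • ∫ t : ℝ, ∇ Φ (t • V - ν)

variable {Φ : E3 → ℝ} {κ : ℝ}

/-- The line starts on the sphere pointing inwards or tangentially. It leaves the ball after a path
of length at most 2; the length 3 leaves room for the perturbed trajectory. -/
lemma one_le_norm_line {ν V : E3} (hν : ‖ν‖ = 1) (hνV : 0 ≤ ⟪ν, V⟫) (hV : V ≠ 0) {t : ℝ}
    (ht : t ∉ Ioc 0 (3 / ‖V‖)) : 1 ≤ ‖t • V - ν‖ := by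
  have hU : 0 < ‖V‖ := norm_pos_iff.2 hV
  rcases le_or_gt t 0 with h0 | h0
  · have h1 : ‖t • V - ν‖ ^ 2 = t ^ 2 * ‖V‖ ^ 2 - 2 * (t * ⟪ν, V⟫) + 1 := by
      rw [norm_sub_sq_real, norm_smul, real_inner_smul_left, hν, mul_pow, real_inner_comm]
      simp
    have h2 := mul_nonneg (neg_nonneg.2 h0) hνV
    have h3 : 0 ≤ t ^ 2 * ‖V‖ ^ 2 := by positivity
    by_contra! hlt
    nlinarith [norm_nonneg (t • V - ν)]
  · have h1 : 3 / ‖V‖ < t := by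
      by_contra! hle
      exact ht ⟨h0, hle⟩
    rw [div_lt_iff₀ hU] at h1
    have h2 := norm_sub_norm_le (t • V) ν
    rw [norm_smul, hν, Real.norm_eq_abs, abs_of_pos h0] at h2
    linarith

lemma IsPairPotential.bornJump_eq (hΦ : IsPairPotential Φ) {ν V : E3} (hν : ‖ν‖ = 1)
    (hνV : 0 ≤ ⟪ν, V⟫) (hV : V ≠ 0) :
    bornJump Φ κ ν V = -κ • ∫ t in (0 : ℝ)..(3 / ‖V‖), ∇ Φ (t • V - ν) := by
  rw [bornJump, intervalIntegral.integral_of_le (by positivity),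
    setIntegral_eq_integral_of_forall_compl_eq_zero fun t ht => ?_]
  exact hΦ.gradient_eq_zero_of_one_le (one_le_norm_line hν hνV hV ht)

lemma IsPairPotential.norm_bornJump_le (hΦ : IsPairPotential Φ) (hκ : 0 ≤ κ) {K : ℝ}
    (hK : ∀ x, ‖∇ Φ x‖ ≤ K) {ν V : E3} (hν : ‖ν‖ = 1) (hνV : 0 ≤ ⟪ν, V⟫) (hV : V ≠ 0) :
    ‖bornJump Φ κ ν V‖ ≤ 3 * K * κ / ‖V‖ := by
  have h1 := intervalIntegral.norm_integral_le_of_norm_le_const (a := 0) (b := 3 / ‖V‖) (C := K)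
    (f := fun t : ℝ => ∇ Φ (t • V - ν)) (fun t _ => hK _)
  rw [sub_zero, abs_of_nonneg (by positivity)] at h1
  rw [hΦ.bornJump_eq hν hνV hV, norm_smul, norm_neg, Real.norm_of_nonneg hκ]
  calc κ * _ ≤ κ * (K * (3 / ‖V‖)) := by gcongr
    _ = _ := by ring

/-- The potential energy is zero at contact and nonnegative later, so the speed never exceeds its
initial value; this includes trapped motions. -/
lemma IsPairPotential.norm_add_two_jump_le (hΦ : IsPairPotential Φ) (hκ : 0 ≤ κ) {ν V : E3}
    (hν : ‖ν‖ = 1) : ‖V + (2 : ℝ) • jump Φ κ ν V‖ ≤ ‖V‖ := by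
  obtain ⟨x, w, h, hx, hw, hlim⟩ := hΦ.exists_isRelMotion_jump hκ ν V
  refine le_of_tendsto hlim.norm (Eventually.of_forall fun t => ?_)
  have h1 := h.energy_eq hΦ 0 t
  rw [hx, hw, hΦ.eq_zero_of_one_le (by rw [norm_neg, hν])] at h1
  have h2 := mul_nonneg hκ (hΦ.nonneg (x t))
  exact le_of_sq_le_sq (by linarith) (norm_nonneg _)

lemma IsPairPotential.norm_jump_le_norm (hΦ : IsPairPotential Φ) (hκ : 0 ≤ κ) {ν V : E3}
    (hν : ‖ν‖ = 1) : ‖jump Φ κ ν V‖ ≤ ‖V‖ := by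
  have h1 := hΦ.norm_add_two_jump_le hκ (V := V) hν
  have h2 := norm_sub_le (V + (2 : ℝ) • jump Φ κ ν V) V
  rw [add_sub_cancel_left, norm_smul, Real.norm_of_nonneg (by norm_num)] at h2
  linarith

/-- Apart from head-on collisions, the relative speed is preserved. -/
lemma IsPairPotential.inner_jump (hΦ : IsPairPotential Φ) (hκ : 0 ≤ κ) {ν V : E3}
    (hν : ‖ν‖ = 1) (hne : ‖V‖ ^ 2 ≠ ⟪ν, V⟫ ^ 2) : ⟪V, jump Φ κ ν V⟫ = -‖jump Φ κ ν V‖ ^ 2 := by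
  obtain ⟨x, w, h, hx, hw, hlim⟩ := hΦ.exists_isRelMotion_jump hκ ν V
  by_cases htrap : ∀ t, 0 ≤ t → 0 ≤ ⟪x t, w t⟫ → ‖x t‖ < 1
  · have := h.norm_mul_norm_eq_of_trapped hΦ hκ htrap
    rw [hx, hw, norm_neg, hν, inner_neg_left, neg_sq, one_pow, one_mul] at this
    exact absurd this hne
  · push Not at htrap
    obtain ⟨s, -, hs, hxs⟩ := htrap
    have h1 : Tendsto w atTop (𝓝 (w s)) := by
      refine tendsto_const_nhds.congr' ?_
      filter_upwards [eventually_ge_atTop s] with t ht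
      exact (h.vel_eq_of_escaped hΦ hκ hxs hs ht).symm
    have h2 := tendsto_nhds_unique hlim h1
    have h3 := h.energy_eq hΦ 0 s
    rw [hx, hw, hΦ.eq_zero_of_one_le hxs, hΦ.eq_zero_of_one_le (by rw [norm_neg, hν]), ← h2,
      norm_add_sq_real, norm_smul, real_inner_smul_right, Real.norm_of_nonneg (by norm_num)] at h3
    linarith

namespace IsRelMotion

variable {x w : ℝ → E3} {K : ℝ}

lemma norm_vel_sub_le (h : IsRelMotion Φ κ x w) (hκ : 0 ≤ κ) (hK : ∀ x, ‖∇ Φ x‖ ≤ K) {t : ℝ}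
    (ht : 0 ≤ t) : ‖w t - w 0‖ ≤ 2 * κ * K * t := by
  have := norm_image_sub_le_of_norm_deriv_le_segment' (f := w) (a := 0) (b := t)
    (C := 2 * κ * K) (fun s _ => (h.vel s).hasDerivWithinAt) (fun s _ => by
      rw [norm_smul, norm_neg, Real.norm_of_nonneg (by positivity)]
      gcongr
      exact hK _) t (right_mem_Icc.2 ht)
  simpa using this

lemma norm_pos_sub_le (h : IsRelMotion Φ κ x w) (hκ : 0 ≤ κ) (hK : ∀ x, ‖∇ Φ x‖ ≤ K) {s t : ℝ}
    (hs : 0 ≤ s) (hst : s ≤ t) : ‖x s - (x 0 + s • w 0)‖ ≤ 2 * κ * K * t ^ 2 := by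
  have hK0 : 0 ≤ K := (norm_nonneg _).trans (hK 0)
  have h1 : ∀ r, HasDerivAt (fun r => x r - (x 0 + r • w 0)) (w r - w 0) r := fun r =>
    ((h.pos r).sub (((hasDerivAt_id r).smul_const (w 0)).const_add (x 0))).congr_deriv (by simp)
  have := norm_image_sub_le_of_norm_deriv_le_segment' (f := fun r => x r - (x 0 + r • w 0))
    (a := 0) (b := t) (C := 2 * κ * K * t) (fun s _ => (h1 s).hasDerivWithinAt) (fun r hr => by
      refine (h.norm_vel_sub_le hκ hK hr.1).trans ?_
      have := hr.2.le
      gcongr) s ⟨hs, hst⟩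
  simp only [zero_smul, add_zero, sub_self, sub_zero] at this
  refine this.trans ?_
  calc 2 * κ * K * t * s ≤ 2 * κ * K * t * t := by
        have := hs.trans hst
        gcongr
    _ = _ := by ring

end IsRelMotion

/-- During the time `3 / ‖V‖` the orbit deviates from the line by at most `18 κ K / ‖V‖² ≤ 1/2`, so
it ends at distance at least `3/2`. There it is outgoing, since an incoming particle would be no
farther out than at the start; hence the whole jump has taken place. -/
lemma IsPairPotential.jump_eq_of_fast (hΦ : IsPairPotential Φ) (hκ : 0 ≤ κ) {K : ℝ}
    (hK : ∀ x, ‖∇ Φ x‖ ≤ K) {ν V : E3} (hν : ‖ν‖ = 1) (hV : V ≠ 0)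
    (hfast : 36 * κ * K ≤ ‖V‖ ^ 2) {x w : ℝ → E3} (h : IsRelMotion Φ κ x w) (hx : x 0 = -ν)
    (hw : w 0 = V) :
    jump Φ κ ν V = -κ • ∫ t in (0 : ℝ)..(3 / ‖V‖), ∇ Φ (x t) := by
  have hU : 0 < ‖V‖ := norm_pos_iff.2 hV
  set τ := 3 / ‖V‖ with hτ
  have hτ0 : 0 ≤ τ := by positivity
  have h1 := h.norm_pos_sub_le hκ hK hτ0 le_rfl
  have h2 : 2 * κ * K * τ ^ 2 ≤ 1 / 2 := by
    rw [hτ, div_pow, ← mul_div_assoc, div_le_iff₀ (by positivity)]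
    linarith
  have h3 : 3 / 2 ≤ ‖x τ‖ := by
    have h4 : ‖τ • V‖ = 3 := by
      rw [norm_smul, Real.norm_of_nonneg hτ0, hτ]
      field_simp
    have h5 : τ • V = x τ - (x τ - (x 0 + τ • w 0)) + ν := by rw [hx, hw]; module
    have h6 := norm_add_le (x τ - (x τ - (x 0 + τ • w 0))) ν
    have h7 := norm_sub_le (x τ) (x τ - (x 0 + τ • w 0))
    rw [← h5, h4, hν] at h6
    linarith
  have h4 : 0 ≤ ⟪x τ, w τ⟫ := by
    by_contra! hneg
    have h5 := h.norm_pos_le_of_virial_nonpos hΦ hκ hneg.le hτ0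
    rw [hx, norm_neg, hν] at h5
    nlinarith
  have h5 : Tendsto w atTop (𝓝 (w τ)) := by
    refine tendsto_const_nhds.congr' ?_
    filter_upwards [eventually_ge_atTop τ] with t ht
    exact (h.vel_eq_of_escaped hΦ hκ (by linarith) h4 ht).symm
  have h6 := tendsto_nhds_unique (h.tendsto_jump hΦ hκ hx hw) h5
  have hc : Continuous fun t => ∇ Φ (x t) := hΦ.continuous_gradient.comp h.continuous_pos
  have hc' : Continuous fun t => -(2 * κ) • ∇ Φ (x t) := hc.const_smul (-(2 * κ))
  have h7 := intervalIntegral.integral_eq_sub_of_hasDerivAt (a := 0) (b := τ)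
    (fun t _ => h.vel t) (hc'.intervalIntegrable 0 τ)
  rw [intervalIntegral.integral_smul, hw, ← h6, add_sub_cancel_left] at h7
  have h8 : jump Φ κ ν V = (1 / 2 : ℝ) • ((2 : ℝ) • jump Φ κ ν V) := by module
  rw [h8, ← h7]
  module

/-- For fast particles the force is compared along the orbit and along the line, by its Lipschitz
bound. For slow ones `‖V‖² < 36 κ K`, and the trivial bound `‖jump‖ ≤ ‖V‖` is already of the
required size. -/
lemma IsPairPotential.exists_jump_bounds (hΦ : IsPairPotential Φ) :
    ∃ C : ℝ, 0 < C ∧ ∀ κ : ℝ, 0 ≤ κ → ∀ ν V : E3, ‖ν‖ = 1 → 0 ≤ ⟪ν, V⟫ → V ≠ 0 →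
      ‖jump Φ κ ν V‖ ≤ C * κ / ‖V‖ ∧ ‖bornJump Φ κ ν V‖ ≤ C * κ / ‖V‖ ∧
      ‖jump Φ κ ν V - bornJump Φ κ ν V‖ ≤ C * κ ^ 2 / ‖V‖ ^ 3 := by
  obtain ⟨K, hK0, hK, hL⟩ := hΦ.exists_gradient_bounds
  have hK0' : (0 : ℝ) < K := hK0
  refine ⟨36 * K + 1404 * K ^ 2, by positivity, fun κ hκ ν V hν hνV hV => ?_⟩
  have hU : 0 < ‖V‖ := norm_pos_iff.2 hV
  have hb := hΦ.norm_bornJump_le hκ hK hν hνV hV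
  have hb' : ‖bornJump Φ κ ν V‖ ≤ (36 * K + 1404 * K ^ 2) * κ / ‖V‖ := by
    refine hb.trans ?_
    gcongr
    nlinarith
  rcases le_or_gt (36 * κ * K) (‖V‖ ^ 2) with hfast | hslow
  · obtain ⟨x, w, h, hx, hw⟩ := hΦ.exists_isRelMotion κ (-ν) V
    have hj := hΦ.jump_eq_of_fast hκ hK hν hV hfast h hx hw
    have hτ0 : 0 ≤ 3 / ‖V‖ := by positivity
    refine ⟨?_, hb', ?_⟩
    · have h1 := intervalIntegral.norm_integral_le_of_norm_le_const (a := 0) (b := 3 / ‖V‖)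
        (C := K) (f := fun t : ℝ => ∇ Φ (x t)) (fun t _ => hK _)
      rw [sub_zero, abs_of_nonneg hτ0] at h1
      rw [hj, norm_smul, norm_neg, Real.norm_of_nonneg hκ]
      calc κ * _ ≤ κ * (K * (3 / ‖V‖)) := by gcongr
        _ = (3 * K) * κ / ‖V‖ := by ring
        _ ≤ _ := by gcongr; nlinarith
    · have hc : Continuous fun t => ∇ Φ (x t) := hΦ.continuous_gradient.comp h.continuous_pos
      have hc' : Continuous fun t : ℝ => ∇ Φ (t • V - ν) :=
        hΦ.continuous_gradient.comp (by fun_prop)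
      have h1 := intervalIntegral.norm_integral_le_of_norm_le_const (a := 0) (b := 3 / ‖V‖)
        (C := K * (2 * κ * K * (3 / ‖V‖) ^ 2))
        (f := fun t : ℝ => ∇ Φ (x t) - ∇ Φ (t • V - ν)) (fun t ht => by
          rw [uIoc_of_le hτ0] at ht
          have h2 := h.norm_pos_sub_le hκ hK ht.1.le ht.2
          have h3 := hL.dist_le_mul (x t) (t • V - ν)
          rw [dist_eq_norm, dist_eq_norm] at h3
          refine h3.trans ?_
          rw [hx, hw, neg_add_eq_sub] at h2
          gcongr)
      rw [sub_zero, abs_of_nonneg hτ0] at h1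
      rw [hj, hΦ.bornJump_eq hν hνV hV, ← smul_sub, ← intervalIntegral.integral_sub
        (hc.intervalIntegrable _ _) (hc'.intervalIntegrable _ _), norm_smul, norm_neg,
        Real.norm_of_nonneg hκ]
      calc κ * _ ≤ κ * (K * (2 * κ * K * (3 / ‖V‖) ^ 2) * (3 / ‖V‖)) := by gcongr
        _ = (54 * K ^ 2) * κ ^ 2 / ‖V‖ ^ 3 := by field_simp; ring
        _ ≤ _ := by gcongr; nlinarith
  · have h1 := hΦ.norm_jump_le_norm hκ (V := V) hν
    have h2 : ‖V‖ ≤ 36 * K * κ / ‖V‖ := by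
      rw [le_div_iff₀ hU]
      nlinarith
    refine ⟨(h1.trans h2).trans (by gcongr; nlinarith), hb', ?_⟩
    calc ‖jump Φ κ ν V - bornJump Φ κ ν V‖ ≤ 36 * K * κ / ‖V‖ + 3 * K * κ / ‖V‖ :=
          (norm_sub_le _ _).trans (add_le_add (h1.trans h2) hb)
      _ = 39 * K * κ * ‖V‖ ^ 2 / ‖V‖ ^ 3 := by field_simp; ring
      _ ≤ 39 * K * κ * (36 * κ * K) / ‖V‖ ^ 3 := by gcongr
      _ = 1404 * K ^ 2 * κ ^ 2 / ‖V‖ ^ 3 := by ring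
      _ ≤ _ := by gcongr; nlinarith

lemma IsPairPotential.bornJump_map (hΦ : IsPairPotential Φ) (R : E3 ≃ₗᵢ[ℝ] E3) (ν V : E3) :
    bornJump Φ κ (R ν) (R V) = R (bornJump Φ κ ν V) := by
  simp only [bornJump, map_smul]
  congr 1
  rw [← LinearIsometryEquiv.coe_toLinearIsometry, ← LinearIsometry.integral_comp_comm]
  simp only [LinearIsometryEquiv.coe_toLinearIsometry, ← map_smul, ← map_sub, hΦ.gradient_map]

lemma IsPairPotential.measurable_bornJump (hΦ : IsPairPotential Φ) (κ : ℝ) (V : E3) :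
    Measurable fun ν : E3 => bornJump Φ κ ν V := by
  have h : Continuous fun p : E3 × ℝ => ∇ Φ (p.2 • V - p.1) :=
    hΦ.continuous_gradient.comp (by fun_prop)
  exact (h.stronglyMeasurable.integral_prod_right).measurable.const_smul (-κ)

end

/-! ### Integration over the sphere and the splitting of space into axis and plane. -/

section

/-- Extend `H` from the sphere to be constant along rays; the radial factor is `∫₀¹ r² dr = 1/3`.
Sphere integrals thus become volume integrals, to which Fubini and isometries apply. -/
lemma integral_sphereMeasure (H : E3 → ℝ) :
    ∫ ν : S2, H ν ∂sphereMeasure = 3 * ∫ x in Metric.ball (0 : E3) 1, H (‖x‖⁻¹ • x) := by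
  have h1 : ∫ x in Metric.ball (0 : E3) 1, H (‖x‖⁻¹ • x) =
      ∫ x : E3, H (‖x‖⁻¹ • x) * (Iio (1 : ℝ)).indicator 1 ‖x‖ := by
    rw [← integral_indicator measurableSet_ball]
    congr 1 with x
    by_cases hx : ‖x‖ < 1 <;> simp [indicator, hx]
  have h2 := (volume : Measure E3).measurePreserving_homeomorphUnitSphereProd.integral_comp
    (Homeomorph.measurableEmbedding _)
    (fun p => H p.1 * (Iio (1 : ℝ)).indicator (1 : ℝ → ℝ) (p.2 : ℝ))
  simp only [homeomorphUnitSphereProd_apply_fst_coe, homeomorphUnitSphereProd_apply_snd_coe] at h2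
  rw [integral_subtype_comap (measurableSet_singleton _).compl
    (fun x : E3 => H (‖x‖⁻¹ • x) * (Iio (1 : ℝ)).indicator 1 ‖x‖), restrict_compl_singleton,
    integral_prod_mul (fun ν : S2 => H ν)
      (fun r : Ioi (0 : ℝ) => (Iio (1 : ℝ)).indicator (1 : ℝ → ℝ) (r : ℝ))] at h2
  have h3 : ∫ r : Ioi (0 : ℝ), (Iio (1 : ℝ)).indicator (1 : ℝ → ℝ) (r : ℝ)
      ∂Measure.volumeIoiPow (Module.finrank ℝ E3 - 1) = 1 / 3 := by
    have h4 : (fun r : Ioi (0 : ℝ) => (Iio (1 : ℝ)).indicator (1 : ℝ → ℝ) (r : ℝ)) =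
        (Iio (⟨1, mem_Ioi.2 one_pos⟩ : Ioi (0 : ℝ))).indicator 1 := by
      ext r
      have h5 : r < (⟨1, mem_Ioi.2 one_pos⟩ : Ioi (0 : ℝ)) ↔ (r : ℝ) < 1 := Iff.rfl
      by_cases hr : (r : ℝ) < 1 <;> simp [indicator, hr, h5, -not_lt]
    rw [h4, integral_indicator_one measurableSet_Iio, Measure.real,
      Measure.volumeIoiPow_apply_Iio, ENNReal.toReal_ofReal (by positivity)]
    simp
    norm_num
  rw [h1, h2, h3, sphereMeasure]
  ring

lemma integral_sphereMeasure_map (R : E3 ≃ₗᵢ[ℝ] E3) (H : E3 → ℝ) :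
    ∫ ν : S2, H (R ν) ∂sphereMeasure = ∫ ν : S2, H ν ∂sphereMeasure := by
  rw [integral_sphereMeasure (fun x => H (R x)), integral_sphereMeasure]
  congr 1
  have h := R.measurePreserving.setIntegral_preimage_emb
    R.toHomeomorph.measurableEmbedding (fun x => H (‖x‖⁻¹ • x)) (Metric.ball 0 1)
  rw [← h]
  simp [R.norm_map]

/-- The cone over a point lies in a line, which is a null set; this makes the single head-on
direction negligible. -/
instance : NullSingletonClass sphereMeasure where
  measure_singleton ν := by
    rw [sphereMeasure, Measure.toSphere_apply' _ (measurableSet_singleton ν)]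
    refine mul_eq_zero_of_right _ (measure_mono_null (t := (ℝ ∙ (ν : E3) : Submodule ℝ E3)) ?_
      (Measure.addHaar_submodule _ _ fun h => ?_))
    · rintro _ ⟨r, -, _, ⟨_, rfl, rfl⟩, rfl⟩
      exact Submodule.smul_mem _ _ (Submodule.mem_span_singleton_self _)
    · have h1 := finrank_span_singleton (K := ℝ) (v := (ν : E3))
        (norm_ne_zero_iff.1 (by simp))
      rw [h, finrank_top] at h1
      simp at h1

instance : IsFiniteMeasure sphereMeasure := by
  unfold sphereMeasure
  infer_instance

/-- The Euclidean plane. -/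
abbrev E2 : Type := EuclideanSpace ℝ (Fin 2)

/-- The point of `ℝ³` with first coordinate `s` and remaining coordinates `b`. -/
def joinE3 (s : ℝ) (b : E2) : E3 := WithLp.toLp 2 ![s, b 0, b 1]

/-- `ℝ³` as the product of a line and a plane. -/
def splitE3 : E3 ≃ᵐ ℝ × E2 :=
  (MeasurableEquiv.toLp 2 (Fin 3 → ℝ)).symm.trans
    ((MeasurableEquiv.piFinSuccAbove (fun _ => ℝ) 0).trans
      ((MeasurableEquiv.refl ℝ).prodCongr (MeasurableEquiv.toLp 2 (Fin 2 → ℝ))))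

lemma splitE3_symm_apply (p : ℝ × E2) : splitE3.symm p = joinE3 p.1 p.2 := by
  rw [MeasurableEquiv.symm_apply_eq]
  refine Prod.ext rfl ?_
  ext i
  fin_cases i <;> rfl

lemma measurePreserving_splitE3 : MeasurePreserving splitE3 := by
  refine MeasurePreserving.trans (PiLp.volume_preserving_ofLp (Fin 3)) ?_
  refine MeasurePreserving.trans (volume_preserving_piFinSuccAbove (fun _ : Fin 3 => ℝ) 0) ?_
  exact (MeasurePreserving.id _).prod (PiLp.volume_preserving_toLp (Fin 2))

lemma integral_joinE3 {F : Type*} [NormedAddCommGroup F] [NormedSpace ℝ F] (H : E3 → F) :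
    ∫ p : ℝ × E2, H (joinE3 p.1 p.2) = ∫ x, H x := by
  simp only [← splitE3_symm_apply]
  exact (measurePreserving_splitE3.symm splitE3).integral_comp splitE3.symm.measurableEmbedding H

lemma integrable_joinE3 {F : Type*} [NormedAddCommGroup F] {H : E3 → F} :
    Integrable (fun p : ℝ × E2 => H (joinE3 p.1 p.2)) ↔ Integrable H := by
  simp only [← splitE3_symm_apply]
  exact (measurePreserving_splitE3.symm splitE3).integrable_comp_emb
    splitE3.symm.measurableEmbedding

lemma norm_joinE3_sq (s : ℝ) (b : E2) : ‖joinE3 s b‖ ^ 2 = s ^ 2 + ‖b‖ ^ 2 := by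
  rw [EuclideanSpace.norm_sq_eq, EuclideanSpace.norm_sq_eq, Fin.sum_univ_three, Fin.sum_univ_two]
  simp [joinE3]
  ring

lemma norm_joinE3 (s : ℝ) (b : E2) : ‖joinE3 s b‖ = √(s ^ 2 + ‖b‖ ^ 2) := by
  rw [← norm_joinE3_sq, Real.sqrt_sq (norm_nonneg _)]

/-- The last two coordinates of a point of `ℝ³`. -/
def planePart (x : E3) : E2 := WithLp.toLp 2 ![x 1, x 2]

lemma planePart_joinE3 (s : ℝ) (b : E2) : planePart (joinE3 s b) = b := by
  ext i
  fin_cases i <;> simp [planePart, joinE3]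

lemma planePart_smul (r : ℝ) (x : E3) : planePart (r • x) = r • planePart x := by
  ext i
  fin_cases i <;> simp [planePart]

lemma continuous_planePart : Continuous planePart := by
  refine (PiLp.continuous_toLp 2 _).comp (continuous_pi fun i => ?_)
  fin_cases i <;> simp <;> fun_prop

lemma image_sqrt_Ioi {B : ℝ} (hB : 0 ≤ B) :
    (fun s : ℝ => √(s ^ 2 + B ^ 2)) '' Ioi 0 = Ioi B := by
  ext r
  constructor
  · rintro ⟨s, hs, rfl⟩
    have hs : 0 < s := hs
    exact Real.lt_sqrt_of_sq_lt (by nlinarith)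
  · intro hr
    have hr : B < r := hr
    refine ⟨√(r ^ 2 - B ^ 2), Real.sqrt_pos.2 (by nlinarith), ?_⟩
    simp only
    rw [Real.sq_sqrt (by nlinarith), sub_add_cancel, Real.sqrt_sq (by linarith)]

/-- Substitution `r = √(s² + B²)`: on a line at distance `B` from the origin, the cosine `s / r` is
exactly `dr / ds`. -/
lemma integral_Ioi_sqrt {B : ℝ} (hB : 0 ≤ B) (F : ℝ → ℝ) :
    ∫ s in Ioi (0 : ℝ), s / √(s ^ 2 + B ^ 2) * F (√(s ^ 2 + B ^ 2)) = ∫ r in Ioi B, F r := by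
  rw [← image_sqrt_Ioi hB, integral_image_eq_integral_abs_deriv_smul measurableSet_Ioi
    (f' := fun s => s / √(s ^ 2 + B ^ 2))]
  · refine setIntegral_congr_fun measurableSet_Ioi fun s hs => ?_
    have hs : 0 < s := hs
    simp only [smul_eq_mul]
    rw [abs_of_nonneg (by positivity)]
  · intro s hs
    have hs : 0 < s := hs
    have h1 : HasDerivAt (fun s : ℝ => s ^ 2 + B ^ 2) (2 * s) s := by
      simpa using (hasDerivAt_pow 2 s).add_const (B ^ 2)
    refine (h1.sqrt (by positivity)).hasDerivWithinAt.congr_deriv ?_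
    field_simp
  · intro s hs t ht hst
    have hs : 0 < s := hs
    have ht : 0 < t := ht
    have h1 := congrArg (fun r => r ^ 2) hst
    simp only at h1
    rw [Real.sq_sqrt (by positivity), Real.sq_sqrt (by positivity)] at h1
    exact (pow_left_inj₀ hs.le ht.le two_ne_zero).1 (by linarith)

end

/-! ### From the flux through the hemisphere to the impact-parameter disc. -/

section

/-- The flux through the unit sphere of a beam in the direction of the first axis. -/
lemma integral_flux {g : E2 → ℝ} (hg : Measurable g) {M : ℝ} (hM : ∀ b, |g b| ≤ M) :
    ∫ ν : S2, max ((ν : E3) 0) 0 * g (planePart ν) ∂sphereMeasure =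
      ∫ b in Metric.ball (0 : E2) 1, g b := by
  have hM0 : 0 ≤ M := (abs_nonneg _).trans (hM 0)
  set g₁ : E2 → ℝ := (Metric.ball (0 : E2) 1).indicator g with hg₁
  have hg₁m : Measurable g₁ := hg.indicator measurableSet_ball
  have hg₁M : ∀ b, |g₁ b| ≤ M := fun b => by
    by_cases hb : b ∈ Metric.ball (0 : E2) 1
    · simpa [hg₁, hb] using hM b
    · simpa [hg₁, hb] using hM0
  -- The integrand extended to be constant along rays and cut off at radius one, to be integrated by
  -- Fubini along lines parallel to the first axis.
  set K : E3 → ℝ := fun x => max (x 0) 0 / ‖x‖ *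
    ((Iio (1 : ℝ)).indicator 1 ‖x‖ * g (‖x‖⁻¹ • planePart x)) with hK
  have hKm : Measurable K := by
    have h1 : Measurable fun x : E3 => (Iio (1 : ℝ)).indicator (1 : ℝ → ℝ) ‖x‖ :=
      (measurable_one.indicator measurableSet_Iio).comp measurable_norm
    have h2 : Measurable fun x : E3 => g (‖x‖⁻¹ • planePart x) :=
      hg.comp (measurable_norm.inv.smul continuous_planePart.measurable)
    have h3 : Measurable fun x : E3 => max (x 0) 0 / ‖x‖ := by fun_prop
    exact h3.mul (h1.mul h2)
  have hKi : Integrable K := by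
    refine Integrable.mono' (g := (Metric.ball (0 : E3) 1).indicator fun _ => M) ?_
      hKm.aestronglyMeasurable (Eventually.of_forall fun x => ?_)
    · exact (integrable_indicator_iff measurableSet_ball).2
        (integrableOn_const measure_ball_lt_top.ne)
    · by_cases hx : ‖x‖ < 1
      · have h1 : |max (x 0) 0 / ‖x‖| ≤ 1 := by
          rw [abs_of_nonneg (by positivity)]
          refine div_le_one_of_le₀ (max_le ?_ (norm_nonneg _)) (norm_nonneg _)
          exact (le_abs_self _).trans (PiLp.norm_apply_le x 0)
        have h2 := hM (‖x‖⁻¹ • planePart x)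
        simp only [hK, Real.norm_eq_abs, abs_mul, indicator, mem_Iio, hx, Metric.mem_ball,
          dist_zero_right, if_true, Pi.one_apply, one_mul]
        calc _ ≤ 1 * M := by gcongr
          _ = M := one_mul M
      · simp [hK, hx]
  have h1 : ∫ x in Metric.ball (0 : E3) 1, max ((‖x‖⁻¹ • x) 0) 0 * g (planePart (‖x‖⁻¹ • x)) =
      ∫ x, K x := by
    rw [← integral_indicator measurableSet_ball]
    congr 1 with x
    by_cases hx : ‖x‖ < 1
    · have h2 : max ((‖x‖⁻¹ • x) 0) 0 = max (x 0) 0 / ‖x‖ := by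
        rw [PiLp.smul_apply, smul_eq_mul, div_eq_inv_mul, mul_max_of_nonneg _ _ (by positivity),
          mul_zero]
      simp only [hK, indicator, mem_Iio, hx, Metric.mem_ball, dist_zero_right, if_true,
        Pi.one_apply, one_mul, h2, planePart_smul]
    · simp [hK, hx]
  -- The cosine turns `ds` into `dr`, and the constraint `r > ‖b‖` says that `b / r` is in the unit
  -- disc, which `g₁` records. Scaling `b` by `r` then produces `r²`, whose integral `1/3` cancels
  -- the factor 3 of `integral_sphereMeasure`.
  have h2 : ∀ b : E2, ∫ s : ℝ, K (joinE3 s b) =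
      ∫ r : ℝ, (Ioo (0 : ℝ) 1).indicator 1 r * g₁ (r⁻¹ • b) := fun b => by
    set F : ℝ → ℝ := fun r => (Iio (1 : ℝ)).indicator 1 r * g (r⁻¹ • b) with hF
    have h3 : (fun s : ℝ => K (joinE3 s b)) = (Ioi (0 : ℝ)).indicator
        fun s => s / √(s ^ 2 + ‖b‖ ^ 2) * F (√(s ^ 2 + ‖b‖ ^ 2)) := by
      ext s
      have h4 : joinE3 s b 0 = s := by simp [joinE3]
      by_cases hs : 0 < s
      · simp [hK, hF, planePart_joinE3, norm_joinE3, h4, hs, hs.le]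
      · simp [hK, h4, hs, not_lt.1 hs]
    rw [h3, integral_indicator measurableSet_Ioi, integral_Ioi_sqrt (norm_nonneg b),
      ← integral_indicator measurableSet_Ioi]
    congr 1 with r
    by_cases hr0 : 0 < r
    · have h5 : r⁻¹ • b ∈ Metric.ball (0 : E2) 1 ↔ r ∈ Ioi ‖b‖ := by
        rw [mem_ball_zero_iff, norm_smul, norm_inv, Real.norm_of_nonneg hr0.le,
          inv_mul_lt_iff₀ hr0, mul_one, mem_Ioi]
      by_cases hr : r ∈ Ioi ‖b‖
      · simp [hF, hg₁, indicator, h5.2 hr, hr, hr0, -Metric.mem_ball, -mem_Ioi]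
      · simp [hg₁, indicator, h5, hr, -Metric.mem_ball, -mem_Ioi]
    · have h6 : r ∉ Ioi ‖b‖ := fun h => hr0 ((norm_nonneg b).trans_lt h)
      simp [indicator, hr0, h6, -mem_Ioi]
  have h3 : Integrable (fun p : E2 × ℝ => (Ioo (0 : ℝ) 1).indicator (1 : ℝ → ℝ) p.2 *
      g₁ (p.2⁻¹ • p.1)) (volume.prod volume) := by
    refine Integrable.mono' (g := (Metric.ball (0 : E2) 1 ×ˢ Ioo (0 : ℝ) 1).indicator fun _ => M)
      ?_ ?_ (Eventually.of_forall fun p => ?_)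
    · refine (integrable_indicator_iff (measurableSet_ball.prod measurableSet_Ioo)).2
        (integrableOn_const ?_)
      rw [Measure.prod_prod]
      exact ENNReal.mul_ne_top measure_ball_lt_top.ne measure_Ioo_lt_top.ne
    · refine Measurable.aestronglyMeasurable ?_
      exact ((measurable_one.indicator measurableSet_Ioo).comp measurable_snd).mul
        (hg₁m.comp (measurable_snd.inv.smul measurable_fst))
    · by_cases hr : p.2 ∈ Ioo (0 : ℝ) 1
      · by_cases hb : p.1 ∈ Metric.ball (0 : E2) 1
        · have : p ∈ Metric.ball (0 : E2) 1 ×ˢ Ioo (0 : ℝ) 1 := ⟨hb, hr⟩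
          simpa [indicator, hr, this, -mem_prod, -mem_Ioo] using hg₁M _
        · have h4 : p.2⁻¹ • p.1 ∉ Metric.ball (0 : E2) 1 := by
            rw [mem_ball_zero_iff, norm_smul, norm_inv, Real.norm_of_nonneg hr.1.le,
              inv_mul_lt_iff₀ hr.1, mul_one]
            rw [mem_ball_zero_iff] at hb
            have := hr.2
            exact fun h => hb (h.trans this)
          have : p ∉ Metric.ball (0 : E2) 1 ×ˢ Ioo (0 : ℝ) 1 := fun h => hb h.1
          simp [indicator, this, hg₁, h4, -mem_prod, -Metric.mem_ball]
      · have : p ∉ Metric.ball (0 : E2) 1 ×ˢ Ioo (0 : ℝ) 1 := fun h => hr h.2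
        simp [indicator, hr, this, -mem_prod, -mem_Ioo]
  have h4 : ∀ r : ℝ, ∫ b : E2, (Ioo (0 : ℝ) 1).indicator (1 : ℝ → ℝ) r * g₁ (r⁻¹ • b) =
      (Ioo (0 : ℝ) 1).indicator (fun r => r ^ 2) r * ∫ b, g₁ b := fun r => by
    rw [integral_const_mul, Measure.integral_comp_inv_smul, finrank_euclideanSpace, Fintype.card_fin,
      smul_eq_mul, abs_of_nonneg (sq_nonneg r), ← mul_assoc]
    congr 1
    by_cases hr : r ∈ Ioo (0 : ℝ) 1 <;> simp [indicator, hr, -mem_Ioo]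
  have h5 : ∫ r : ℝ, (Ioo (0 : ℝ) 1).indicator (fun r => r ^ 2) r = 1 / 3 := by
    rw [integral_indicator measurableSet_Ioo, ← integral_Ioc_eq_integral_Ioo,
      ← intervalIntegral.integral_of_le zero_le_one, integral_pow]
    norm_num
  rw [integral_sphereMeasure (fun x => max (x 0) 0 * g (planePart x)), h1, ← integral_joinE3,
    Measure.volume_eq_prod, integral_prod_symm _ (integrable_joinE3.2 hKi)]
  simp only [h2]
  rw [integral_integral_swap h3]
  simp only [h4]
  rw [integral_mul_const, h5, hg₁, integral_indicator measurableSet_ball]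
  ring

end

/-! ### Plancherel, and line integrals of the potential and of its gradient. -/

section

open scoped FourierTransform SchwartzMap in
/-- Plancherel's theorem for integrable and square integrable functions. -/
lemma integral_norm_fourier_sq {E : Type*} [NormedAddCommGroup E] [InnerProductSpace ℝ E]
    [FiniteDimensional ℝ E] [MeasurableSpace E] [BorelSpace E] {f : E → ℂ} (hf : Integrable f)
    (hf2 : MemLp f 2) :
    MemLp (𝓕 f) 2 ∧ ∫ ξ, ‖𝓕 f ξ‖ ^ 2 = ∫ x, ‖f x‖ ^ 2 := by
  set F : Lp ℂ 2 (volume : Measure E) := hf2.toLp f with hF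
  have hc : Continuous (𝓕 f) :=
    VectorFourier.fourierIntegral_continuous Real.continuous_fourierChar continuous_inner hf
  -- The abstract `L²` transform agrees almost everywhere with the integral one: against every
  -- smooth compactly supported test function both can be moved onto the test function.
  have hae : ∀ᵐ ξ, (𝓕 F : Lp ℂ 2 (volume : Measure E)) ξ = 𝓕 f ξ := by
    refine ae_eq_of_integral_contDiff_smul_eq
      ((Lp.memLp (𝓕 F : Lp ℂ 2 (volume : Measure E))).locallyIntegrable (by norm_num))
      hc.locallyIntegrable fun g hg hgc => ?_
    have hg₁ : HasCompactSupport (Complex.ofRealCLM ∘ g) := hgc.comp_left rfl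
    have hg₂ : ContDiff ℝ ∞ (Complex.ofRealCLM ∘ g) := by fun_prop
    set φ : 𝓢(E, ℂ) := hg₁.toSchwartzMap hg₂ with hφ
    have hφg : ∀ x, φ x = (g x : ℂ) := fun x => rfl
    calc ∫ ξ, g ξ • (𝓕 F : Lp ℂ 2 (volume : Measure E)) ξ
        = Lp.toTemperedDistribution (𝓕 F : Lp ℂ 2 (volume : Measure E)) φ := by
          rw [Lp.toTemperedDistribution_apply]
          simp [hφg]
      _ = Lp.toTemperedDistribution F (𝓕 φ) := by
          rw [← Lp.fourier_toTemperedDistribution_eq]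
          rfl
      _ = ∫ x, (𝓕 φ) x • f x := by
          rw [Lp.toTemperedDistribution_apply]
          refine integral_congr_ae ?_
          filter_upwards [hf2.coeFn_toLp] with x hx
          rw [hF, hx]
      _ = ∫ x, φ x • 𝓕 f x := by
          rw [SchwartzMap.fourier_coe]
          simpa using! VectorFourier.integral_fourierIntegral_smul_eq_flip (L := innerₗ E)
            Real.continuous_fourierChar continuous_inner φ.integrable hf
      _ = _ := by simp [hφg]
  have hmem : MemLp (𝓕 f) 2 :=
    (Lp.memLp (𝓕 F : Lp ℂ 2 (volume : Measure E))).ae_eq hae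
  refine ⟨hmem, ?_⟩
  have h1 : hmem.toLp (𝓕 f) = 𝓕 F := by
    refine Lp.ext ?_
    filter_upwards [hmem.coeFn_toLp, hae] with ξ h1 h2
    rw [h1, h2]
  have h2 : ∀ {h : E → ℂ} (hh : MemLp h 2), ∫ x, ‖h x‖ ^ 2 = ‖hh.toLp h‖ ^ 2 := fun {h} hh => by
    rw [← real_inner_self_eq_norm_sq, L2.inner_def]
    refine integral_congr_ae ?_
    filter_upwards [hh.coeFn_toLp] with x hx
    rw [hx, real_inner_self_eq_norm_sq]
  rw [h2 hmem, h2 hf2, h1, Lp.norm_fourier_eq]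

/-- The plane orthogonal to the first axis. -/
def planeIncl : E2 →ₗ[ℝ] E3 where
  toFun b := joinE3 0 b
  map_add' b c := by ext i; fin_cases i <;> simp [joinE3]
  map_smul' r b := by ext i; fin_cases i <;> simp [joinE3]

/-- The isometric inclusion of the plane orthogonal to the first axis. -/
def planeEmb : E2 →ₗᵢ[ℝ] E3 where
  toLinearMap := planeIncl
  norm_map' b := by
    change ‖joinE3 0 b‖ = ‖b‖
    rw [norm_joinE3]
    simp

lemma joinE3_eq (s : ℝ) (b : E2) : joinE3 s b = s • EuclideanSpace.single 0 1 + planeEmb b := by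
  change joinE3 s b = s • EuclideanSpace.single 0 1 + joinE3 0 b
  ext i
  fin_cases i <;> simp [joinE3]

lemma planeEmb_single_zero : planeEmb (EuclideanSpace.single 0 1) = EuclideanSpace.single 1 1 := by
  change joinE3 0 _ = _
  ext i
  fin_cases i <;> simp [joinE3]

lemma planeEmb_single_one : planeEmb (EuclideanSpace.single 1 1) = EuclideanSpace.single 2 1 := by
  change joinE3 0 _ = _
  ext i
  fin_cases i <;> simp [joinE3]

lemma continuous_joinE3 : Continuous fun p : ℝ × E2 => joinE3 p.1 p.2 := by
  simp only [joinE3_eq]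
  have := planeEmb.continuous
  fun_prop

lemma one_le_norm_joinE3_of_notMem {s : ℝ} {b : E2} (hs : s ∉ Icc (-1 : ℝ) 1) :
    1 ≤ ‖joinE3 s b‖ := by
  rw [norm_joinE3, Real.one_le_sqrt]
  have : 1 < |s| := by
    by_contra! h
    exact hs (abs_le.1 h)
  nlinarith [sq_abs s, sq_nonneg ‖b‖]

lemma one_le_norm_joinE3 {s : ℝ} {b : E2} (hb : 1 ≤ ‖b‖) : 1 ≤ ‖joinE3 s b‖ := by
  rw [norm_joinE3, Real.one_le_sqrt]
  nlinarith [sq_nonneg s]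

/-- The integral of the potential over a line parallel to the first axis. -/
def xray (Φ : E3 → ℝ) (b : E2) : ℝ := ∫ s : ℝ, Φ (joinE3 s b)

/-- The integral of the gradient over a line parallel to the first axis. -/
def kick (Φ : E3 → ℝ) (b : E2) : E3 := ∫ s : ℝ, ∇ Φ (joinE3 s b)

variable {Φ : E3 → ℝ}

lemma integrable_of_bound_Icc {F : Type*} [NormedAddCommGroup F] {g : ℝ → F} (hg : Continuous g)
    {K : ℝ} (hK : ∀ s, ‖g s‖ ≤ (Icc (-1 : ℝ) 1).indicator (fun _ => K) s) : Integrable g :=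
  Integrable.mono' ((integrable_indicator_iff measurableSet_Icc).2
    (integrableOn_const measure_Icc_lt_top.ne)) hg.aestronglyMeasurable (Eventually.of_forall hK)

lemma continuous_joinE3_left (b : E2) : Continuous fun s : ℝ => joinE3 s b :=
  continuous_joinE3.comp (by fun_prop : Continuous fun s : ℝ => (s, b))

lemma IsPairPotential.norm_gradient_joinE3_le {K : ℝ} (hΦ : IsPairPotential Φ)
    (hK : ∀ x, ‖∇ Φ x‖ ≤ K) (b : E2) (s : ℝ) :
    ‖∇ Φ (joinE3 s b)‖ ≤ (Icc (-1 : ℝ) 1).indicator (fun _ => K) s := by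
  by_cases hs : s ∈ Icc (-1 : ℝ) 1
  · simpa [indicator, hs, -mem_Icc] using hK _
  · rw [hΦ.gradient_eq_zero_of_one_le (one_le_norm_joinE3_of_notMem hs)]
    simp [indicator, hs, -mem_Icc]

lemma IsPairPotential.integrable_gradient_joinE3 (hΦ : IsPairPotential Φ) (b : E2) :
    Integrable fun s : ℝ => ∇ Φ (joinE3 s b) := by
  obtain ⟨K, -, hK, -⟩ := hΦ.exists_gradient_bounds
  exact integrable_of_bound_Icc (hΦ.continuous_gradient.comp (continuous_joinE3_left b))
    (hΦ.norm_gradient_joinE3_le hK b)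

lemma IsPairPotential.exists_norm_kick_le (hΦ : IsPairPotential Φ) :
    ∃ K : ℝ, ∀ b, ‖kick Φ b‖ ≤ K := by
  obtain ⟨K, -, hK, -⟩ := hΦ.exists_gradient_bounds
  exact ⟨_, fun b => norm_integral_le_of_norm_le ((integrable_indicator_iff measurableSet_Icc).2
    (integrableOn_const measure_Icc_lt_top.ne))
    (Eventually.of_forall (hΦ.norm_gradient_joinE3_le hK b))⟩

lemma IsPairPotential.kick_eq_zero (hΦ : IsPairPotential Φ) {b : E2} (hb : 1 ≤ ‖b‖) :
    kick Φ b = 0 := by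
  simp [kick, fun s : ℝ => hΦ.gradient_eq_zero_of_one_le (one_le_norm_joinE3 (s := s) hb)]

lemma IsPairPotential.xray_eq_zero (hΦ : IsPairPotential Φ) {b : E2} (hb : 1 ≤ ‖b‖) :
    xray Φ b = 0 := by
  simp [xray, fun s : ℝ => hΦ.eq_zero_of_one_le (one_le_norm_joinE3 (s := s) hb)]

lemma IsPairPotential.measurable_kick (hΦ : IsPairPotential Φ) : Measurable (kick Φ) := by
  have h : Continuous fun p : E2 × ℝ => ∇ Φ (joinE3 p.2 p.1) :=
    hΦ.continuous_gradient.comp (continuous_joinE3.comp continuous_swap)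
  exact h.stronglyMeasurable.integral_prod_right.measurable

/-- Differentiation under the integral, dominated because the force vanishes for `|s| > 1`. It makes
the transverse components of `kick` derivatives of a scalar function, so that Plancherel applies. -/
lemma IsPairPotential.hasFDerivAt_xray (hΦ : IsPairPotential Φ) (b : E2) :
    HasFDerivAt (xray Φ) ((innerSL ℝ (kick Φ b)).comp planeEmb.toContinuousLinearMap) b := by
  obtain ⟨K, -, hK, -⟩ := hΦ.exists_gradient_bounds
  set T : E3 →L[ℝ] (E2 →L[ℝ] ℝ) :=
    ((ContinuousLinearMap.compL ℝ E2 E3 ℝ).flip planeEmb.toContinuousLinearMap).comp (innerSL ℝ)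
    with hT
  have h1 : ∀ s c, HasFDerivAt (fun c => Φ (joinE3 s c)) (T (∇ Φ (joinE3 s c))) c := fun s c => by
    have h2 : HasFDerivAt (fun c => joinE3 s c) planeEmb.toContinuousLinearMap c := by
      simp only [joinE3_eq]
      exact planeEmb.toContinuousLinearMap.hasFDerivAt.const_add _
    refine ((hΦ.hasFDerivAt (joinE3 s c)).comp c h2).congr_fderiv ?_
    ext y
    exact inner_gradient_left.symm
  have h2 := hasFDerivAt_integral_of_dominated_of_fderiv_le (μ := volume) (x₀ := b) (s := univ)
    (F := fun c s => Φ (joinE3 s c)) (F' := fun c s => T (∇ Φ (joinE3 s c)))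
    (bound := fun s => ‖T‖ * (Icc (-1 : ℝ) 1).indicator (fun _ => (K : ℝ)) s) univ_mem
    (Eventually.of_forall fun c =>
      (hΦ.contDiff.continuous.comp (continuous_joinE3_left c)).aestronglyMeasurable)
    ?_ (T.continuous.comp (hΦ.continuous_gradient.comp
      (continuous_joinE3_left b))).aestronglyMeasurable
    (Eventually.of_forall fun s c _ => (T.le_opNorm _).trans (by
      gcongr
      exact hΦ.norm_gradient_joinE3_le hK c s))
    (((integrable_indicator_iff measurableSet_Icc).2
      (integrableOn_const measure_Icc_lt_top.ne)).const_mul _)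
    (Eventually.of_forall fun s c _ => h1 s c)
  · rw [T.integral_comp_comm (hΦ.integrable_gradient_joinE3 b)] at h2
    exact h2
  · refine integrable_of_bound_Icc (K := Φ 0)
      (hΦ.contDiff.continuous.comp (continuous_joinE3_left b)) fun s => ?_
    by_cases hs : s ∈ Icc (-1 : ℝ) 1
    · simp only [indicator, hs, if_true, Real.norm_of_nonneg (hΦ.nonneg _)]
      exact hΦ.antitone _ _ (by simp)
    · rw [hΦ.eq_zero_of_one_le (one_le_norm_joinE3_of_notMem hs)]
      simp [indicator, hs, -mem_Icc]

end

/-! ### The Landau constant as a second moment of the deflection. -/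

section

variable {Φ : E3 → ℝ}

lemma exists_linearIsometryEquiv_apply_eq {E : Type*} [NormedAddCommGroup E]
    [InnerProductSpace ℝ E] [CompleteSpace E] {x y : E} (h : ‖x‖ = ‖y‖) :
    ∃ R : E ≃ₗᵢ[ℝ] E, R x = y :=
  ⟨_, Submodule.reflection_sub h⟩

lemma IsPairPotential.potentialFourier_eq (hΦ : IsPairPotential Φ) {k k' : E3} (h : ‖k‖ = ‖k'‖) :
    potentialFourier Φ k = potentialFourier Φ k' := by
  obtain ⟨R, rfl⟩ := exists_linearIsometryEquiv_apply_eq h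
  rw [potentialFourier, potentialFourier]
  conv_rhs => rw [← R.measurePreserving.integral_comp R.toHomeomorph.measurableEmbedding]
  simp only [R.inner_map_map, hΦ.radial _ _ (R.norm_map _)]

lemma IsPairPotential.potentialFourier_im (hΦ : IsPairPotential Φ) (k : E3) :
    (potentialFourier Φ k).im = 0 := by
  have h1 : (starRingEnd ℂ) (potentialFourier Φ k) = potentialFourier Φ (-k) := by
    rw [potentialFourier, potentialFourier, ← integral_conj]
    congr 1 with x
    rw [map_mul, Complex.conj_ofReal, ← Complex.exp_conj]
    simp
  rw [hΦ.potentialFourier_eq (norm_neg k)] at h1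
  exact Complex.conj_eq_iff_im.1 h1

lemma IsPairPotential.integrable (hΦ : IsPairPotential Φ) : Integrable Φ :=
  hΦ.contDiff.continuous.integrable_of_hasCompactSupport hΦ.hasCompactSupport

open scoped FourierTransform in
-- The Fourier slice theorem. The radius `2π ‖ξ‖` converts from the kernel `exp (-2πi ⟪b, ξ⟫)`;
-- taking the real part loses nothing, since `Φ` is even.
lemma IsPairPotential.fourier_xray (hΦ : IsPairPotential Φ) (ξ : E2) :
    𝓕 (fun b => (xray Φ b : ℂ)) ξ =
      ((potentialFourier Φ (EuclideanSpace.single 0 (2 * Real.pi * ‖ξ‖))).re : ℂ) := by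
  have h1 : potentialFourier Φ ((2 * Real.pi) • planeEmb ξ) =
      potentialFourier Φ (EuclideanSpace.single 0 (2 * Real.pi * ‖ξ‖)) := by
    refine hΦ.potentialFourier_eq ?_
    simp [norm_smul, planeEmb.norm_map]
  have h2 : potentialFourier Φ (EuclideanSpace.single 0 (2 * Real.pi * ‖ξ‖)) =
      ((potentialFourier Φ (EuclideanSpace.single 0 (2 * Real.pi * ‖ξ‖))).re : ℂ) :=
    Complex.ext (by simp) (by simp [hΦ.potentialFourier_im])
  rw [← h2, ← h1, potentialFourier]
  set g : E3 → ℂ := fun x =>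
    (Φ x : ℂ) * Complex.exp (-(Complex.I * (⟪(2 * Real.pi) • planeEmb ξ, x⟫ : ℝ))) with hg
  have hgi : Integrable g := by
    refine (hΦ.integrable.ofReal (𝕜 := ℂ)).mul_bdd (c := 1) ?_ (Eventually.of_forall fun x => ?_)
    · exact Continuous.aestronglyMeasurable (by fun_prop)
    · rw [Complex.norm_exp]
      simp
  rw [← integral_joinE3, Measure.volume_eq_prod, integral_prod_symm _ (integrable_joinE3.2 hgi),
    Real.fourier_eq']
  congr 1 with b
  simp only [xray, hg]
  rw [← integral_complex_ofReal, smul_eq_mul, ← integral_const_mul]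
  congr 1 with s
  have h3 : ⟪planeEmb ξ, joinE3 s b⟫ = ⟪b, ξ⟫ := by
    rw [joinE3_eq, inner_add_right, planeEmb.inner_map_map, real_inner_comm ξ, real_inner_smul_right]
    have : ⟪planeEmb ξ, EuclideanSpace.single (0 : Fin 3) (1 : ℝ)⟫ = 0 := by
      rw [EuclideanSpace.inner_single_right]
      change 1 * (starRingEnd ℝ) (joinE3 0 ξ 0) = 0
      simp [joinE3]
    rw [this]
    simp
  rw [real_inner_smul_left, h3, mul_comm]
  congr 2
  push_cast
  ring

lemma memLp_of_eq_zero_of_one_le {u : E2 → ℝ}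
    (hu : Measurable u) {M : ℝ} (hM : ∀ b, |u b| ≤ M) (h0 : ∀ b, 1 ≤ ‖b‖ → u b = 0)
    (p : ℝ≥0∞) : MemLp u p := by
  have h1 : u = (Metric.ball (0 : E2) 1).indicator u := by
    ext b
    by_cases hb : ‖b‖ < 1
    · simp [indicator, hb]
    · simp [indicator, hb, h0 b (not_lt.1 hb)]
  rw [h1]
  have : IsFiniteMeasure ((volume : Measure E2).restrict (Metric.ball 0 1)) :=
    ⟨by simp⟩
  exact (memLp_indicator_iff_restrict measurableSet_ball).2
    (MemLp.of_bound hu.aestronglyMeasurable M (Eventually.of_forall hM))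

open scoped FourierTransform in
-- Plancherel for the derivative of `xray Φ` in the direction `c`, whose transform is a multiple by
-- `2πi ⟪ξ, c⟫` of the slice.
lemma IsPairPotential.integral_inner_kick_sq (hΦ : IsPairPotential Φ) (c : E2) :
    Integrable (fun ξ : E2 => (2 * Real.pi * ⟪ξ, c⟫ *
        (potentialFourier Φ (EuclideanSpace.single 0 (2 * Real.pi * ‖ξ‖))).re) ^ 2) ∧
    ∫ b, ⟪kick Φ b, planeEmb c⟫ ^ 2 = ∫ ξ : E2, (2 * Real.pi * ⟪ξ, c⟫ *
      (potentialFourier Φ (EuclideanSpace.single 0 (2 * Real.pi * ‖ξ‖))).re) ^ 2 := by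
  obtain ⟨K, hK⟩ := hΦ.exists_norm_kick_le
  have hcont : Continuous (xray Φ) :=
    continuous_iff_continuousAt.2 fun b => (hΦ.hasFDerivAt_xray b).continuousAt
  have hxi : Integrable (xray Φ) := hcont.integrable_of_hasCompactSupport
    (HasCompactSupport.intro (isCompact_closedBall (0 : E2) 1) fun b hb =>
      hΦ.xray_eq_zero (by simpa using (not_le.1 (by simpa using hb)).le))
  set f : E2 → ℂ := fun b => (xray Φ b : ℂ) with hf
  have hfi : Integrable f := hxi.ofReal
  have hfd : ∀ b, HasFDerivAt f (Complex.ofRealCLM.comp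
      ((innerSL ℝ (kick Φ b)).comp planeEmb.toContinuousLinearMap)) b := fun b =>
    Complex.ofRealCLM.hasFDerivAt.comp b (hΦ.hasFDerivAt_xray b)
  have hfdeq : fderiv ℝ f = fun b => Complex.ofRealCLM.comp
      ((innerSL ℝ (kick Φ b)).comp planeEmb.toContinuousLinearMap) :=
    funext fun b => (hfd b).fderiv
  have hfdi : Integrable (fderiv ℝ f) := by
    refine Integrable.mono' (g := fun b => ‖kick Φ b‖) ?_
      (measurable_fderiv ℝ f).aestronglyMeasurable (Eventually.of_forall fun b => ?_)
    · refine memLp_one_iff_integrable.1 (memLp_of_eq_zero_of_one_le hΦ.measurable_kick.norm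
        (M := K) (fun b => by simpa using hK b) (fun b hb => by simp [hΦ.kick_eq_zero hb]) 1)
    · rw [hfdeq]
      refine ContinuousLinearMap.opNorm_le_bound _ (norm_nonneg _) fun y => ?_
      simpa [planeEmb.norm_map] using norm_inner_le_norm (𝕜 := ℝ) (kick Φ b) (planeEmb y)
  set u : E2 → ℝ := fun b => ⟪kick Φ b, planeEmb c⟫ with hu
  have hu_eq : (fun b => fderiv ℝ f b c) = fun b => (u b : ℂ) := by
    rw [hfdeq]
    rfl
  have huL : ∀ p, MemLp u p := memLp_of_eq_zero_of_one_le (M := K * ‖planeEmb c‖)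
    (hΦ.measurable_kick.inner measurable_const)
    (fun b => (abs_real_inner_le_norm _ _).trans (by have := hK b; gcongr))
    (fun b hb => by simp [hu, hΦ.kick_eq_zero hb])
  obtain ⟨h1, h2⟩ := integral_norm_fourier_sq (f := fun b => (u b : ℂ))
    (memLp_one_iff_integrable.1 (huL 1)).ofReal (huL 2).ofReal
  have h3 : ∀ ξ, ‖𝓕 (fun b => (u b : ℂ)) ξ‖ ^ 2 = (2 * Real.pi * ⟪ξ, c⟫ *
      (potentialFourier Φ (EuclideanSpace.single 0 (2 * Real.pi * ‖ξ‖))).re) ^ 2 := fun ξ => by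
    rw [← hu_eq, ← Real.fourier_continuousLinearMap_apply hfdi,
      Real.fourier_fderiv hfi (fun b => (hfd b).differentiableAt) hfdi,
      VectorFourier.fourierSMulRight_apply, hΦ.fourier_xray]
    simp only [neg_apply, innerSL_apply_apply ℝ, norm_smul, norm_neg, norm_mul,
      Complex.norm_I, Complex.norm_real, mul_one, Complex.norm_ofNat, mul_pow, Real.norm_eq_abs,
      sq_abs]
    ring
  simp only [h3] at h2
  constructor
  · refine (h1.integrable_norm_pow two_ne_zero).congr (Eventually.of_forall fun ξ => ?_)
    simpa using h3 ξ
  · rw [h2]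
    simp [hu]

/-- Summing over two orthogonal directions makes the integrand radial in `ξ`; polar coordinates and
`r = 2π ‖ξ‖` leave `(1 / 2π) ∫ r³ Φ̂²`, which is `4A`. -/
lemma IsPairPotential.integral_kick_sq (hΦ : IsPairPotential Φ) :
    (∫ b, kick Φ b 1 ^ 2) + ∫ b, kick Φ b 2 ^ 2 = 4 * landauConst Φ := by
  obtain ⟨i0, h0⟩ := hΦ.integral_inner_kick_sq (EuclideanSpace.single 0 1)
  obtain ⟨i1, h1⟩ := hΦ.integral_inner_kick_sq (EuclideanSpace.single 1 1)
  simp only [planeEmb_single_zero, planeEmb_single_one, EuclideanSpace.inner_single_right, one_mul,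
    conj_trivial] at h0 h1 i0 i1
  rw [h0, h1, ← integral_add i0 i1]
  set p : ℝ → ℝ := fun r => (potentialFourier Φ (EuclideanSpace.single 0 r)).re with hp
  have h2 : ∀ ξ : E2, (2 * Real.pi * ξ 0 * p (2 * Real.pi * ‖ξ‖)) ^ 2 +
      (2 * Real.pi * ξ 1 * p (2 * Real.pi * ‖ξ‖)) ^ 2 =
      (fun r => (2 * Real.pi * r * p (2 * Real.pi * r)) ^ 2) ‖ξ‖ := fun ξ => by
    have := EuclideanSpace.norm_sq_eq ξ
    simp only [Fin.sum_univ_two, Real.norm_eq_abs, sq_abs] at this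
    simp only [mul_pow, this]
    ring
  have h3 := integral_comp_mul_left_Ioi (fun r => r ^ 3 * p r ^ 2) 0
    (b := 2 * Real.pi) (by positivity)
  rw [mul_zero] at h3
  calc _ = ∫ ξ : E2, (fun r => (2 * Real.pi * r * p (2 * Real.pi * r)) ^ 2) ‖ξ‖ := by
        simp only [← h2]
        rfl
    _ = 2 * (Real.pi * ∫ y in Ioi (0 : ℝ), y * (2 * Real.pi * y * p (2 * Real.pi * y)) ^ 2) := by
        rw [integral_fun_norm_addHaar volume
          (fun r => (2 * Real.pi * r * p (2 * Real.pi * r)) ^ 2)]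
        simp [Measure.real, EuclideanSpace.volume_ball_fin_two, Real.pi_pos.le]
    _ = 2 * (Real.pi * ∫ y in Ioi (0 : ℝ), (2 * Real.pi)⁻¹ *
          ((2 * Real.pi * y) ^ 3 * p (2 * Real.pi * y) ^ 2)) := by
        congr 3
        ext y
        have := Real.pi_pos
        field_simp
        try ring
    _ = 4 * landauConst Φ := by
        rw [integral_const_mul, h3, landauConst, smul_eq_mul]
        have := Real.pi_pos
        field_simp
        try ring

/-- The reflection of the `i`-th coordinate. -/
def flipCoord {n : ℕ} (i : Fin n) : EuclideanSpace ℝ (Fin n) ≃ₗᵢ[ℝ] EuclideanSpace ℝ (Fin n) :=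
  LinearIsometryEquiv.piLpCongrRight 2 fun j =>
    if j = i then LinearIsometryEquiv.neg ℝ else LinearIsometryEquiv.refl ℝ ℝ

lemma flipCoord_apply {n : ℕ} (i j : Fin n) (x : EuclideanSpace ℝ (Fin n)) :
    flipCoord i x j = if j = i then -x j else x j := by
  by_cases h : j = i <;> simp [flipCoord, h]

/-- The exchange of two coordinates. -/
def swapCoord {n : ℕ} (i j : Fin n) : EuclideanSpace ℝ (Fin n) ≃ₗᵢ[ℝ] EuclideanSpace ℝ (Fin n) :=
  LinearIsometryEquiv.piLpCongrLeft 2 ℝ ℝ (Equiv.swap i j)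

lemma swapCoord_apply {n : ℕ} (i j k : Fin n) (x : EuclideanSpace ℝ (Fin n)) :
    swapCoord i j x k = x (Equiv.swap i j k) := by
  simp [swapCoord, LinearIsometryEquiv.piLpCongrLeft_apply, Equiv.piCongrLeft'_apply]

lemma IsPairPotential.kick_map (hΦ : IsPairPotential Φ) {R : E3 ≃ₗᵢ[ℝ] E3} {b c : E2}
    (h : ∀ s, R (joinE3 s b) = joinE3 s c) : kick Φ c = R (kick Φ b) := by
  rw [kick, kick, ← LinearIsometryEquiv.coe_toLinearIsometry, ← LinearIsometry.integral_comp_comm]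
  simp only [LinearIsometryEquiv.coe_toLinearIsometry, ← h, hΦ.gradient_map]

/-- Reversing the line reflects the longitudinal force, so its contributions cancel: to first order
the deflection is purely transverse. -/
lemma IsPairPotential.kick_zero (hΦ : IsPairPotential Φ) (b : E2) : kick Φ b 0 = 0 := by
  have h1 : kick Φ b = flipCoord 0 (kick Φ b) := by
    have h2 : ∀ s, flipCoord 0 (joinE3 s b) = joinE3 (-s) b := fun s => by
      ext i
      fin_cases i <;> simp [flipCoord_apply, joinE3]
    conv_lhs => rw [kick, ← integral_neg_eq_self]
    rw [kick, ← LinearIsometryEquiv.coe_toLinearIsometry, ← LinearIsometry.integral_comp_comm]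
    simp only [LinearIsometryEquiv.coe_toLinearIsometry, ← h2, hΦ.gradient_map]
  have h3 := congrArg (fun x : E3 => x 0) h1
  simp only [flipCoord_apply, if_true] at h3
  linarith

lemma IsPairPotential.kick_flipCoord (hΦ : IsPairPotential Φ) (b : E2) :
    kick Φ (flipCoord 0 b) = flipCoord 1 (kick Φ b) :=
  hΦ.kick_map fun s => by
    ext i
    fin_cases i <;> simp [flipCoord_apply, joinE3]

lemma IsPairPotential.kick_swapCoord (hΦ : IsPairPotential Φ) (b : E2) :
    kick Φ (swapCoord 0 1 b) = swapCoord 1 2 (kick Φ b) :=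
  hΦ.kick_map fun s => by
    ext i
    fin_cases i <;> simp [swapCoord_apply, joinE3, Equiv.swap_apply_def]

lemma integral_comp_linearIsometryEquiv {E : Type*} [NormedAddCommGroup E] [InnerProductSpace ℝ E]
    [FiniteDimensional ℝ E] [MeasurableSpace E] [BorelSpace E] (R : E ≃ₗᵢ[ℝ] E) (g : E → ℝ) :
    ∫ x, g (R x) = ∫ x, g x :=
  R.measurePreserving.integral_comp R.toHomeomorph.measurableEmbedding g

/-- The second moments of the deflection. -/
lemma IsPairPotential.integral_kick_mul_kick (hΦ : IsPairPotential Φ) (i j : Fin 3) :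
    ∫ b, kick Φ b i * kick Φ b j = if i = j ∧ i ≠ 0 then 2 * landauConst Φ else 0 := by
  -- A reflection of the plane kills the mixed moment; exchanging the two axes equates the diagonal
  -- ones, each then half of `4A`.
  have h12 : ∫ b, kick Φ b 1 * kick Φ b 2 = 0 := by
    have := integral_comp_linearIsometryEquiv (flipCoord 0) fun b => kick Φ b 1 * kick Φ b 2
    simp [hΦ.kick_flipCoord, flipCoord_apply, integral_neg] at this
    linarith
  have h21 : ∫ b, kick Φ b 2 * kick Φ b 1 = 0 := by simpa [mul_comm] using h12
  have h1122 : ∫ b, kick Φ b 1 ^ 2 = ∫ b, kick Φ b 2 ^ 2 := by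
    have := integral_comp_linearIsometryEquiv (swapCoord 0 1) fun b => kick Φ b 2 ^ 2
    simpa [hΦ.kick_swapCoord, swapCoord_apply] using this
  have hsum := hΦ.integral_kick_sq
  have h11 : ∫ b, kick Φ b 1 * kick Φ b 1 = 2 * landauConst Φ := by
    simp only [← pow_two]
    linarith
  have h22 : ∫ b, kick Φ b 2 * kick Φ b 2 = 2 * landauConst Φ := by
    simp only [← pow_two]
    linarith
  fin_cases i <;> fin_cases j <;> simp [hΦ.kick_zero, h12, h21, h11, h22]

end

/-! ### Second moments of the Born jump. -/

section

variable {Φ : E3 → ℝ} {κ : ℝ}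

lemma IsPairPotential.kick_neg (hΦ : IsPairPotential Φ) (b : E2) : kick Φ (-b) = -kick Φ b := by
  rw [kick, ← integral_neg_eq_self, kick, ← integral_neg]
  congr 1 with s : 1
  rw [← hΦ.gradient_neg]
  congr 1
  ext i
  fin_cases i <;> simp [joinE3]

/-- Substituting `s = U t - ν 0` removes the dependence on the longitudinal position; only the
impact parameter and the crossing time scale `1 / U` remain. -/
lemma IsPairPotential.bornJump_single (hΦ : IsPairPotential Φ) (ν : E3) {U : ℝ} (hU : 0 < U) :
    bornJump Φ κ ν (U • EuclideanSpace.single 0 1) = (κ / U) • kick Φ (planePart ν) := by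
  have h1 : ∀ t : ℝ, t • U • EuclideanSpace.single (0 : Fin 3) (1 : ℝ) - ν =
      joinE3 (U * t - ν 0) (-planePart ν) := fun t => by
    ext i
    fin_cases i <;> simp [joinE3, planePart, mul_comm]
  rw [bornJump]
  simp only [h1]
  rw [Measure.integral_comp_mul_left (fun s => ∇ Φ (joinE3 (s - ν 0) (-planePart ν))),
    integral_sub_right_eq_self (fun s => ∇ Φ (joinE3 s (-planePart ν)))]
  change -κ • |U⁻¹| • kick Φ (-planePart ν) = _
  rw [hΦ.kick_neg, abs_of_pos (by positivity), smul_smul, smul_neg, ← neg_smul, div_eq_mul_inv]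
  congr 1
  ring

/-- The second moments of the change of velocity, to first order in the interaction. -/
lemma IsPairPotential.integral_bornJump (hΦ : IsPairPotential Φ) (κ : ℝ) {V : E3} (hV : V ≠ 0)
    (b : OrthonormalBasis (Fin 3) ℝ E3) (hb : b 0 = ‖V‖⁻¹ • V) (H : E3 →L[ℝ] E3 →L[ℝ] ℝ) :
    ∫ ν : S2, max ⟪(ν : E3), V⟫ 0 * H (bornJump Φ κ ν V) (bornJump Φ κ ν V) ∂sphereMeasure =
      2 * landauConst Φ * κ ^ 2 / ‖V‖ * (H (b 1) (b 1) + H (b 2) (b 2)) := by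
  have hU : 0 < ‖V‖ := norm_pos_iff.2 hV
  obtain ⟨K, hK⟩ := hΦ.exists_norm_kick_le
  set R : E3 ≃ₗᵢ[ℝ] E3 := b.repr.symm with hR
  have hRV : R (‖V‖ • EuclideanSpace.single 0 1) = V := by
    rw [map_smul, hR, b.repr_symm_single, hb, smul_smul, mul_inv_cancel₀ hU.ne', one_smul]
  have hki : ∀ i, Measurable fun c => kick Φ c i := fun i =>
    (by fun_prop : Measurable fun x : E3 => x i).comp hΦ.measurable_kick
  have hkb : ∀ i c, |kick Φ c i| ≤ K := fun i c => (PiLp.norm_apply_le (kick Φ c) i).trans (hK c)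
  have hK0 : 0 ≤ K := (norm_nonneg _).trans (hK 0)
  set g : E2 → ℝ := fun c => ∑ i, ∑ j, kick Φ c i * kick Φ c j * H (b i) (b j) with hg
  have hgm : Measurable g := Finset.measurable_fun_sum _ fun i _ =>
    Finset.measurable_fun_sum _ fun j _ => ((hki i).mul (hki j)).mul_const _
  have hgb : ∀ c, |g c| ≤ ∑ i, ∑ j, K * K * |H (b i) (b j)| := fun c => by
    refine (Finset.abs_sum_le_sum_abs _ _).trans (Finset.sum_le_sum fun i _ => ?_)
    refine (Finset.abs_sum_le_sum_abs _ _).trans (Finset.sum_le_sum fun j _ => ?_)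
    rw [abs_mul, abs_mul]
    gcongr <;> exact hkb _ _
  have hkk : ∀ i j, Integrable fun c => kick Φ c i * kick Φ c j := fun i j =>
    memLp_one_iff_integrable.1 (memLp_of_eq_zero_of_one_le ((hki i).mul (hki j)) (M := K * K)
      (fun c => by
        change |kick Φ c i * kick Φ c j| ≤ K * K
        rw [abs_mul]; gcongr <;> exact hkb _ _)
      (fun c hc => by simp [hΦ.kick_eq_zero hc]) 1)
  have h1 : ∀ ν : S2, max ⟪R (ν : E3), V⟫ 0 * H (bornJump Φ κ (R ν) V) (bornJump Φ κ (R ν) V) =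
      ‖V‖ * (κ / ‖V‖) ^ 2 * (max ((ν : E3) 0) 0 * g (planePart ν)) := fun ν => by
    have h2 : bornJump Φ κ (R ν) V = (κ / ‖V‖) • ∑ i, kick Φ (planePart ν) i • b i := by
      conv_lhs => rw [← hRV, hΦ.bornJump_map, hΦ.bornJump_single _ hU, map_smul]
      rw [hR, b.sum_repr_symm]
    have h3 : ⟪R (ν : E3), V⟫ = ‖V‖ * (ν : E3) 0 := by
      conv_lhs => rw [← hRV, R.inner_map_map, real_inner_smul_right,
        EuclideanSpace.inner_single_right]
      simp
    have h4 : max (‖V‖ * (ν : E3) 0) 0 = ‖V‖ * max ((ν : E3) 0) 0 := by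
      rw [mul_max_of_nonneg _ _ hU.le, mul_zero]
    rw [h2, h3, h4, hg]
    simp only [Fin.sum_univ_three, map_smul, map_add, smul_apply, add_apply, smul_eq_mul]
    ring
  rw [← integral_sphereMeasure_map R fun x =>
    max ⟪x, V⟫ 0 * H (bornJump Φ κ x V) (bornJump Φ κ x V)]
  simp only [h1]
  -- The deflection vanishes for impact parameters of norm at least one, so the disc may be replaced
  -- by the whole plane.
  rw [integral_const_mul, integral_flux hgm hgb, setIntegral_eq_integral_of_forall_compl_eq_zero]
  · have h5 : ∫ c, g c = ∑ i, ∑ j, (∫ c, kick Φ c i * kick Φ c j) * H (b i) (b j) := by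
      rw [hg, integral_finsetSum _ fun i _ => integrable_finsetSum _ fun j _ =>
        (hkk i j).mul_const _]
      refine Finset.sum_congr rfl fun i _ => ?_
      rw [integral_finsetSum _ fun j _ => (hkk i j).mul_const _]
      exact Finset.sum_congr rfl fun j _ => integral_mul_const _ _
    rw [h5]
    simp only [hΦ.integral_kick_mul_kick, Fin.sum_univ_three]
    simp
    field_simp
  · intro c hc
    have hc : 1 ≤ ‖c‖ := by simpa using hc
    simp [hg, hΦ.kick_eq_zero hc]

lemma measurable_inner_sphere (V : E3) : Measurable fun ν : S2 => max ⟪(ν : E3), V⟫ 0 := by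
  have : Continuous fun ν : S2 => max ⟪(ν : E3), V⟫ 0 := by fun_prop
  exact this.measurable

/-- The area of the unit sphere. -/
def sphereArea : ℝ := sphereMeasure.real univ

lemma abs_inner_mul_le {V : E3} {X : S2 → ℝ} {M : ℝ} (hM : 0 ≤ M)
    (hX : ∀ ν : S2, 0 < ⟪(ν : E3), V⟫ → |X ν| ≤ M) (ν : S2) :
    ‖max ⟪(ν : E3), V⟫ 0 * X ν‖ ≤ ‖V‖ * M := by
  rcases le_or_gt ⟪(ν : E3), V⟫ 0 with h | h
  · rw [max_eq_right h]
    simp only [zero_mul, norm_zero]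
    positivity
  · have h1 := real_inner_le_norm (ν : E3) V
    rw [norm_eq_of_mem_sphere, one_mul] at h1
    rw [max_eq_left h.le, norm_mul, Real.norm_of_nonneg h.le, Real.norm_eq_abs]
    have := hX ν h
    gcongr

lemma integrable_inner_mul {V : E3} {X : S2 → ℝ} (hXm : Measurable X) {M : ℝ} (hM : 0 ≤ M)
    (hX : ∀ ν : S2, 0 < ⟪(ν : E3), V⟫ → |X ν| ≤ M) :
    Integrable (fun ν : S2 => max ⟪(ν : E3), V⟫ 0 * X ν) sphereMeasure :=
  Integrable.of_bound ((measurable_inner_sphere V).mul hXm).aestronglyMeasurable (‖V‖ * M)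
    (Eventually.of_forall (abs_inner_mul_le hM hX))

lemma abs_integral_inner_mul_le {V : E3} {X : S2 → ℝ} {M : ℝ} (hM : 0 ≤ M)
    (hX : ∀ ν : S2, 0 < ⟪(ν : E3), V⟫ → |X ν| ≤ M) :
    |∫ ν : S2, max ⟪(ν : E3), V⟫ 0 * X ν ∂sphereMeasure| ≤ sphereArea * (‖V‖ * M) := by
  have := norm_integral_le_of_norm_le_const (μ := sphereMeasure)
    (Eventually.of_forall (abs_inner_mul_le hM hX))
  rw [mul_comm]
  exact this

end

/-! ### The mean jump, by axial symmetry and energy conservation. -/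

section

variable {Φ : E3 → ℝ} {κ : ℝ}

/-- The rotation by the angle `π` around an axis. -/
lemma exists_half_turn (V : E3) :
    ∃ R : E3 ≃ₗᵢ[ℝ] E3, ∀ x, R x = (2 * (⟪V, x⟫ / ‖V‖ ^ 2)) • V - x := by
  refine ⟨(ℝ ∙ V).reflection, fun x => ?_⟩
  rw [Submodule.reflection_apply, Submodule.starProjection_singleton]
  simp only [RCLike.ofReal_real_eq_id, id]
  module

/-- Equality in Cauchy–Schwarz leaves only the direction of `V`, a null set on the sphere. -/
lemma ae_norm_sq_ne_inner_sq {V : E3} (hV : V ≠ 0) :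
    ∀ᵐ ν : S2 ∂sphereMeasure, 0 < ⟪(ν : E3), V⟫ → ‖V‖ ^ 2 ≠ ⟪(ν : E3), V⟫ ^ 2 := by
  have hU : 0 < ‖V‖ := norm_pos_iff.2 hV
  have hne : ‖‖V‖⁻¹ • V‖ = 1 := by
    rw [norm_smul, norm_inv, norm_norm, inv_mul_cancel₀ hU.ne']
  have hae : ∀ᵐ ν ∂sphereMeasure, ν ≠ (⟨‖V‖⁻¹ • V, by simpa using hne⟩ : S2) := by
    simp [ae_iff]
  filter_upwards [hae] with ν hν h heq
  refine hν (Subtype.ext ?_)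
  have h3 : ⟪(ν : E3), V⟫ = ‖(ν : E3)‖ * ‖V‖ := by
    rw [norm_eq_of_mem_sphere, one_mul]
    exact ((pow_left_inj₀ hU.le h.le two_ne_zero).1 heq).symm
  have h4 := inner_eq_norm_mul_iff_real.1 h3
  rw [norm_eq_of_mem_sphere, one_smul] at h4
  simp only
  conv_rhs => rw [← h4, smul_smul]
  rw [h4, inv_mul_cancel₀ hU.ne', one_smul]

lemma IsPairPotential.measurable_jump_sphere (hΦ : IsPairPotential Φ) (hκ : 0 ≤ κ) (V : E3) :
    Measurable fun ν : S2 => jump Φ κ ν V := by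
  have h : Measurable fun ν : E3 => (ν, V) := measurable_id.prodMk measurable_const
  have h1 : Measurable fun ν : E3 => jump Φ κ ν V := by
    simpa only [Function.comp_def] using (hΦ.measurable_jump hκ).comp h
  exact h1.comp measurable_subtype_coe

/-- The mean change of velocity is parallel to the relative velocity, and it is determined by the
mean square of the change of velocity. -/
lemma IsPairPotential.integral_jump (hΦ : IsPairPotential Φ) (hκ : 0 ≤ κ) {V : E3} (hV : V ≠ 0)
    (p : E3 →L[ℝ] ℝ) :
    ∫ ν : S2, max ⟪(ν : E3), V⟫ 0 * p (jump Φ κ ν V) ∂sphereMeasure =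
      -(p V / ‖V‖ ^ 2) * ∫ ν : S2, max ⟪(ν : E3), V⟫ 0 * ‖jump Φ κ ν V‖ ^ 2 ∂sphereMeasure := by
  have hU : 0 < ‖V‖ := norm_pos_iff.2 hV
  have hjm := hΦ.measurable_jump_sphere hκ V
  have hjb : ∀ ν : S2, ‖jump Φ κ ν V‖ ≤ ‖V‖ := fun ν =>
    hΦ.norm_jump_le_norm hκ (norm_eq_of_mem_sphere ν)
  have hint : ∀ q : E3 →L[ℝ] ℝ, Integrable
      (fun ν : S2 => max ⟪(ν : E3), V⟫ 0 * q (jump Φ κ ν V)) sphereMeasure := fun q =>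
    integrable_inner_mul (q.continuous.measurable.comp hjm) (M := ‖q‖ * ‖V‖) (by positivity)
      fun ν _ => (q.le_opNorm _).trans (by have := hjb ν; gcongr)
  obtain ⟨R, hRx⟩ := exists_half_turn V
  have hRV : R V = V := by
    rw [hRx, real_inner_self_eq_norm_sq, div_self (by positivity)]
    module
  -- `q` is the part of `p` that vanishes on `V`. The half turn around `V` preserves the flux and
  -- reverses `q`, so the mean of `q` over the jumps is zero.
  obtain ⟨q, hq⟩ : ∃ q : E3 →L[ℝ] ℝ, ∀ x, q x = p x - p V / ‖V‖ ^ 2 * innerSL ℝ V x :=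
    ⟨p - (p V / ‖V‖ ^ 2) • innerSL ℝ V, fun x => rfl⟩
  have hqR : ∀ x, q (R x) = -q x := fun x => by
    have h1 : q V = 0 := by
      rw [hq, innerSL_apply_apply ℝ, real_inner_self_eq_norm_sq]
      field_simp
      ring
    rw [hRx, map_sub, map_smul, h1]
    simp
  have h0 : ∫ ν : S2, max ⟪(ν : E3), V⟫ 0 * q (jump Φ κ ν V) ∂sphereMeasure = 0 := by
    have h1 := integral_sphereMeasure_map R fun x => max ⟪x, V⟫ 0 * q (jump Φ κ x V)
    have h2 : ∀ x : E3, max ⟪R x, V⟫ 0 * q (jump Φ κ (R x) V) =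
        -(max ⟪x, V⟫ 0 * q (jump Φ κ x V)) := fun x => by
      have h3 : jump Φ κ (R x) V = R (jump Φ κ x V) := by
        conv_lhs => rw [← hRV]
        exact hΦ.jump_map hκ R x V
      have h4 : ⟪R x, V⟫ = ⟪x, V⟫ := by
        conv_lhs => rw [← hRV]
        exact R.inner_map_map x V
      rw [h3, h4, hqR]
      ring
    simp only [h2] at h1
    rw [integral_neg] at h1
    linarith
  have h1 : ∫ ν : S2, max ⟪(ν : E3), V⟫ 0 * p (jump Φ κ ν V) ∂sphereMeasure =
      (p V / ‖V‖ ^ 2) * ∫ ν : S2, max ⟪(ν : E3), V⟫ 0 * innerSL ℝ V (jump Φ κ ν V)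
        ∂sphereMeasure := by
    rw [← integral_const_mul, ← sub_eq_zero, ← integral_sub (hint p) ((hint _).const_mul _)]
    refine Eq.trans (integral_congr_ae (Eventually.of_forall fun ν => ?_)) h0
    simp only [hq]
    ring
  rw [h1, neg_mul, ← mul_neg, ← integral_neg]
  congr 1
  refine integral_congr_ae ?_
  -- Off the head-on direction, conservation of the relative speed replaces `⟪V, J⟫` by `-‖J‖²`.
  filter_upwards [ae_norm_sq_ne_inner_sq hV] with ν hν
  rcases le_or_gt ⟪(ν : E3), V⟫ 0 with h | h
  · simp [max_eq_right h]
  · rw [innerSL_apply_apply ℝ, hΦ.inner_jump hκ (norm_eq_of_mem_sphere ν) (hν h)]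
    ring

end

/-! ### Expansion of the collision integral in the strength of the interaction. -/

section

variable {Φ : E3 → ℝ} {κ : ℝ}

lemma IsPairPotential.measurable_bornJump_sphere (hΦ : IsPairPotential Φ) (κ : ℝ) (V : E3) :
    Measurable fun ν : S2 => bornJump Φ κ ν V :=
  (hΦ.measurable_bornJump κ V).comp measurable_subtype_coe

lemma abs_bilinear_sub_le {H : E3 →L[ℝ] E3 →L[ℝ] ℝ} {B : ℝ} (hH : ‖H‖ ≤ B) (x y : E3) :
    |H x x - H y y| ≤ B * (‖x - y‖ * (‖x‖ + ‖y‖)) := by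
  have h1 : H x x - H y y = H (x - y) x + H y (x - y) := by
    simp only [map_sub, sub_apply]
    ring
  have h2 : |H (x - y) x| ≤ B * ‖x - y‖ * ‖x‖ :=
    (H.le_opNorm₂ _ _).trans (by gcongr)
  have h3 : |H y (x - y)| ≤ B * ‖y‖ * ‖x - y‖ :=
    (H.le_opNorm₂ _ _).trans (by gcongr)
  rw [h1]
  refine (abs_add_le _ _).trans ?_
  linarith

lemma sphereArea_nonneg : 0 ≤ sphereArea := measureReal_nonneg

/-- The collision integral of a function with controlled Taylor expansion, to leading order and to
second order in the strength of the interaction. -/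
lemma IsPairPotential.exists_collision_bounds (hΦ : IsPairPotential Φ) :
    ∃ C : ℝ, 0 < C ∧ ∀ κ : ℝ, 0 ≤ κ → ∀ V : E3, V ≠ 0 → ∀ (δ : E3 → ℝ) (B : ℝ)
      (p : E3 →L[ℝ] ℝ) (H : E3 →L[ℝ] E3 →L[ℝ] ℝ), Measurable δ → ‖p‖ ≤ B → ‖H‖ ≤ B →
      (∀ w, |δ w - p w| ≤ B * ‖w‖ ^ 2) → (∀ w, |δ w - p w - 1 / 2 * H w w| ≤ B * ‖w‖ ^ 3) →
      ∀ b : OrthonormalBasis (Fin 3) ℝ E3, b 0 = ‖V‖⁻¹ • V →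
      |∫ ν : S2, max ⟪(ν : E3), V⟫ 0 * δ (jump Φ κ ν V) ∂sphereMeasure|
        ≤ C * B * κ ^ 2 * (1 + ‖V‖⁻¹) ^ 2 ∧
      |(∫ ν : S2, max ⟪(ν : E3), V⟫ 0 * δ (jump Φ κ ν V) ∂sphereMeasure) - κ ^ 2 *
          (landauConst Φ * (‖V‖⁻¹ * (H (b 1) (b 1) + H (b 2) (b 2)) - 4 * ‖V‖⁻¹ ^ 3 * p V))|
        ≤ C * B * κ ^ 3 * (1 + ‖V‖⁻¹) ^ 4 := by
  obtain ⟨c, hc, hbounds⟩ := hΦ.exists_jump_bounds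
  have hσ := sphereArea_nonneg
  refine ⟨sphereArea * (3 * c ^ 2 + c ^ 3) + 1, by positivity,
    fun κ hκ V hV δ B p H hδ hp hH h2 h3 b hb => ?_⟩
  have hB : 0 ≤ B := (norm_nonneg _).trans hp
  have hU : 0 < ‖V‖ := norm_pos_iff.2 hV
  set a := ‖V‖⁻¹ with ha
  have ha0 : 0 < a := inv_pos.2 hU
  have hUa : ‖V‖ * a = 1 := mul_inv_cancel₀ hU.ne'
  have hJm := hΦ.measurable_jump_sphere hκ V
  have hJ0m := hΦ.measurable_bornJump_sphere κ V
  have hJ : ∀ ν : S2, 0 < ⟪(ν : E3), V⟫ → ‖jump Φ κ ν V‖ ≤ c * κ * a := fun ν h => by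
    have := (hbounds κ hκ ν V (norm_eq_of_mem_sphere ν) h.le hV).1
    rwa [div_eq_mul_inv] at this
  have hJ0 : ∀ ν : S2, 0 < ⟪(ν : E3), V⟫ → ‖bornJump Φ κ ν V‖ ≤ c * κ * a := fun ν h => by
    have := (hbounds κ hκ ν V (norm_eq_of_mem_sphere ν) h.le hV).2.1
    rwa [div_eq_mul_inv] at this
  have hdiff : ∀ ν : S2, 0 < ⟪(ν : E3), V⟫ → ‖jump Φ κ ν V - bornJump Φ κ ν V‖ *
      (‖jump Φ κ ν V‖ + ‖bornJump Φ κ ν V‖) ≤ 2 * c ^ 2 * κ ^ 3 * a ^ 4 := fun ν h => by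
    have h4 := (hbounds κ hκ ν V (norm_eq_of_mem_sphere ν) h.le hV).2.2
    rw [div_eq_mul_inv, ← inv_pow, ← ha] at h4
    calc _ ≤ c * κ ^ 2 * a ^ 3 * (c * κ * a + c * κ * a) := by
          have := hJ ν h
          have := hJ0 ν h
          gcongr
      _ = _ := by ring
  have hpm : Measurable fun ν : S2 => p (jump Φ κ ν V) := p.continuous.measurable.comp hJm
  have hδm : Measurable fun ν : S2 => δ (jump Φ κ ν V) := hδ.comp hJm
  have hquad : ∀ T : E3 →L[ℝ] E3 →L[ℝ] ℝ, Continuous fun x => T x x := fun T => by fun_prop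
  have hip := integrable_inner_mul (V := V) hpm (M := B * (c * κ * a)) (by positivity) fun ν h =>
    (p.le_opNorm _).trans (by have := hJ ν h; gcongr)
  have hiT : ∀ T : E3 →L[ℝ] E3 →L[ℝ] ℝ, Integrable (fun ν : S2 => max ⟪(ν : E3), V⟫ 0 *
      T (jump Φ κ ν V) (jump Φ κ ν V)) sphereMeasure := fun T =>
    integrable_inner_mul ((hquad T).measurable.comp hJm) (M := ‖T‖ * (c * κ * a) * (c * κ * a))
      (by positivity) fun ν h => (T.le_opNorm₂ _ _).trans (by have := hJ ν h; gcongr)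
  have hiT0 : ∀ T : E3 →L[ℝ] E3 →L[ℝ] ℝ, Integrable (fun ν : S2 => max ⟪(ν : E3), V⟫ 0 *
      T (bornJump Φ κ ν V) (bornJump Φ κ ν V)) sphereMeasure := fun T =>
    integrable_inner_mul ((hquad T).measurable.comp hJ0m) (M := ‖T‖ * (c * κ * a) * (c * κ * a))
      (by positivity) fun ν h => (T.le_opNorm₂ _ _).trans (by have := hJ0 ν h; gcongr)
  have hE2 : ∀ ν : S2, 0 < ⟪(ν : E3), V⟫ →
      |δ (jump Φ κ ν V) - p (jump Φ κ ν V)| ≤ B * (c * κ * a) ^ 2 := fun ν h =>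
    (h2 _).trans (by have := hJ ν h; gcongr)
  have hE3 : ∀ ν : S2, 0 < ⟪(ν : E3), V⟫ → |δ (jump Φ κ ν V) - p (jump Φ κ ν V) -
      1 / 2 * H (jump Φ κ ν V) (jump Φ κ ν V)| ≤ B * (c * κ * a) ^ 3 := fun ν h =>
    (h3 _).trans (by have := hJ ν h; gcongr)
  have hiE2 : Integrable (fun ν : S2 => max ⟪(ν : E3), V⟫ 0 *
      (δ (jump Φ κ ν V) - p (jump Φ κ ν V))) sphereMeasure :=
    integrable_inner_mul (V := V) (hδm.sub hpm) (by positivity) hE2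
  have hiE3 : Integrable (fun ν : S2 => max ⟪(ν : E3), V⟫ 0 * (δ (jump Φ κ ν V) -
      p (jump Φ κ ν V) - 1 / 2 * H (jump Φ κ ν V) (jump Φ κ ν V))) sphereMeasure :=
    integrable_inner_mul (V := V)
    ((hδm.sub hpm).sub (((hquad H).measurable.comp hJm).const_mul (1 / 2))) (by positivity) hE3
  have hbE2 := abs_integral_inner_mul_le (by positivity) hE2
  have hbE3 := abs_integral_inner_mul_le (by positivity) hE3
  set N := ∫ ν : S2, max ⟪(ν : E3), V⟫ 0 * δ (jump Φ κ ν V) ∂sphereMeasure with hN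
  set P := ∫ ν : S2, max ⟪(ν : E3), V⟫ 0 * p (jump Φ κ ν V) ∂sphereMeasure with hP
  set Q : (E3 →L[ℝ] E3 →L[ℝ] ℝ) → ℝ := fun T => ∫ ν : S2, max ⟪(ν : E3), V⟫ 0 *
    T (jump Φ κ ν V) (jump Φ κ ν V) ∂sphereMeasure with hQ
  set Q0 : (E3 →L[ℝ] E3 →L[ℝ] ℝ) → ℝ := fun T => ∫ ν : S2, max ⟪(ν : E3), V⟫ 0 *
    T (bornJump Φ κ ν V) (bornJump Φ κ ν V) ∂sphereMeasure with hQ0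
  set R2 := ∫ ν : S2, max ⟪(ν : E3), V⟫ 0 * (δ (jump Φ κ ν V) - p (jump Φ κ ν V)) ∂sphereMeasure
    with hR2
  set R3 := ∫ ν : S2, max ⟪(ν : E3), V⟫ 0 * (δ (jump Φ κ ν V) - p (jump Φ κ ν V) -
    1 / 2 * H (jump Φ κ ν V) (jump Φ κ ν V)) ∂sphereMeasure with hR3
  have hN2 : N = P + R2 := by
    rw [hN, hP, hR2, ← integral_add hip hiE2]
    congr 1 with ν
    ring
  have hN3 : R2 = 1 / 2 * Q H + R3 := by
    rw [hR2, hQ, hR3, ← integral_const_mul, ← integral_add ((hiT H).const_mul _) hiE3]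
    congr 1 with ν
    ring
  -- The linear term becomes a quadratic moment, that of the form `innerSL ℝ`; the Born error
  -- therefore enters only through `Q - Q0`.
  have hPS : P = -(p V * a ^ 2) * Q (innerSL ℝ) := by
    rw [hP, hΦ.integral_jump hκ hV p, hQ, ha, inv_pow, ← div_eq_mul_inv]
    simp only [innerSL_apply_apply ℝ, real_inner_self_eq_norm_sq]
  have hQ0T : ∀ T, Q0 T = 2 * landauConst Φ * κ ^ 2 * a * (T (b 1) (b 1) + T (b 2) (b 2)) :=
    fun T => by
      rw [hQ0]
      simp only
      rw [hΦ.integral_bornJump κ hV b hb T, ha, div_eq_mul_inv]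
  have hQ0S : Q0 (innerSL ℝ) = 4 * landauConst Φ * κ ^ 2 * a := by
    rw [hQ0T]
    simp only [innerSL_apply_apply ℝ, real_inner_self_eq_norm_sq, b.norm_eq_one]
    ring
  have hQdiff : ∀ (T : E3 →L[ℝ] E3 →L[ℝ] ℝ) (M : ℝ), ‖T‖ ≤ M →
      |Q T - Q0 T| ≤ 2 * sphereArea * c ^ 2 * κ ^ 3 * a ^ 3 * M := fun T M hM => by
    have hM0 : 0 ≤ M := (norm_nonneg T).trans hM
    have h4 := abs_integral_inner_mul_le (V := V) (X := fun ν : S2 =>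
      T (jump Φ κ ν V) (jump Φ κ ν V) - T (bornJump Φ κ ν V) (bornJump Φ κ ν V))
      (M := M * (2 * c ^ 2 * κ ^ 3 * a ^ 4)) (by positivity) fun ν h =>
        (abs_bilinear_sub_le hM _ _).trans (by have := hdiff ν h; gcongr)
    have h5 : Q T - Q0 T = ∫ ν : S2, max ⟪(ν : E3), V⟫ 0 * (T (jump Φ κ ν V) (jump Φ κ ν V) -
        T (bornJump Φ κ ν V) (bornJump Φ κ ν V)) ∂sphereMeasure := by
      rw [hQ, hQ0]
      simp only
      rw [← integral_sub (hiT T) (hiT0 T)]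
      congr 1 with ν
      ring
    rw [h5]
    refine h4.trans (le_of_eq ?_)
    calc _ = 2 * sphereArea * c ^ 2 * κ ^ 3 * a ^ 3 * M * (‖V‖ * a) := by ring
      _ = _ := by rw [hUa, mul_one]
  have hS : |Q (innerSL ℝ)| ≤ sphereArea * c ^ 2 * κ ^ 2 * a := by
    have h4 := abs_integral_inner_mul_le (V := V) (X := fun ν : S2 =>
      innerSL ℝ (jump Φ κ ν V) (jump Φ κ ν V)) (M := (c * κ * a) ^ 2) (by positivity) fun ν h => by
        rw [innerSL_apply_apply ℝ, real_inner_self_eq_norm_sq, abs_of_nonneg (sq_nonneg _)]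
        have := hJ ν h
        gcongr
    refine h4.trans (le_of_eq ?_)
    calc _ = sphereArea * c ^ 2 * κ ^ 2 * a * (‖V‖ * a) := by ring
      _ = _ := by rw [hUa, mul_one]
  have hpV : |p V * a ^ 2| ≤ B * a := by
    have h4 : |p V| ≤ B * ‖V‖ := (p.le_opNorm V).trans (by gcongr)
    rw [abs_mul, abs_of_nonneg (sq_nonneg a)]
    calc _ ≤ B * ‖V‖ * a ^ 2 := by gcongr
      _ = B * a * (‖V‖ * a) := by ring
      _ = _ := by rw [hUa, mul_one]
  have hbE2' : |R2| ≤ sphereArea * B * c ^ 2 * κ ^ 2 * a := hbE2.trans (le_of_eq (by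
    calc _ = sphereArea * B * c ^ 2 * κ ^ 2 * a * (‖V‖ * a) := by ring
      _ = _ := by rw [hUa, mul_one]))
  have hbE3' : |R3| ≤ sphereArea * B * c ^ 3 * κ ^ 3 * a ^ 2 := hbE3.trans (le_of_eq (by
    calc _ = sphereArea * B * c ^ 3 * κ ^ 3 * a ^ 2 * (‖V‖ * a) := by ring
      _ = _ := by rw [hUa, mul_one]))
  have ha4 : 1 ≤ 1 + a := by linarith
  constructor
  · have h5 : |P| ≤ B * a * (sphereArea * c ^ 2 * κ ^ 2 * a) := by
      rw [hPS, abs_mul, abs_neg]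
      gcongr
    rw [hN2]
    calc |P + R2| ≤ |P| + |R2| := abs_add_le _ _
      _ ≤ B * a * (sphereArea * c ^ 2 * κ ^ 2 * a) + sphereArea * B * c ^ 2 * κ ^ 2 * a :=
        add_le_add h5 hbE2'
      _ = sphereArea * c ^ 2 * (B * κ ^ 2 * (a ^ 2 + a)) := by ring
      _ ≤ (sphereArea * (3 * c ^ 2 + c ^ 3) + 1) * (B * κ ^ 2 * (1 + a) ^ 2) := by
        gcongr
        · have : 0 ≤ sphereArea * (2 * c ^ 2 + c ^ 3) := by positivity
          linarith
        · nlinarith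
      _ = _ := by ring
  -- Replacing `Q` by `Q0` leaves exactly the Landau integrand, so the error is the Born error in
  -- drift and diffusion plus the cubic Taylor remainder, of orders `κ³ a⁴`, `κ³ a³` and `κ³ a²`.
  · have h6 : N - κ ^ 2 * (landauConst Φ * (a * (H (b 1) (b 1) + H (b 2) (b 2)) -
        4 * a ^ 3 * p V)) = -(p V * a ^ 2) * (Q (innerSL ℝ) - Q0 (innerSL ℝ)) +
        1 / 2 * (Q H - Q0 H) + R3 := by
      rw [hN2, hN3, hPS, hQ0S, hQ0T H]
      ring
    have h7 := hQdiff (innerSL ℝ) 1 (norm_innerSL_le ℝ)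
    have h8 := hQdiff H B hH
    rw [h6]
    calc _ ≤ |-(p V * a ^ 2) * (Q (innerSL ℝ) - Q0 (innerSL ℝ))| + |1 / 2 * (Q H - Q0 H)| + |R3| :=
          abs_add_three _ _ _
      _ ≤ B * a * (2 * sphereArea * c ^ 2 * κ ^ 3 * a ^ 3 * 1) +
          1 / 2 * (2 * sphereArea * c ^ 2 * κ ^ 3 * a ^ 3 * B) +
          sphereArea * B * c ^ 3 * κ ^ 3 * a ^ 2 := by
        rw [abs_mul (-(p V * a ^ 2)), abs_neg, abs_mul (1 / 2 : ℝ),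
          abs_of_pos (by norm_num : (0 : ℝ) < 1 / 2)]
        gcongr
      _ = sphereArea * (2 * c ^ 2 * a ^ 4 + c ^ 2 * a ^ 3 + c ^ 3 * a ^ 2) * (B * κ ^ 3) := by ring
      _ ≤ sphereArea * (2 * c ^ 2 * (1 + a) ^ 4 + c ^ 2 * (1 + a) ^ 4 + c ^ 3 * (1 + a) ^ 4) *
          (B * κ ^ 3) := by
        have e3 : a ^ 3 ≤ (1 + a) ^ 4 := (pow_le_pow_left₀ ha0.le (by linarith) 3).trans
          (pow_le_pow_right₀ ha4 (by norm_num))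
        have e2 : a ^ 2 ≤ (1 + a) ^ 4 := (pow_le_pow_left₀ ha0.le (by linarith) 2).trans
          (pow_le_pow_right₀ ha4 (by norm_num))
        have e4 : a ^ 4 ≤ (1 + a) ^ 4 := pow_le_pow_left₀ ha0.le (by linarith) 4
        gcongr
      _ = sphereArea * (3 * c ^ 2 + c ^ 3) * (B * κ ^ 3 * (1 + a) ^ 4) := by ring
      _ ≤ (sphereArea * (3 * c ^ 2 + c ^ 3) + 1) * (B * κ ^ 3 * (1 + a) ^ 4) := by
        gcongr
        linarith
      _ = _ := by ring

end

/-! ### Uniform bounds and Taylor expansions for core functions. -/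

section

variable {G : Type*} [NormedAddCommGroup G] [NormedSpace ℝ G]

/-- Smooth functions of `(x, v)` with values in a normed space that are periodic in `x` and
compactly supported in `v`. -/
structure IsCoreFamily (u : E3 → E3 → G) : Prop where
  smooth : ContDiff ℝ ∞ (Function.uncurry u)
  periodic : ∀ v i, Function.Periodic (fun x => u x v) (EuclideanSpace.single i 1)
  compactSupport : ∃ R : ℝ, ∀ x v, R < ‖v‖ → u x v = 0

lemma IsCoreFunction.isCoreFamily {f : E3 → E3 → ℝ} (hf : IsCoreFunction f) : IsCoreFamily f :=
  ⟨hf.smooth, fun v i x => hf.periodic x v i, hf.compactSupport⟩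

lemma exists_sub_mem_unitCell (x : E3) : ∃ n : Fin 3 → ℤ,
    x - ∑ i, n i • (EuclideanSpace.single i 1 : E3) ∈ unitCell := by
  refine ⟨fun i => ⌊x i⌋, fun i => ?_⟩
  have h : (x - ∑ j, ⌊x j⌋ • (EuclideanSpace.single j 1 : E3)) i = Int.fract (x i) := by
    simp [Fin.sum_univ_three, ← Int.self_sub_floor]
    fin_cases i <;> simp
  rw [h]
  exact ⟨Int.fract_nonneg _, Int.fract_lt_one _⟩

lemma unitCell_subset_closedBall : unitCell ⊆ Metric.closedBall (0 : E3) 2 := fun x hx => by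
  rw [mem_closedBall_zero_iff, ← sq_le_sq₀ (norm_nonneg _) zero_le_two, EuclideanSpace.norm_sq_eq,
    Fin.sum_univ_three]
  have h : ∀ i, ‖x i‖ ^ 2 ≤ 1 := fun i => by
    rw [Real.norm_eq_abs, sq_abs]
    nlinarith [(hx i).1, (hx i).2]
  linarith [h 0, h 1, h 2]

namespace IsCoreFamily

variable {u : E3 → E3 → G}

lemma continuous (hu : IsCoreFamily u) : Continuous (Function.uncurry u) := hu.smooth.continuous

lemma smooth_right (hu : IsCoreFamily u) (x : E3) : ContDiff ℝ ∞ (u x) :=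
  hu.smooth.comp (contDiff_const.prodMk contDiff_id)

/-- Periodicity moves `x` into the unit cell, and the velocities outside a ball do not contribute;
compactness does the rest. -/
lemma exists_bound (hu : IsCoreFamily u) : ∃ B : ℝ, 0 < B ∧ ∀ x v, ‖u x v‖ ≤ B := by
  obtain ⟨R, hR⟩ := hu.compactSupport
  obtain ⟨B, hB⟩ := ((isCompact_closedBall (0 : E3) 2).prod
    (isCompact_closedBall (0 : E3) R)).exists_bound_of_continuousOn hu.continuous.continuousOn
  refine ⟨max B 1, by positivity, fun x v => ?_⟩
  rcases lt_or_ge R ‖v‖ with h | h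
  · rw [hR x v h, norm_zero]
    positivity
  obtain ⟨n, hn⟩ := exists_sub_mem_unitCell x
  have hp : u (x - ∑ i, n i • (EuclideanSpace.single i 1 : E3)) v = u x v := by
    rw [Fin.sum_univ_three, ← sub_sub, ← sub_sub]
    rw [((hu.periodic v 2).sub_zsmul_eq (n 2)), ((hu.periodic v 1).sub_zsmul_eq (n 1)),
      ((hu.periodic v 0).sub_zsmul_eq (n 0))]
  rw [← hp]
  exact (hB (_, v) ⟨unitCell_subset_closedBall hn, mem_closedBall_zero_iff.2 h⟩).trans
    (le_max_left _ _)

/-- The derivative in the velocity. -/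
lemma fderiv_right (hu : IsCoreFamily u) : IsCoreFamily fun x v => fderiv ℝ (u x) v where
  smooth := by
    refine ContDiff.fderiv (f := fun (z : E3 × E3) v => u z.1 v) (m := ∞) ?_ contDiff_snd (by simp)
    exact hu.smooth.comp (contDiff_fst.fst.prodMk contDiff_snd)
  periodic v i x := by
    have h : u (x + EuclideanSpace.single i 1) = u x := funext fun w => hu.periodic w i x
    simp only [h]
  compactSupport := by
    obtain ⟨R, hR⟩ := hu.compactSupport
    refine ⟨R, fun x v hv => ?_⟩
    have h : u x =ᶠ[𝓝 v] fun _ => 0 := by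
      filter_upwards [(isOpen_lt continuous_const continuous_norm).mem_nhds hv] with w hw
      exact hR x w hw
    rw [h.fderiv_eq, fderiv_fun_const, Pi.zero_apply]

/-- The derivative in the position. -/
lemma fderiv_left (hu : IsCoreFamily u) :
    IsCoreFamily fun x v => fderiv ℝ (fun y => u y v) x where
  smooth := by
    refine ContDiff.fderiv (f := fun (z : E3 × E3) y => u y z.2) (m := ∞) ?_ contDiff_fst (by simp)
    exact hu.smooth.comp (contDiff_snd.prodMk contDiff_fst.snd)
  periodic v i x := by
    have h : (fun y => u (y + EuclideanSpace.single i 1) v) = fun y => u y v :=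
      funext (hu.periodic v i)
    simp only [← fderiv_comp_add_right (f := fun y => u y v), h]
  compactSupport := by
    obtain ⟨R, hR⟩ := hu.compactSupport
    refine ⟨R, fun x v hv => ?_⟩
    have h : (fun y => u y v) = fun _ => 0 := funext fun y => hR y v hv
    rw [h, fderiv_fun_const, Pi.zero_apply]

end IsCoreFamily

lemma norm_sub_fderiv_le {g : E3 → G} (hg : ContDiff ℝ 2 g) {B : ℝ}
    (hB : ∀ v, ‖fderiv ℝ (fderiv ℝ g) v‖ ≤ B) (v w : E3) :
    ‖g (v + w) - g v - fderiv ℝ g v w‖ ≤ B * ‖w‖ ^ 2 := by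
  have hd : Differentiable ℝ (fderiv ℝ g) :=
    (hg.fderiv_right (m := 1) (by norm_num)).differentiable one_ne_zero
  have hB0 : 0 ≤ B := le_trans (norm_nonneg (fderiv ℝ (fderiv ℝ g) 0)) (hB 0)
  have h := (convex_closedBall v ‖w‖).norm_image_sub_le_of_norm_hasFDerivWithin_le' (f := g)
    (f' := fderiv ℝ g) (φ := fderiv ℝ g v) (C := B * ‖w‖) (x := v) (y := v + w)
    (fun x _ => (hg.differentiable two_ne_zero x).hasFDerivAt.hasFDerivWithinAt)
    (fun x hx => (convex_univ.norm_image_sub_le_of_norm_fderiv_le (fun y _ => hd y)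
      (fun y _ => hB y) (mem_univ v) (mem_univ x)).trans
      (by gcongr; exact mem_closedBall_iff_norm.1 hx))
    (Metric.mem_closedBall_self (norm_nonneg _)) (by simp)
  rw [add_sub_cancel_left] at h
  exact h.trans (le_of_eq (by ring))

lemma IsCoreFamily.exists_norm_sub_fderiv_le {u : E3 → E3 → G} (hu : IsCoreFamily u) :
    ∃ B : ℝ, 0 < B ∧ ∀ x v w, ‖u x (v + w) - u x v - fderiv ℝ (u x) v w‖ ≤ B * ‖w‖ ^ 2 := by
  obtain ⟨B, hB0, hB⟩ := hu.fderiv_right.fderiv_right.exists_bound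
  exact ⟨B, hB0, fun x => norm_sub_fderiv_le
    ((hu.smooth_right x).of_le (WithTop.coe_le_coe.2 le_top)) (hB x)⟩

/-- The mean value inequality is applied to `g` minus half its quadratic part at `v`. Symmetry of
the second derivative makes the derivative of that part equal to `H (y - v)`, so the hypothesis on
`fderiv ℝ g` bounds the remainder. -/
lemma norm_sub_fderiv_sub_fderiv_fderiv_le {g : E3 → ℝ} (hg : ContDiff ℝ 2 g) {B : ℝ}
    (hB0 : 0 ≤ B)
    (hB : ∀ v w, ‖fderiv ℝ g (v + w) - fderiv ℝ g v - fderiv ℝ (fderiv ℝ g) v w‖ ≤ B * ‖w‖ ^ 2)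
    (v w : E3) :
    |g (v + w) - g v - fderiv ℝ g v w - 1 / 2 * fderiv ℝ (fderiv ℝ g) v w w| ≤ B * ‖w‖ ^ 3 := by
  have hsymm : IsSymmSndFDerivAt ℝ g v := hg.contDiffAt.isSymmSndFDerivAt (by simp)
  set H := fderiv ℝ (fderiv ℝ g) v with hH
  have hd : ∀ y, HasFDerivAt (fun y => g y - 1 / 2 * H (y - v) (y - v))
      (fderiv ℝ g y - H (y - v)) y := fun y => by
    have h1 := (hg.differentiable two_ne_zero y).hasFDerivAt
    have h2 : HasFDerivAt (fun y : E3 => y - v) (ContinuousLinearMap.id ℝ E3) y :=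
      (hasFDerivAt_id y).sub_const v
    refine (h1.sub ((H.hasFDerivAt_of_bilinear h2 h2).const_mul (1 / 2))).congr_fderiv ?_
    ext z
    have h3 : H z (y - v) = H (y - v) z := hsymm z (y - v)
    simp [ContinuousLinearMap.precompR, ContinuousLinearMap.precompL]
    simp only [map_sub, sub_apply] at h3 ⊢
    linarith
  have h := (convex_closedBall v ‖w‖).norm_image_sub_le_of_norm_hasFDerivWithin_le'
    (φ := fderiv ℝ g v) (C := B * ‖w‖ ^ 2) (x := v) (y := v + w)
    (fun x _ => (hd x).hasFDerivWithinAt)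
    (fun x hx => by
      have h4 := hB v (x - v)
      rw [add_sub_cancel] at h4
      rw [sub_right_comm]
      refine h4.trans ?_
      gcongr
      exact mem_closedBall_iff_norm.1 hx)
    (Metric.mem_closedBall_self (norm_nonneg _)) (by simp)
  rw [add_sub_cancel_left, sub_self, map_zero, Real.norm_eq_abs] at h
  refine le_trans (le_of_eq ?_) (h.trans (le_of_eq (by ring)))
  congr 1
  simp
  ring

end

/-! ### Comparison with the Landau integrand at fixed relative velocity. -/

section

variable {Φ : E3 → ℝ}

lemma exists_orthonormalBasis_zero_eq {V : E3} (hV : V ≠ 0) :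
    ∃ b : OrthonormalBasis (Fin 3) ℝ E3, b 0 = ‖V‖⁻¹ • V := by
  have hn : ‖‖V‖⁻¹ • V‖ = 1 := by
    rw [norm_smul, norm_inv, norm_norm, inv_mul_cancel₀ (norm_ne_zero_iff.2 hV)]
  obtain ⟨b, hb⟩ := Orthonormal.exists_orthonormalBasis_extension_of_card_eq (𝕜 := ℝ) (E := E3)
    (ι := Fin 3) (by simp) (v := fun _ => ‖V‖⁻¹ • V) (s := {0}) (by
      refine ⟨fun _ => hn, fun i j hij => (hij (Subsingleton.elim _ _)).elim⟩)
  exact ⟨b, hb 0 rfl⟩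

lemma IsPairPotential.collisionIntegrand_eq (hΦ : IsPairPotential Φ) (α : ℝ) (g : E3 → ℝ)
    (v v₁ : E3) (ν : S2) : collisionIntegrand Φ α g v v₁ ν =
      max ⟪(ν : E3), v - v₁⟫ 0 * (g (v + jump Φ (1 / √α) ν (v - v₁)) - g v) := by
  rw [collisionIntegrand]
  rcases lt_or_ge 0 ⟪(ν : E3), v - v₁⟫ with h | h
  · rw [indicator_of_mem (by exact h), hΦ.postVelocity_eq, abs_of_pos h, max_eq_left h.le]
  · rw [indicator_of_notMem (by exact h.not_gt), max_eq_right h, zero_mul]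

lemma laplacian_eq_sum_fderiv (g : E3 → ℝ) (v : E3) (b : OrthonormalBasis (Fin 3) ℝ E3) :
    Δ g v = ∑ i, fderiv ℝ (fderiv ℝ g) v (b i) (b i) := by
  rw [InnerProductSpace.laplacian_eq_iteratedFDeriv_orthonormalBasis g b]
  simp [iteratedFDeriv_two_apply]

lemma landauIntegrand_eq_fderiv (g : E3 → ℝ) (v v₁ : E3) :
    landauIntegrand g v v₁ = 1 / ‖v - v₁‖ ^ 3 * (‖v - v₁‖ ^ 2 *
      ∑ i, fderiv ℝ (fderiv ℝ g) v (EuclideanSpace.basisFun (Fin 3) ℝ i)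
        (EuclideanSpace.basisFun (Fin 3) ℝ i) -
      fderiv ℝ (fderiv ℝ g) v (v - v₁) (v - v₁) - 4 * fderiv ℝ g v (v - v₁)) := by
  rw [landauIntegrand, laplacian_eq_sum_fderiv g v (EuclideanSpace.basisFun (Fin 3) ℝ),
    iteratedFDeriv_two_apply, real_inner_comm, inner_gradient_left]
  rfl

/-- In a basis with first vector along `V` the longitudinal second derivative cancels, which leaves
the form produced by the collision expansion. -/
lemma landauIntegrand_eq {g : E3 → ℝ} {v v₁ : E3} (hV : v - v₁ ≠ 0)
    {b : OrthonormalBasis (Fin 3) ℝ E3} (hb : b 0 = ‖v - v₁‖⁻¹ • (v - v₁)) :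
    landauIntegrand g v v₁ = ‖v - v₁‖⁻¹ * (fderiv ℝ (fderiv ℝ g) v (b 1) (b 1) +
      fderiv ℝ (fderiv ℝ g) v (b 2) (b 2)) - 4 * ‖v - v₁‖⁻¹ ^ 3 * fderiv ℝ g v (v - v₁) := by
  rw [landauIntegrand, laplacian_eq_sum_fderiv g v b, iteratedFDeriv_two_apply, real_inner_comm,
    inner_gradient_left, Fin.sum_univ_three, hb]
  set V := v - v₁
  have hU : ‖V‖ ≠ 0 := norm_ne_zero_iff.2 hV
  simp only [map_smul, smul_apply, smul_eq_mul, Matrix.cons_val_zero,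
    Matrix.cons_val_one]
  field_simp
  ring

lemma collision_integral_self_eq_zero (Φ : E3 → ℝ) (α : ℝ) (g : E3 → ℝ) (v : E3) :
    ∫ ν, collisionIntegrand Φ α g v v ν ∂sphereMeasure = 0 := by
  simp [collisionIntegrand]

lemma landauIntegrand_self (g : E3 → ℝ) (v : E3) : landauIntegrand g v v = 0 := by
  simp [landauIntegrand]

/-- The smaller of the first- and second-order estimates. -/
lemma le_rpow_of_le_of_le {T X C κ u : ℝ} (hC : 0 ≤ C) (hκ : 0 ≤ κ)
    (h1 : T ≤ C * u ^ 2) (h2 : T ≤ C * κ * u ^ 4) (hX : X = κ * u ^ 2) :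
    T ≤ C * u ^ 2 * X ^ (1 / 15 : ℝ) := by
  have hX0 : 0 ≤ X := by rw [hX]; positivity
  rcases le_total 1 X with h | h
  · exact h1.trans (le_mul_of_one_le_right (by positivity) (Real.one_le_rpow h (by norm_num)))
  · refine h2.trans ?_
    calc C * κ * u ^ 4 = C * u ^ 2 * X := by rw [hX]; ring
      _ ≤ C * u ^ 2 * X ^ (1 / 15 : ℝ) := by
        gcongr
        exact Real.self_le_rpow_of_le_one hX0 h (by norm_num)

/-- The collision integrals converge to the Landau operator, at a rate that degenerates
integrably as the relative velocity tends to zero. -/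
lemma IsPairPotential.exists_collision_sub_landau_bounds (hΦ : IsPairPotential Φ)
    {f : E3 → E3 → ℝ} (hf : IsCoreFunction f) : ∃ C : ℝ, 0 < C ∧ ∀ x v v₁,
      |landauIntegrand (f x) v v₁| ≤ C * (1 + ‖v - v₁‖⁻¹) ^ (32 / 15 : ℝ) ∧ ∀ α : ℝ, 0 < α →
      |α * ∫ ν, collisionIntegrand Φ α (f x) v v₁ ν ∂sphereMeasure| ≤
        C * (1 + ‖v - v₁‖⁻¹) ^ (32 / 15 : ℝ) ∧
      |α * (∫ ν, collisionIntegrand Φ α (f x) v v₁ ν ∂sphereMeasure) -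
          landauConst Φ * landauIntegrand (f x) v v₁| ≤
        C * α ^ (-(1 / 30) : ℝ) * (1 + ‖v - v₁‖⁻¹) ^ (32 / 15 : ℝ) := by
  have hu := hf.isCoreFamily
  obtain ⟨B₁, hB₁, h₁⟩ := hu.fderiv_right.exists_bound
  obtain ⟨B₂, hB₂, h₂⟩ := hu.fderiv_right.fderiv_right.exists_bound
  obtain ⟨B₃, hB₃, h₃⟩ := hu.exists_norm_sub_fderiv_le
  obtain ⟨B₄, hB₄, h₄⟩ := hu.fderiv_right.exists_norm_sub_fderiv_le
  obtain ⟨c, hc, hbounds⟩ := hΦ.exists_collision_bounds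
  set B := B₁ + B₂ + B₃ + B₄ with hB
  set A := landauConst Φ with hA
  have hB0 : 0 < B := by positivity
  set C := c * B + (1 + |A|) * (6 * B) with hC
  have hC0 : 0 < C := by positivity
  have hCB : 6 * B ≤ C := by
    have : 0 ≤ c * B + |A| * (6 * B) := by positivity
    rw [hC]; linarith
  have hCc : c * B ≤ C := by
    have : 0 ≤ (1 + |A|) * (6 * B) := by positivity
    rw [hC]; linarith
  refine ⟨C, hC0, fun x v v₁ => ?_⟩
  -- On the diagonal both integrands are zero, and `0⁻¹ = 0` makes the weight on the right equal to
  -- one.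
  rcases eq_or_ne (v - v₁) 0 with hV | hV
  · obtain rfl := sub_eq_zero.1 hV
    simp only [collision_integral_self_eq_zero, landauIntegrand_self, mul_zero, sub_zero, abs_zero]
    exact ⟨by positivity, fun α hα => ⟨by positivity, by positivity⟩⟩
  obtain ⟨b, hb⟩ := exists_orthonormalBasis_zero_eq hV
  set V := v - v₁ with hVdef
  set a := ‖V‖⁻¹ with ha
  have hU : 0 < ‖V‖ := norm_pos_iff.2 hV
  have ha0 : 0 < a := inv_pos.2 hU
  have hUa : ‖V‖ * a = 1 := mul_inv_cancel₀ hU.ne'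
  set p := fderiv ℝ (f x) v with hp
  set H := fderiv ℝ (fderiv ℝ (f x)) v with hH
  have hpB : ‖p‖ ≤ B := (h₁ x v).trans (by rw [hB]; linarith)
  have hHB : ‖H‖ ≤ B := (h₂ x v).trans (by rw [hB]; linarith)
  have hsq : (1 + a) ^ 2 ≤ (1 + a) ^ (32 / 15 : ℝ) := by
    rw [← Real.rpow_natCast]
    exact Real.rpow_le_rpow_of_exponent_le (by linarith) (by norm_num)
  have hL : |landauIntegrand (f x) v v₁| ≤ 6 * B * (1 + a) ^ 2 := by
    have hbi : ∀ i, |H (b i) (b i)| ≤ B := fun i => by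
      refine (H.le_opNorm₂ _ _).trans ?_
      rw [b.norm_eq_one, mul_one, mul_one]
      exact hHB
    have hpV : |p V| ≤ B * ‖V‖ := (p.le_opNorm V).trans (by gcongr)
    rw [landauIntegrand_eq hV hb]
    calc _ ≤ |a * (H (b 1) (b 1) + H (b 2) (b 2))| + |4 * a ^ 3 * p V| := abs_sub _ _
      _ ≤ a * (B + B) + 4 * a ^ 3 * (B * ‖V‖) := by
        rw [abs_mul, abs_mul, abs_of_pos ha0, abs_of_pos (by positivity : 0 < 4 * a ^ 3)]
        gcongr
        exact (abs_add_le _ _).trans (add_le_add (hbi 1) (hbi 2))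
      _ = 2 * B * a + 4 * B * a ^ 2 * (‖V‖ * a) := by ring
      _ = 2 * B * a + 4 * B * a ^ 2 := by rw [hUa, mul_one]
      _ ≤ 6 * B * (1 + a) ^ 2 := by nlinarith [mul_pos hB0 ha0, mul_pos hB0 (sq_pos_of_pos ha0)]
  refine ⟨hL.trans (by gcongr), fun α hα => ?_⟩
  set κ := 1 / √α with hκ
  have hκ0 : 0 < κ := by positivity
  have hακ : α * κ ^ 2 = 1 := by
    rw [hκ, div_pow, Real.sq_sqrt hα.le]
    field_simp
  have hcoll : ∫ ν, collisionIntegrand Φ α (f x) v v₁ ν ∂sphereMeasure =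
      ∫ ν : S2, max ⟪(ν : E3), V⟫ 0 * (f x (v + jump Φ κ ν V) - f x v) ∂sphereMeasure := by
    simp only [hΦ.collisionIntegrand_eq, hκ, hVdef]
  have hcont := (hu.smooth_right x).continuous
  obtain ⟨h5, h6⟩ := hbounds κ hκ0.le V hV (fun w => f x (v + w) - f x v) B p H
    (by fun_prop) hpB hHB
    (fun w => (h₃ x v w).trans (by gcongr; rw [hB]; linarith))
    (fun w => (norm_sub_fderiv_sub_fderiv_fderiv_le
      ((hu.smooth_right x).of_le (WithTop.coe_le_coe.2 le_top)) hB₄.le (h₄ x) v w).trans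
      (by gcongr; rw [hB]; linarith)) b hb
  rw [← landauIntegrand_eq hV hb] at h6
  rw [← hcoll] at h5 h6
  set N := ∫ ν, collisionIntegrand Φ α (f x) v v₁ ν ∂sphereMeasure
  have h7 : |α * N| ≤ c * B * (1 + a) ^ 2 := by
    rw [abs_mul, abs_of_pos hα]
    calc α * |N| ≤ α * (c * B * κ ^ 2 * (1 + a) ^ 2) := by gcongr
      _ = c * B * (1 + a) ^ 2 * (α * κ ^ 2) := by ring
      _ = _ := by rw [hακ, mul_one]
  have h8 : |α * N - A * landauIntegrand (f x) v v₁| ≤ C * (1 + a) ^ 2 := by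
    calc _ ≤ |α * N| + |A * landauIntegrand (f x) v v₁| := abs_sub _ _
      _ ≤ c * B * (1 + a) ^ 2 + |A| * (6 * B * (1 + a) ^ 2) := by
        rw [abs_mul A]
        gcongr
      _ ≤ C * (1 + a) ^ 2 := by
        have : 0 ≤ 6 * B * (1 + a) ^ 2 := by positivity
        rw [hC]
        linarith
  have h9 : |α * N - A * landauIntegrand (f x) v v₁| ≤ C * κ * (1 + a) ^ 4 := by
    have e : α * N - A * landauIntegrand (f x) v v₁ =
        α * (N - κ ^ 2 * (A * landauIntegrand (f x) v v₁)) := by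
      linear_combination (-(A * landauIntegrand (f x) v v₁)) * hακ.symm
    rw [e, abs_mul, abs_of_pos hα]
    calc _ ≤ α * (c * B * κ ^ 3 * (1 + a) ^ 4) := by gcongr
      _ = c * B * κ * (1 + a) ^ 4 * (α * κ ^ 2) := by ring
      _ = c * B * κ * (1 + a) ^ 4 := by rw [hακ, mul_one]
      _ ≤ _ := by gcongr
  refine ⟨h7.trans (by gcongr), ?_⟩
  -- The exponent `1/15` raises the weight from power 2 to `2 + 2/15 = 32/15 < 3` and gives the rate
  -- `κ^(1/15) = α^(-1/30)`.
  refine (le_rpow_of_le_of_le hC0.le hκ0.le h8 h9 rfl).trans (le_of_eq ?_)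
  have e1 : κ ^ (1 / 15 : ℝ) = α ^ (-(1 / 30) : ℝ) := by
    rw [hκ, one_div, Real.sqrt_eq_rpow, ← Real.rpow_neg hα.le, ← Real.rpow_mul hα.le]
    norm_num
  have e2 : (1 + a) ^ 2 * ((1 + a) ^ 2) ^ (1 / 15 : ℝ) = (1 + a) ^ (32 / 15 : ℝ) := by
    rw [← Real.rpow_natCast, ← Real.rpow_mul (by positivity), ← Real.rpow_add (by positivity)]
    norm_num
  rw [Real.mul_rpow hκ0.le (by positivity), e1, ← e2]
  ring

end

/-! ### Maxwellian averages of integrable singularities. -/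

section

variable {β : ℝ}

lemma maxwellian_nonneg (β : ℝ) (v : E3) : 0 ≤ maxwellian β v :=
  mul_nonneg (inv_nonneg.2 (integral_nonneg fun _ => (Real.exp_pos _).le)) (Real.exp_pos _).le

lemma continuous_maxwellian (β : ℝ) : Continuous (maxwellian β) := by
  unfold maxwellian
  fun_prop

lemma exists_maxwellian_le (hβ : 0 < β) : ∃ C : ℝ, 0 ≤ C ∧ ∀ v, maxwellian β v ≤ C := by
  have h : 0 ≤ (∫ w : E3, Real.exp (-(β / 2) * ‖w‖ ^ 2))⁻¹ :=
    inv_nonneg.2 (integral_nonneg fun _ => (Real.exp_pos _).le)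
  refine ⟨_, h, fun v => mul_le_of_le_one_right h (Real.exp_le_one_iff.2 ?_)⟩
  have : 0 ≤ β / 2 * ‖v‖ ^ 2 := by positivity
  linarith

lemma integrable_maxwellian (hβ : 0 < β) : Integrable (maxwellian β) := by
  have h := (GaussianFourier.integrable_cexp_neg_mul_sq_norm_add (V := E3) (b := (β / 2 : ℝ))
    (by simpa using hβ) 0 0).norm
  refine (h.const_mul (∫ w : E3, Real.exp (-(β / 2) * ‖w‖ ^ 2))⁻¹).congr (Eventually.of_forall fun v => ?_)
  simp only [maxwellian, Complex.norm_exp]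
  congr 2
  simp [← Complex.ofReal_pow]

lemma isFiniteMeasure_phaseMeasure (hβ : 0 < β) : IsFiniteMeasure (phaseMeasure β) := by
  have h1 : IsFiniteMeasure (maxwellMeasure β) :=
    isFiniteMeasure_withDensity_ofReal (integrable_maxwellian hβ).2
  have h2 : IsFiniteMeasure ((volume : Measure E3).restrict unitCell) :=
    ⟨by
      rw [Measure.restrict_apply_univ]
      exact (measure_mono unitCell_subset_closedBall).trans_lt measure_closedBall_lt_top⟩
  unfold phaseMeasure
  infer_instance

lemma integrable_indicator_ball_rpow {s : ℝ} (hs : s < 3) :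
    Integrable ((Metric.ball (0 : E3) 1).indicator fun w => ‖w‖ ^ (-s)) := by
  refine (integrable_indicator_iff Metric.isOpen_ball.measurableSet).2
    ((integrableOn_fun_norm_addHaar volume (f := fun r : ℝ => r ^ (-s))).2 ?_)
  have h : IntegrableOn (fun r : ℝ => r ^ (2 - s)) (Ioo 0 1) :=
    (intervalIntegral.integrableOn_Ioo_rpow_iff one_pos).2 (by linarith)
  refine h.congr_fun (fun r hr => ?_) measurableSet_Ioo
  simp only [finrank_euclideanSpace, Fintype.card_fin, smul_eq_mul]
  rw [← Real.rpow_natCast, ← Real.rpow_add hr.1]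
  norm_num [sub_eq_add_neg]

lemma one_add_inv_norm_rpow_le {s : ℝ} (hs : 0 ≤ s) (V : E3) : (1 + ‖V‖⁻¹) ^ s ≤
    2 ^ s * (1 + (Metric.ball (0 : E3) 1).indicator (fun w => ‖w‖ ^ (-s)) V) := by
  by_cases hV : V ∈ Metric.ball (0 : E3) 1
  · rw [indicator_of_mem hV]
    rw [mem_ball_zero_iff] at hV
    rcases eq_or_ne V 0 with rfl | h0
    · rw [norm_zero, inv_zero, add_zero, Real.one_rpow]
      have h1 : (1 : ℝ) ≤ 2 ^ s := Real.one_le_rpow one_le_two hs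
      have h2 : (0 : ℝ) ≤ 0 ^ (-s) := Real.rpow_nonneg le_rfl _
      nlinarith
    · have hU : 0 < ‖V‖ := norm_pos_iff.2 h0
      have h1 : 1 ≤ ‖V‖⁻¹ := (one_le_inv₀ hU).2 hV.le
      calc (1 + ‖V‖⁻¹) ^ s ≤ (2 * ‖V‖⁻¹) ^ s := by gcongr; linarith
        _ = 2 ^ s * ‖V‖ ^ (-s) := by
          rw [Real.mul_rpow zero_le_two (by positivity), Real.inv_rpow hU.le, Real.rpow_neg hU.le]
        _ ≤ _ := by gcongr; linarith
  · rw [indicator_of_notMem hV, add_zero, mul_one]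
    rw [mem_ball_zero_iff, not_lt] at hV
    have h1 : ‖V‖⁻¹ ≤ 1 := inv_le_one_of_one_le₀ hV
    gcongr
    linarith

/-- A Maxwellian average of an integrable singularity is bounded uniformly in its position. -/
lemma exists_integral_maxwellian_mul_le (hβ : 0 < β) {s : ℝ} (hs : 0 ≤ s) (hs3 : s < 3) :
    ∃ C : ℝ, 0 ≤ C ∧ ∀ v : E3,
      Integrable (fun v₁ => maxwellian β v₁ * (1 + ‖v - v₁‖⁻¹) ^ s) ∧
      ∫ v₁, maxwellian β v₁ * (1 + ‖v - v₁‖⁻¹) ^ s ≤ C := by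
  obtain ⟨K, hK, hMK⟩ := exists_maxwellian_le hβ
  set g := (Metric.ball (0 : E3) 1).indicator fun w => ‖w‖ ^ (-s) with hg
  have hg0 : ∀ w, 0 ≤ g w := indicator_nonneg fun w _ => by positivity
  have hgi : Integrable g := integrable_indicator_ball_rpow hs3
  have hM := integrable_maxwellian hβ
  -- Near the singularity the Maxwellian is replaced by its supremum; the translation-invariant
  -- integral of `g` then gives a bound independent of `v`.
  have hbound : ∀ v v₁ : E3, maxwellian β v₁ * (1 + ‖v - v₁‖⁻¹) ^ s ≤
      2 ^ s * (maxwellian β v₁ + K * g (v - v₁)) := fun v v₁ => by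
    calc _ ≤ maxwellian β v₁ * (2 ^ s * (1 + g (v - v₁))) :=
          mul_le_mul_of_nonneg_left (one_add_inv_norm_rpow_le hs _) (maxwellian_nonneg β v₁)
      _ = 2 ^ s * (maxwellian β v₁ + maxwellian β v₁ * g (v - v₁)) := by ring
      _ ≤ _ := by
        have := hg0 (v - v₁)
        have := hMK v₁
        gcongr
  have hi : ∀ v : E3, Integrable fun v₁ => 2 ^ s * (maxwellian β v₁ + K * g (v - v₁)) := fun v =>
    (hM.add ((hgi.comp_sub_left v).const_mul K)).const_mul _
  have hpos : ∀ v v₁ : E3, 0 ≤ maxwellian β v₁ * (1 + ‖v - v₁‖⁻¹) ^ s := fun v v₁ =>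
    mul_nonneg (maxwellian_nonneg β v₁) (by positivity)
  have hint : ∀ v : E3, Integrable fun v₁ => maxwellian β v₁ * (1 + ‖v - v₁‖⁻¹) ^ s := fun v =>
    (hi v).mono' ((continuous_maxwellian β).measurable.mul (by fun_prop)).aestronglyMeasurable
      (Eventually.of_forall fun v₁ => by
        rw [Real.norm_of_nonneg (hpos v v₁)]
        exact hbound v v₁)
  refine ⟨2 ^ s * ((∫ v₁, maxwellian β v₁) + K * ∫ w, g w), ?_, fun v => ⟨hint v, ?_⟩⟩
  · have := integral_nonneg (μ := volume) (f := maxwellian β) (maxwellian_nonneg β)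
    have := integral_nonneg (μ := volume) (f := g) hg0
    positivity
  · refine (integral_mono (hint v) (hi v) (hbound v)).trans (le_of_eq ?_)
    rw [integral_const_mul, integral_add hM ((hgi.comp_sub_left v).const_mul K),
      integral_const_mul, integral_sub_left_eq_self g volume v]

end

/-! ### Measurability, absolute convergence and uniform bounds for the operators. -/

section

variable {Φ : E3 → ℝ} {β : ℝ} {f : E3 → E3 → ℝ}

/-- The flux factor is at most `‖V‖`, which compensates the bound `C κ / ‖V‖` for the jump; at fixed
`α` the integrand is therefore bounded. -/
lemma IsPairPotential.exists_collisionIntegrand_le (hΦ : IsPairPotential Φ)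
    (hf : IsCoreFunction f) (α : ℝ) :
    ∃ C : ℝ, ∀ x v v₁ ν, ‖collisionIntegrand Φ α (f x) v v₁ ν‖ ≤ C := by
  have hu := hf.isCoreFamily
  obtain ⟨B, hB, h₁⟩ := hu.fderiv_right.exists_bound
  obtain ⟨c, hc, hbounds⟩ := hΦ.exists_jump_bounds
  have hκ : 0 ≤ 1 / √α := by positivity
  refine ⟨B * (c * (1 / √α)), fun x v v₁ ν => ?_⟩
  rcases eq_or_ne (v - v₁) 0 with hV | hV
  · obtain rfl := sub_eq_zero.1 hV
    simp only [collisionIntegrand, sub_self, inner_zero_right, lt_self_iff_false]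
    simp
    positivity
  have hU : 0 < ‖v - v₁‖ := norm_pos_iff.2 hV
  rw [hΦ.collisionIntegrand_eq]
  refine (abs_inner_mul_le (V := v - v₁) (M := B * (c * (1 / √α) / ‖v - v₁‖)) (by positivity)
    (X := fun ν => f x (v + jump Φ (1 / √α) ν (v - v₁)) - f x v) (fun ν h => ?_) ν).trans
    (le_of_eq (by field_simp))
  have h2 := convex_univ.norm_image_sub_le_of_norm_fderiv_le
    (fun y _ => (hu.smooth_right x).differentiable (by simp) y) (fun y _ => h₁ x y) (mem_univ v)
    (mem_univ (v + jump Φ (1 / √α) ν (v - v₁)))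
  rw [add_sub_cancel_left] at h2
  refine h2.trans ?_
  gcongr
  exact (hbounds _ hκ ν _ (norm_eq_of_mem_sphere ν) h.le hV).1

lemma IsPairPotential.measurable_collisionIntegrand (hΦ : IsPairPotential Φ)
    (hf : IsCoreFunction f) (α : ℝ) : Measurable fun q : ((E3 × E3) × E3) × S2 =>
      collisionIntegrand Φ α (f q.1.1.1) q.1.1.2 q.1.2 q.2 := by
  have hκ : 0 ≤ 1 / √α := by positivity
  have hν : Measurable fun q : ((E3 × E3) × E3) × S2 => (q.2 : E3) :=
    measurable_subtype_coe.comp measurable_snd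
  have hV : Measurable fun q : ((E3 × E3) × E3) × S2 => q.1.1.2 - q.1.2 := by fun_prop
  have hJ : Measurable fun q : ((E3 × E3) × E3) × S2 =>
      jump Φ (1 / √α) q.2 (q.1.1.2 - q.1.2) := by
    simpa only [Function.comp_def] using (hΦ.measurable_jump hκ).comp (hν.prodMk hV)
  have hfm : Measurable (Function.uncurry f) := hf.isCoreFamily.continuous.measurable
  have h1 : Measurable fun q : ((E3 × E3) × E3) × S2 =>
      f q.1.1.1 (q.1.1.2 + jump Φ (1 / √α) q.2 (q.1.1.2 - q.1.2)) :=
    hfm.comp (measurable_fst.fst.fst.prodMk (measurable_fst.fst.snd.add hJ))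
  have h2 : Measurable fun q : ((E3 × E3) × E3) × S2 => f q.1.1.1 q.1.1.2 :=
    hfm.comp (measurable_fst.fst.fst.prodMk measurable_fst.fst.snd)
  simp only [hΦ.collisionIntegrand_eq]
  exact ((hν.inner hV).max measurable_const).mul (h1.sub h2)

lemma measurable_landauIntegrand (hf : IsCoreFunction f) :
    Measurable fun q : (E3 × E3) × E3 => landauIntegrand (f q.1.1) q.1.2 q.2 := by
  have h1 : Continuous fun q : (E3 × E3) × E3 => fderiv ℝ (f q.1.1) q.1.2 :=
    hf.isCoreFamily.fderiv_right.continuous.comp continuous_fst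
  have h2 : Continuous fun q : (E3 × E3) × E3 => fderiv ℝ (fderiv ℝ (f q.1.1)) q.1.2 :=
    hf.isCoreFamily.fderiv_right.fderiv_right.continuous.comp continuous_fst
  have hV : Continuous fun q : (E3 × E3) × E3 => q.1.2 - q.2 := by fun_prop
  simp only [landauIntegrand_eq_fderiv]
  refine Measurable.mul (by fun_prop) (Continuous.measurable ?_)
  refine ((hV.norm.pow 2).mul (continuous_finsetSum _ fun i _ =>
    (h2.clm_apply continuous_const).clm_apply continuous_const)).sub ((h2.clm_apply hV).clm_apply hV)
      |>.sub ((h1.clm_apply hV).const_mul 4)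

lemma transport_eq (f : E3 → E3 → ℝ) (x v : E3) :
    transport f x v = fderiv ℝ (fun y => f y v) x v := by
  rw [transport, real_inner_comm, inner_gradient_left]

lemma measurable_transport (hf : IsCoreFunction f) :
    Measurable fun z : E3 × E3 => transport f z.1 z.2 := by
  have h1 : Continuous fun z : E3 × E3 => fderiv ℝ (fun y => f y z.2) z.1 :=
    hf.isCoreFamily.fderiv_left.continuous
  simp only [transport_eq]
  exact (h1.clm_apply continuous_snd).measurable

lemma exists_transport_le (hf : IsCoreFunction f) : ∃ C : ℝ, ∀ x v, |transport f x v| ≤ C := by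
  obtain ⟨B, hB, h₁⟩ := hf.isCoreFamily.fderiv_left.exists_bound
  obtain ⟨R, hR⟩ := hf.isCoreFamily.fderiv_left.compactSupport
  refine ⟨B * max R 0, fun x v => ?_⟩
  rw [transport_eq]
  rcases lt_or_ge R ‖v‖ with h | h
  · rw [hR x v h, zero_apply, abs_zero]
    positivity
  · refine (ContinuousLinearMap.le_opNorm (fderiv ℝ (fun y => f y v) x) v).trans ?_
    have := h₁ x v
    gcongr
    exact h.trans (le_max_left _ _)

lemma IsPairPotential.stronglyMeasurable_integral_collisionIntegrand (hΦ : IsPairPotential Φ)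
    (hf : IsCoreFunction f) (α : ℝ) : StronglyMeasurable fun q : (E3 × E3) × E3 =>
      ∫ ν, collisionIntegrand Φ α (f q.1.1) q.1.2 q.2 ν ∂sphereMeasure :=
  (hΦ.measurable_collisionIntegrand hf α).stronglyMeasurable.integral_prod_right'

lemma IsPairPotential.measurable_boltzmannOp (hΦ : IsPairPotential Φ) (hf : IsCoreFunction f)
    (β α : ℝ) : Measurable fun z : E3 × E3 => boltzmannOp Φ β α f z.1 z.2 := by
  have h : StronglyMeasurable fun q : (E3 × E3) × E3 => maxwellian β q.2 *
      ∫ ν, collisionIntegrand Φ α (f q.1.1) q.1.2 q.2 ν ∂sphereMeasure :=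
    ((continuous_maxwellian β).comp continuous_snd).stronglyMeasurable.mul
      (hΦ.stronglyMeasurable_integral_collisionIntegrand hf α)
  exact h.integral_prod_right'.measurable.const_mul α

lemma measurable_landauOp (hf : IsCoreFunction f) (Φ : E3 → ℝ) (β : ℝ) :
    Measurable fun z : E3 × E3 => landauOp Φ β f z.1 z.2 := by
  have h : StronglyMeasurable fun q : (E3 × E3) × E3 =>
      maxwellian β q.2 * landauIntegrand (f q.1.1) q.1.2 q.2 :=
    ((continuous_maxwellian β).comp continuous_snd).stronglyMeasurable.mul
      (measurable_landauIntegrand hf).stronglyMeasurable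
  exact h.integral_prod_right'.measurable.const_mul _

lemma IsPairPotential.integrable_collisionIntegrand (hΦ : IsPairPotential Φ)
    (hf : IsCoreFunction f) (hβ : 0 < β) (α : ℝ) (x v : E3) :
    Integrable (fun p : E3 × S2 => maxwellian β p.1 * collisionIntegrand Φ α (f x) v p.1 p.2)
      (volume.prod sphereMeasure) := by
  obtain ⟨C, hC⟩ := hΦ.exists_collisionIntegrand_le hf α
  have hg : Measurable fun p : E3 × S2 => (((x, v), p.1), p.2) := by fun_prop
  have hm : Measurable fun p : E3 × S2 => collisionIntegrand Φ α (f x) v p.1 p.2 := by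
    simpa only [Function.comp_def] using (hΦ.measurable_collisionIntegrand hf α).comp hg
  refine (((integrable_maxwellian hβ).mul_prod (integrable_const C)).mono'
    (((continuous_maxwellian β).measurable.comp measurable_fst).mul hm).aestronglyMeasurable
    (Eventually.of_forall fun p => ?_))
  rw [norm_mul, Real.norm_of_nonneg (maxwellian_nonneg β _)]
  exact mul_le_mul_of_nonneg_left (hC _ _ _ _) (maxwellian_nonneg β _)

lemma abs_integral_maxwellian_mul_le {T : E3 → ℝ} {C K s : ℝ} (hC : 0 ≤ C) {v : E3}
    (hT : ∀ v₁, |T v₁| ≤ C * (1 + ‖v - v₁‖⁻¹) ^ s)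
    (hi : Integrable fun v₁ => maxwellian β v₁ * (1 + ‖v - v₁‖⁻¹) ^ s)
    (hK : ∫ v₁, maxwellian β v₁ * (1 + ‖v - v₁‖⁻¹) ^ s ≤ K) :
    |∫ v₁, maxwellian β v₁ * T v₁| ≤ C * K := by
  rw [← Real.norm_eq_abs]
  refine (norm_integral_le_of_norm_le (hi.const_mul C) (Eventually.of_forall fun v₁ => ?_)).trans ?_
  · rw [norm_mul, Real.norm_of_nonneg (maxwellian_nonneg β _)]
    exact (mul_le_mul_of_nonneg_left (hT v₁) (maxwellian_nonneg β _)).trans (le_of_eq (by ring))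
  · rw [integral_const_mul]
    gcongr

lemma integrable_maxwellian_mul {T : E3 → ℝ} (hTm : Measurable T) {C s : ℝ} {v : E3}
    (hT : ∀ v₁, |T v₁| ≤ C * (1 + ‖v - v₁‖⁻¹) ^ s)
    (hi : Integrable fun v₁ => maxwellian β v₁ * (1 + ‖v - v₁‖⁻¹) ^ s) :
    Integrable fun v₁ => maxwellian β v₁ * T v₁ := by
  refine (hi.const_mul C).mono'
    ((continuous_maxwellian β).measurable.mul hTm).aestronglyMeasurable
    (Eventually.of_forall fun v₁ => ?_)
  rw [norm_mul, Real.norm_of_nonneg (maxwellian_nonneg β _)]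
  exact (mul_le_mul_of_nonneg_left (hT v₁) (maxwellian_nonneg β _)).trans (le_of_eq (by ring))

/-- The pointwise estimates for the two collision operators. -/
lemma IsPairPotential.exists_operator_bounds (hΦ : IsPairPotential Φ) (hf : IsCoreFunction f)
    (hβ : 0 < β) : ∃ C : ℝ, 0 ≤ C ∧ ∀ x v,
      (Integrable fun v₁ => maxwellian β v₁ * landauIntegrand (f x) v v₁) ∧
      |landauOp Φ β f x v| ≤ C ∧ ∀ α : ℝ, 0 < α → |boltzmannOp Φ β α f x v| ≤ C ∧
        |boltzmannOp Φ β α f x v - landauOp Φ β f x v| ≤ C * α ^ (-(1 / 30) : ℝ) := by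
  obtain ⟨C, hC, hbounds⟩ := hΦ.exists_collision_sub_landau_bounds hf
  obtain ⟨K, hK, hweight⟩ := exists_integral_maxwellian_mul_le hβ (s := 32 / 15) (by norm_num)
    (by norm_num)
  set A := landauConst Φ with hA
  refine ⟨(1 + |A|) * (C * K), by positivity, fun x v => ?_⟩
  obtain ⟨hi, hw⟩ := hweight v
  have hCK : 0 ≤ C * K := by positivity
  have hACK : 0 ≤ |A| * (C * K) := by positivity
  have hg : Measurable fun v₁ : E3 => ((x, v), v₁) := by fun_prop
  have hLm : Measurable fun v₁ => landauIntegrand (f x) v v₁ := by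
    simpa only [Function.comp_def] using (measurable_landauIntegrand hf).comp hg
  have hLi := integrable_maxwellian_mul hLm (fun v₁ => (hbounds x v v₁).1) hi
  refine ⟨hLi, ?_, fun α hα => ?_⟩
  · rw [landauOp, abs_mul]
    have := abs_integral_maxwellian_mul_le hC.le (fun v₁ => (hbounds x v v₁).1) hi hw
    calc _ ≤ |A| * (C * K) := by gcongr
      _ ≤ _ := by linarith
  have hBm : Measurable fun v₁ =>
      α * ∫ ν, collisionIntegrand Φ α (f x) v v₁ ν ∂sphereMeasure := by
    have h := (hΦ.stronglyMeasurable_integral_collisionIntegrand hf α).measurable.comp hg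
    simpa only [Function.comp_def] using h.const_mul α
  have hBi := integrable_maxwellian_mul hBm (fun v₁ => ((hbounds x v v₁).2 α hα).1) hi
  have hB : boltzmannOp Φ β α f x v = ∫ v₁, maxwellian β v₁ *
      (α * ∫ ν, collisionIntegrand Φ α (f x) v v₁ ν ∂sphereMeasure) := by
    rw [boltzmannOp, ← integral_const_mul]
    congr 1 with v₁
    ring
  have hBL : boltzmannOp Φ β α f x v - landauOp Φ β f x v = ∫ v₁, maxwellian β v₁ *
      (α * (∫ ν, collisionIntegrand Φ α (f x) v v₁ ν ∂sphereMeasure) -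
        A * landauIntegrand (f x) v v₁) := by
    rw [hB, landauOp, ← integral_const_mul, ← integral_sub hBi (hLi.const_mul A)]
    congr 1 with v₁
    ring
  constructor
  · rw [hB]
    refine (abs_integral_maxwellian_mul_le hC.le (fun v₁ => ((hbounds x v v₁).2 α hα).1)
      hi hw).trans ?_
    linarith
  · rw [hBL]
    refine (abs_integral_maxwellian_mul_le (by positivity)
      (fun v₁ => ((hbounds x v v₁).2 α hα).2) hi hw).trans ?_
    have := Real.rpow_nonneg hα.le (-(1 / 30))
    calc _ = C * K * α ^ (-(1 / 30) : ℝ) := by ring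
      _ ≤ _ := mul_le_mul_of_nonneg_right (by linarith) this

lemma memH_of_abs_le (hβ : 0 < β) {F : E3 → E3 → ℝ}
    (hm : Measurable fun z : E3 × E3 => F z.1 z.2) {C : ℝ} (hC : ∀ x v, |F x v| ≤ C) :
    MemH β F := by
  have := isFiniteMeasure_phaseMeasure hβ
  exact MemLp.of_bound hm.aestronglyMeasurable C (Eventually.of_forall fun z => hC _ _)

lemma normH_sq_le (hβ : 0 < β) {F : E3 → E3 → ℝ} {C : ℝ} (hC0 : 0 ≤ C)
    (hC : ∀ x v, |F x v| ≤ C) :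
    normH β F ^ 2 ≤ ENNReal.ofReal ((phaseMeasure β).real univ * C ^ 2) := by
  have := isFiniteMeasure_phaseMeasure hβ
  have h : normH β F ≤ phaseMeasure β univ ^ (2 : ℝ)⁻¹ * ENNReal.ofReal C :=
    eLpNorm_le_of_ae_bound (p := 2) (Eventually.of_forall fun z => hC _ _)
  refine (pow_le_pow_left' h 2).trans (le_of_eq ?_)
  rw [mul_pow, ← ENNReal.rpow_natCast, ← ENNReal.rpow_mul, ← ENNReal.ofReal_pow hC0,
    ENNReal.ofReal_mul measureReal_nonneg, ofReal_measureReal]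
  norm_num

end

end

end LinearLandau

/-! ### Conclusion in the Hilbert space. -/

theorem mainTheorem4 (Φ : E3 → ℝ) (hΦ : IsPairPotential Φ) (β : ℝ) (hβ : 0 < β)
    (f : E3 → E3 → ℝ) (hf : IsCoreFunction f) :
    (∀ α : ℝ, 0 < α → ∀ x v : E3,
      Integrable (fun p : E3 × S2 => maxwellian β p.1 * collisionIntegrand Φ α (f x) v p.1 p.2)
        (volume.prod sphereMeasure)) ∧
    (∀ x v : E3, Integrable fun v₁ : E3 => maxwellian β v₁ * landauIntegrand (f x) v v₁) ∧
    (∀ α : ℝ, 0 < α → MemH β (boltzmannGen Φ β α f)) ∧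
    MemH β (landauGen Φ β f) ∧
    Tendsto (fun α : ℝ => normH β (boltzmannGen Φ β α f - landauGen Φ β f)) atTop (𝓝 0) ∧
    ∃ C : ℝ, ∀ α : ℝ, 0 < α →
      normH β (boltzmannGen Φ β α f - landauGen Φ β f) ^ 2
        ≤ ENNReal.ofReal (C * α ^ (-(1 / 15) : ℝ)) := by
  obtain ⟨C, hC, hop⟩ := hΦ.exists_operator_bounds hf hβ
  obtain ⟨T, hT⟩ := exists_transport_le hf
  have hbound : ∀ α : ℝ, 0 < α → normH β (boltzmannGen Φ β α f - landauGen Φ β f) ^ 2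
      ≤ ENNReal.ofReal ((phaseMeasure β).real univ * C ^ 2 * α ^ (-(1 / 15) : ℝ)) := by
    intro α hα
    refine (normH_sq_le hβ (C := C * α ^ (-(1 / 30) : ℝ))
      (mul_nonneg hC (Real.rpow_nonneg hα.le _)) fun x v => ?_).trans (le_of_eq ?_)
    · simp only [Pi.sub_apply, boltzmannGen, landauGen, sub_sub_sub_cancel_right]
      exact ((hop x v).2.2 α hα).2
    · rw [mul_pow, ← Real.rpow_mul_natCast hα.le, mul_assoc]
      norm_num
  refine ⟨fun α _ => hΦ.integrable_collisionIntegrand hf hβ α, fun x v => (hop x v).1,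
    fun α hα => ?_, ?_, ?_, _, hbound⟩
  · exact memH_of_abs_le hβ ((hΦ.measurable_boltzmannOp hf β α).sub (measurable_transport hf))
      fun x v => (abs_sub _ _).trans (add_le_add ((hop x v).2.2 α hα).1 (hT x v))
  · exact memH_of_abs_le hβ ((measurable_landauOp hf Φ β).sub (measurable_transport hf))
      fun x v => (abs_sub _ _).trans (add_le_add (hop x v).2.1 (hT x v))
  · have hlim : Tendsto (fun α : ℝ => ENNReal.ofReal
        ((phaseMeasure β).real univ * C ^ 2 * α ^ (-(1 / 15) : ℝ))) atTop (𝓝 0) := by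
      have h := (tendsto_rpow_neg_atTop (by norm_num : (0 : ℝ) < 1 / 15)).const_mul
        ((phaseMeasure β).real univ * C ^ 2)
      rw [mul_zero] at h
      simpa using ENNReal.tendsto_ofReal h
    have hsq : Tendsto (fun α : ℝ => normH β (boltzmannGen Φ β α f - landauGen Φ β f) ^ 2)
        atTop (𝓝 0) :=
      tendsto_of_tendsto_of_tendsto_of_le_of_le' tendsto_const_nhds hlim
        (Eventually.of_forall fun _ => zero_le)
        ((eventually_gt_atTop 0).mono fun α hα => hbound α hα)
    -- Convergence of the squared norms is converted into convergence of the norms by a square root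
    -- in `ℝ≥0∞`.
    have h := hsq.ennrpow_const (1 / 2)
    refine (h.congr fun α => ?_).trans (by norm_num)
    rw [← ENNReal.rpow_natCast, ← ENNReal.rpow_mul]
    norm_num
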